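/- **The calculus.** Fix base types $\mathsf b$. Ground types are $A ::= \mathsf b \mid \mathsf{unit} \mid A\times B \mid [\tau]A$ and value types are $X ::= A \mid X\times Y \mid X\to Y!\tau \mid [\tau]X$ with $\tau\in\mathbb N$. Fix constants $\mathsf f:(A_1,\dots,A_n)\to B$ and a set $\mathcal O$ of operations $\mathsf{op}:A_{\mathsf{op}}\leadsto B_{\mathsf{op}}!\tau_{\mathsf{op}}$ with ground $A_i,B,A_{\mathsf{op}},B_{\mathsf{op}}$ and $\tau_{\mathsf{op}}\in\mathbb N$. Terms, up to renaming of bound variables, are $$V ::= x \mid \mathsf f(V_1,\dots,V_n)\mid ()\mid (V,W)\mid \mathsf{fun}\,(x{:}X)\mapsto M\mid \mathsf{box}_\tau V,$$ $$M ::= \mathsf{return}\,V\mid \mathsf{let}\,x=M\,\mathsf{in}\,N\mid V\,W\mid \mathsf{match}\,V\,\mathsf{with}\,\{(x,y)\mapsto N\}\mid \mathsf{op}\,V\,(x.M)\mid \mathsf{delay}\,\tau\,M\mid \mathsf{handle}\,M\,\mathsf{with}\,H\,\mathsf{to}\,x\,\mathsf{in}\,N\mid \mathsf{unbox}_\tau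 V\,\mathsf{as}\,x\,\mathsf{in}\,N,$$ with $H=(x.k.M_{\mathsf{op}})_{\mathsf{op}\in\mathcal O}$. Contexts are $\Gamma ::= \cdot\mid\Gamma,x{:}X\mid\Gamma,\langle\tau\rangle$. The time of $\Gamma$ is the sum of its grades $\tau$. The context $\Gamma-\tau$ is given by $\Gamma-0=\Gamma$ and, for $\tau>0$, by $\cdot-\tau=\cdot$, $(\Gamma,x{:}X)-\tau=\Gamma-\tau$, and $(\Gamma,\langle\tau'\rangle)-\tau=\Gamma,\langle\tau'-\tau\rangle$ if $\tau\le\tau'$, and $=\Gamma-(\tau-\tau')$ otherwise. The typing rules are: $x:X$ if $x{:}X$ occurs anywhere in $\Gamma$; the usual rules for constants, unit, pairs, functions, application and $\mathsf{match}$; and - $\Gamma\vdash\mathsf{box}_\tau V:[\tau]X$ if $\Gamma,\langle\tau\rangle\vdash V:X$; - $\Gamma\vdash\mathsf{return}\,V:X!0$ if $\Gamma\vdash V:X$; - $\Gamma\vdash\mathsf{let}\,x=M\,\mathsf{in}\,N:Y!(\tau+\tau')$ if $\Gamma\vdash M:X!\tau$ and $\Gamma,\langle\tau\rangle,x{:}X\vdash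 N:Y!\tau'$; - $\Gamma\vdash\mathsf{op}\,V\,(x.M):X!(\tau_{\mathsf{op}}+\tau)$ if $\Gamma\vdash V:A_{\mathsf{op}}$ and $\Gamma,\langle\tau_{\mathsf{op}}\rangle,x{:}B_{\mathsf{op}}\vdash M:X!\tau$; - $\Gamma\vdash\mathsf{delay}\,\tau\,M:X!(\tau+\tau')$ if $\Gamma,\langle\tau\rangle\vdash M:X!\tau'$; - $\Gamma\vdash\mathsf{handle}\,M\,\mathsf{with}\,H\,\mathsf{to}\,x\,\mathsf{in}\,N:Y!(\tau+\tau')$ if $\Gamma\vdash M:X!\tau$, $\Gamma,\langle\tau\rangle,x{:}X\vdash N:Y!\tau'$, and $\Gamma,x{:}A_{\mathsf{op}},k{:}[\tau_{\mathsf{op}}](B_{\mathsf{op}}\to Y!\tau'')\vdash M_{\mathsf{op}}:Y!(\tau_{\mathsf{op}}+\tau'')$ for all $\mathsf{op}\in\mathcal O$ and $\tau''\in\mathbb N$; - $\Gamma\vdash\mathsf{unbox}_\tau V\,\mathsf{as}\,x\,\mathsf{in}\,N:Y!\tau'$ if $\tau\le\mathrm{time}(\Gamma)$, $\Gamma-\tau\vdash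 V:[\tau]X$ and $\Gamma,x{:}X\vdash N:Y!\tau'$. **The equational theory** has judgements $\Gamma\vdash V\equiv W:X$ and $\Gamma\vdash M\equiv N:X!\tau$ between well-typed terms. It is generated by the equivalence, congruence and substitutivity rules (from $\Gamma,x{:}X,\Gamma'\vdash I\equiv J$ and $\Gamma\vdash V\equiv W:X$ infer $\Gamma,\Gamma'\vdash I[V/x]\equiv J[W/x]$) and by - $()\equiv V:\mathsf{unit}$; $\ \mathsf{fun}(x{:}X)\mapsto V\,x\equiv V$; $\ (\mathsf{fun}(x{:}X)\mapsto M)\,V\equiv M[V/x]$; - $\mathsf{match}\,(V,W)\,\mathsf{with}\{(x,y)\mapsto N\}\equiv N[V/x,W/y]$; $\ \mathsf{match}\,V\,\mathsf{with}\{(x,y)\mapsto N[(x,y)/z]\}\equiv N[V/z]$; - $\mathsf{let}\,x=\mathsf{return}\,V\,\mathsf{in}\,N\equiv N[V/x]$; $\ \mathsf{let}\,y=(\mathsf{let}\,x=M\,\mathsf{in}\,N)\,\mathsf{in}\,P\equiv\mathsf{let}\,x=M\,\mathsf{in}\,(\mathsf{let}\,y=N\,\mathsf{in}\,P)$; $\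 \mathsf{let}\,x=M\,\mathsf{in}\,\mathsf{return}\,x\equiv M$; - $\mathsf{let}\,x=(\mathsf{op}\,V\,(y.M))\,\mathsf{in}\,N\equiv\mathsf{op}\,V\,(y.\,\mathsf{let}\,x=M\,\mathsf{in}\,N)$; $\ \mathsf{let}\,x=(\mathsf{delay}\,\tau\,M)\,\mathsf{in}\,N\equiv\mathsf{delay}\,\tau\,(\mathsf{let}\,x=M\,\mathsf{in}\,N)$; - $\mathsf{handle}\,(\mathsf{return}\,V)\,\mathsf{with}\,H\,\mathsf{to}\,x\,\mathsf{in}\,N\equiv N[V/x]$; - $\mathsf{handle}\,(\mathsf{op}\,V\,(y.M))\,\mathsf{with}\,H\,\mathsf{to}\,x\,\mathsf{in}\,N\equiv M_{\mathsf{op}}[V/x,\ \mathsf{box}_{\tau_{\mathsf{op}}}(\mathsf{fun}(y{:}B_{\mathsf{op}})\mapsto\mathsf{handle}\,M\,\mathsf{with}\,H\,\mathsf{to}\,x\,\mathsf{in}\,N)/k]$; - $\mathsf{handle}\,(\mathsf{delay}\,\tau\,M)\,\mathsf{with}\,H\,\mathsf{to}\,x\,\mathsf{in}\,N\equiv\mathsf{delay}\,\tau\,(\mathsf{handle}\,M\,\mathsf{with}\,H\,\mathsf{to}\,x\,\mathsf{in}\,N)$;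 - $\mathsf{unbox}_\tau(\mathsf{box}_\tau V)\,\mathsf{as}\,x\,\mathsf{in}\,N\equiv N[V/x]$; $\ \mathsf{unbox}_\tau V\,\mathsf{as}\,x\,\mathsf{in}\,N[\mathsf{box}_\tau x/y]\equiv N[V/y]$. **Models.** A model is a cartesian closed category $\mathbb C$ (exponentials $\Rightarrow$) with products indexed by $\mathbb N$ and by $\mathcal O$, together with the following data. 1. A functor $[-]:(\mathbb N,\le)\to[\mathbb C,\mathbb C]$ with natural isomorphisms $\varepsilon:[0]A\cong A$ and $\delta:[\tau_1+\tau_2]A\cong[\tau_1][\tau_2]A$ satisfying the graded comonad laws, with $\delta$ natural in $\tau_1,\tau_2$. A functor $\langle-\rangle:(\mathbb N,\le)^{\mathrm{op}}\to[\mathbb C,\mathbb C]$ with natural isomorphisms $\eta:A\cong\langle0\rangle A$ and $\mu:\langle\tau_1\rangle\langle\tau_2\rangle A\cong\langle\tau_1+\tau_2\rangle A$ satisfying the graded monad laws, with $\mu$ natural in $\tau_1,\tau_2$. 2. Adjunctions $\langle\tau\rangle\dashv[\tau]$ with unit $\eta^\dashv_\tau$ and counit $\varepsilon^\dashv_\tau$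 such that $[\tau](\langle0\le\tau\rangle)\circ\eta^\dashv_{\tau}\circ\eta^{-1}\circ\varepsilon=[0\le\tau]$, $\ \langle0\rangle([0\le\tau])\circ\eta\circ\varepsilon^{-1}\circ\varepsilon^\dashv_{\tau}=\langle0\le\tau\rangle$, $\ [\tau_1][\tau_2](\mu)\circ[\tau_1](\eta^\dashv_{\tau_2})\circ\eta^\dashv_{\tau_1}=\delta\circ\eta^\dashv_{\tau_1+\tau_2}$ and $\varepsilon^\dashv_{\tau_1}\circ\langle\tau_1\rangle(\varepsilon^\dashv_{\tau_2})\circ\langle\tau_1\rangle\langle\tau_2\rangle(\delta)=\varepsilon^\dashv_{\tau_1+\tau_2}\circ\mu$. Write $\mathsf m:[\tau]A\times[\tau]B\to[\tau](A\times B)$ for the canonical isomorphism and $\varepsilon^{\langle\rangle}=\eta^{-1}\circ\langle0\le\tau\rangle:\langle\tau\rangle A\to A$. 3. Functors $T\,\tau:\mathbb C\to\mathbb C$ ($\tau\in\mathbb N$) and natural transformations $\eta^T:A\to T\,0\,A$, $\mu^T:T\,\tau_1(T\,\tau_2\,A)\to T(\tau_1+\tau_2)A$ and $\mathsf{str}:[\tau]A\times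 T\,\tau\,B\to T\,\tau(A\times B)$ satisfying the graded monad laws and, with $\alpha$ the associativity isomorphism, $\mathsf{str}\circ(\varepsilon^{-1}\times\eta^T)=\eta^T$, $\mu^T\circ T(\mathsf{str})\circ\mathsf{str}=\mathsf{str}\circ(\delta^{-1}\times\mu^T)$, $T(\mathsf{snd})\circ\mathsf{str}=\mathsf{snd}$, $T(\alpha)\circ\mathsf{str}\circ(\mathsf m\times\mathrm{id})\circ\alpha^{-1}=\mathsf{str}\circ(\mathrm{id}\times\mathsf{str})$. 4. Objects $[\![\mathsf b]\!]$. These determine objects $[\![X]\!]$: unit and product types are terminal objects and products, $[\![X\to Y!\tau]\!]=[\![X]\!]\Rightarrow T\,\tau\,[\![Y]\!]$ and $[\![[\tau]X]\!]=[\tau][\![X]\!]$. Morphisms $[\![\mathsf f]\!]:[\![A_1]\!]\times\dots\times[\![A_n]\!]\to[\![B]\!]$. 5. Transformations natural in $A$, $\mathsf{op}^T:[\![A_{\mathsf{op}}]\!]\times[\tau_{\mathsf{op}}]([\![B_{\mathsf{op}}]\!]\Rightarrow T\,\tau\,A)\to T(\tau_{\mathsf{op}}+\tau)A$ and $\mathsf{delay}^T_{\tau,\tau'}:[\tau](T\,\tau'\,A)\to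 T(\tau+\tau')A$, that commute with $\mu^T$ and with $\mathsf{str}$; for instance $\mathsf{str}\circ(\mathrm{id}\times\mathsf{delay}^T)=\mathsf{delay}^T\circ[\tau](\mathsf{str})\circ\mathsf m\circ(\delta\times\mathrm{id})$. 6. Handling morphisms $\chi_{A,\tau,\tau'}:\mathcal H_A\to\big(T\,\tau(T\,\tau'A)\Rightarrow T(\tau+\tau')A\big)$ for all objects $A$, where $\mathcal H_A=\prod_{\mathsf{op}}\prod_{\tau''}\big([\![A_{\mathsf{op}}]\!]\times[\tau_{\mathsf{op}}]([\![B_{\mathsf{op}}]\!]\Rightarrow T\,\tau''A)\big)\Rightarrow T(\tau_{\mathsf{op}}+\tau'')A$. In elementwise notation: $\chi(h,\eta^T(a))=a$; $\ \chi(h,\mathsf{delay}^T(t))=\mathsf{delay}^T$ applied to $\chi(h,-)$ under $[\tau]$ on $t$; and $\chi_{A,\tau_{\mathsf{op}}+\tau,\tau'}(h,\mathsf{op}^T(a,\kappa))=h_{\mathsf{op},\tau+\tau'}(a,\kappa')$, where $\kappa'$ is $\kappa$ postcomposed, under $[\tau_{\mathsf{op}}]$ and $[\![B_{\mathsf{op}}]\!]\Rightarrow(-)$,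 with $\chi_{A,\tau,\tau'}(h,-)$; here $h$ is moved under $[\tau]$ by $\eta^\dashv$, $\mathsf m$ and $\varepsilon^{\langle\rangle}$. **Interpretation.** Contexts are functors $[\![\cdot]\!]A=A$, $[\![\Gamma,x{:}X]\!]A=[\![\Gamma]\!]A\times[\![X]\!]$, $[\![\Gamma,\langle\tau\rangle]\!]A=\langle\tau\rangle([\![\Gamma]\!]A)$. Typing derivations of values and computations are interpreted by recursion as morphisms $[\![\Gamma]\!]\mathbb 1\to[\![X]\!]$ and $[\![\Gamma]\!]\mathbb 1\to T\,\tau\,[\![X]\!]$. Unit, pairs, functions, application, constants and $\mathsf{match}$ use the cartesian closed structure. A variable collapses the modalities to its right by $\mu$ and $\eta$, followed by $\varepsilon^{\langle\rangle}$ and $\mathsf{snd}$. Moreover (with the grades of the premises as in the typing rules) - $[\![\mathsf{box}_\tau V]\!]=[\tau]([\![V]\!])\circ\eta^\dashv$, $\ [\![\mathsf{return}\,V]\!]=\eta^T\circ[\![V]\!]$, $\ [\![\mathsf{let}\,x=M\,\mathsf{in}\,N]\!]=\mu^T\circ T([\![N]\!])\circ\mathsf{str}\circ\langle\eta^\dashv,[\![M]\!]\rangle$;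 - $[\![\mathsf{op}\,V(x.M)]\!]=\mathsf{op}^T\circ(\mathrm{id}\times[\tau_{\mathsf{op}}](\mathsf{curry}[\![M]\!]))\circ\langle[\![V]\!],\eta^\dashv\rangle$, $\ [\![\mathsf{delay}\,\tau\,M]\!]=\mathsf{delay}^T\circ[\tau]([\![M]\!])\circ\eta^\dashv$; - $[\![\mathsf{handle}\,M\,\mathsf{with}\,H\,\mathsf{to}\,x\,\mathsf{in}\,N]\!]=\mathsf{uncurry}(\chi)\circ\langle[\![H]\!],\,T([\![N]\!])\circ\mathsf{str}\circ\langle\eta^\dashv,[\![M]\!]\rangle\rangle$, where $[\![H]\!]$ is the tuple of the curried interpretations of the clauses at all grades $\tau''$; - $[\![\mathsf{unbox}_\tau V\,\mathsf{as}\,x\,\mathsf{in}\,N]\!]=[\![N]\!]\circ\langle\mathrm{id},\varepsilon^\dashv\circ\langle\tau\rangle([\![V]\!])\circ\eta^{\mathrm{PRA}}\rangle$, where $\eta^{\mathrm{PRA}}:[\![\Gamma]\!]A\to\langle\tau\rangle([\![\Gamma-\tau]\!]A)$ for $\tau\le\mathrm{time}(\Gamma)$ collapses $\tau$ worth of modalities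 of $\Gamma$ by projections, $\eta$, $\mu$ and $\mu^{-1}$. **Theorem (soundness).** In every model, if $\Gamma\vdash I\equiv J:X$ (for values) or $\Gamma\vdash I\equiv J:X!\tau$ (for computations) is derivable in the equational theory, then $I$ and $J$ are well-typed in $\Gamma$ at that type, and $[\![I]\!]=[\![J]\!]$, whichever typing derivations of $I$ and $J$ at that type are used to compute the interpretations. -/

import Mathlib

universe u v w

open CategoryTheory

namespace LambdaTau

/-! ## Types -/

/-- Ground types over a set of base types. -/
inductive GTy (B : Type u) : Type u
  | base (b : B) : GTy B
  | unit : GTy B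
  | prod (X Y : GTy B) : GTy B
  | box (τ : ℕ) (X : GTy B) : GTy B

/-- Value types. `fn X Y τ` is the type of functions from `X` to computations returning `Y` and
taking `τ` units of time; `box τ X` is the temporal resource type. -/
inductive VTy (B : Type u) : Type u
  | base (b : B) : VTy B
  | unit : VTy B
  | prod (X Y : VTy B) : VTy B
  | fn (X Y : VTy B) (τ : ℕ) : VTy B
  | box (τ : ℕ) (X : VTy B) : VTy B

/-- Every ground type is a value type. -/
def GTy.toVTy {B : Type u} : GTy B → VTy B
  | .base b => .base b
  | .unit => .unit
  | .prod X Y => .prod X.toVTy Y.toVTy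
  | .box τ X => .box τ X.toVTy

/-- A signature: base types, constants `f : (A₁, …, Aₙ) → B` and operations `o : A ⇝ B ! τ`,
typed with ground types. -/
structure Signature where
  Base : Type u
  Const : Type u
  arity : Const → ℕ
  constDom : (f : Const) → Fin (arity f) → GTy Base
  constCod : Const → GTy Base
  Op : Type u
  opArg : Op → GTy Base
  opRes : Op → GTy Base
  opTime : Op → ℕ

/-- The argument type of an operation, as a value type. -/
abbrev Signature.argTy (S : Signature.{u}) (o : S.Op) : VTy S.Base := (S.opArg o).toVTy

/-- The result type of an operation, as a value type. -/
abbrev Signature.resTy (S : Signature.{u}) (o : S.Op) : VTy S.Base := (S.opRes o).toVTy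

/-! ## Raw terms, up to renaming of bound variables (de Bruijn indices) -/

mutual

/-- Values. `lam X M` binds one variable in `M`. -/
inductive Val (S : Signature.{u}) : Type u
  | var (i : ℕ) : Val S
  | const (f : S.Const) (Vs : Fin (S.arity f) → Val S) : Val S
  | unit : Val S
  | pair (V W : Val S) : Val S
  | lam (X : VTy S.Base) (M : Comp S) : Val S
  | box (τ : ℕ) (V : Val S) : Val S

/-- Computations.
* `letin M N` is `let x = M in N`, where `N` binds `x`;
* `split V N` is `match V with {(x, y) ↦ N}`, where `N` binds `x` (index 1) and `y` (index 0);
* `op o V M` is `op V (x . M)`, where `M` binds `x`;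
* `handle M H N` is `handle M with H to x in N`, where `N` binds `x`, and the clause `H o` binds
  the parameter `x` (index 1) and the continuation `k` (index 0);
* `unbox τ V N` is `unbox_τ V as x in N`, where `N` binds `x`. -/
inductive Comp (S : Signature.{u}) : Type u
  | ret (V : Val S) : Comp S
  | letin (M N : Comp S) : Comp S
  | app (V W : Val S) : Comp S
  | split (V : Val S) (N : Comp S) : Comp S
  | op (o : S.Op) (V : Val S) (M : Comp S) : Comp S
  | delay (τ : ℕ) (M : Comp S) : Comp S
  | handle (M : Comp S) (H : S.Op → Comp S) (N : Comp S) : Comp S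
  | unbox (τ : ℕ) (V : Val S) (N : Comp S) : Comp S

end

/-- Lifting a renaming of indices under one binder. -/
def liftRen (ρ : ℕ → ℕ) : ℕ → ℕ
  | 0 => 0
  | i + 1 => ρ i + 1

mutual

/-- Renaming in values. -/
def Val.rename {S : Signature.{u}} : (ℕ → ℕ) → Val S → Val S
  | ρ, .var i => .var (ρ i)
  | ρ, .const f Vs => .const f (fun i => (Vs i).rename ρ)
  | _, .unit => .unit
  | ρ, .pair V W => .pair (V.rename ρ) (W.rename ρ)
  | ρ, .lam X M => .lam X (M.rename (liftRen ρ))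
  | ρ, .box τ V => .box τ (V.rename ρ)

/-- Renaming in computations. -/
def Comp.rename {S : Signature.{u}} : (ℕ → ℕ) → Comp S → Comp S
  | ρ, .ret V => .ret (V.rename ρ)
  | ρ, .letin M N => .letin (M.rename ρ) (N.rename (liftRen ρ))
  | ρ, .app V W => .app (V.rename ρ) (W.rename ρ)
  | ρ, .split V N => .split (V.rename ρ) (N.rename (liftRen (liftRen ρ)))
  | ρ, .op o V M => .op o (V.rename ρ) (M.rename (liftRen ρ))
  | ρ, .delay τ M => .delay τ (M.rename ρ)
  | ρ, .handle M H N => .handle (M.rename ρ) (fun o => (H o).rename (liftRen (liftRen ρ)))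
      (N.rename (liftRen ρ))
  | ρ, .unbox τ V N => .unbox τ (V.rename ρ) (N.rename (liftRen ρ))

end

/-- Lifting a simultaneous substitution under one binder. -/
def liftSub {S : Signature.{u}} (σ : ℕ → Val S) : ℕ → Val S
  | 0 => .var 0
  | i + 1 => (σ i).rename Nat.succ

mutual

/-- Simultaneous capture-avoiding substitution in values. -/
def Val.subst {S : Signature.{u}} : (ℕ → Val S) → Val S → Val S
  | σ, .var i => σ i
  | σ, .const f Vs => .const f (fun i => (Vs i).subst σ)
  | _, .unit => .unit
  | σ, .pair V W => .pair (V.subst σ) (W.subst σ)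
  | σ, .lam X M => .lam X (M.subst (liftSub σ))
  | σ, .box τ V => .box τ (V.subst σ)

/-- Simultaneous capture-avoiding substitution in computations. -/
def Comp.subst {S : Signature.{u}} : (ℕ → Val S) → Comp S → Comp S
  | σ, .ret V => .ret (V.subst σ)
  | σ, .letin M N => .letin (M.subst σ) (N.subst (liftSub σ))
  | σ, .app V W => .app (V.subst σ) (W.subst σ)
  | σ, .split V N => .split (V.subst σ) (N.subst (liftSub (liftSub σ)))
  | σ, .op o V M => .op o (V.subst σ) (M.subst (liftSub σ))
  | σ, .delay τ M => .delay τ (M.subst σ)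
  | σ, .handle M H N => .handle (M.subst σ) (fun o => (H o).subst (liftSub (liftSub σ)))
      (N.subst (liftSub σ))
  | σ, .unbox τ V N => .unbox τ (V.subst σ) (N.subst (liftSub σ))

end

/-- The substitution `[V/x]` for the last variable `x` of a context. -/
def sub1 {S : Signature.{u}} (V : Val S) : ℕ → Val S
  | 0 => V
  | i + 1 => .var i

/-- The substitution `[V/x, W/y]` for the last two variables `x, y` of a context. -/
def sub2 {S : Signature.{u}} (V W : Val S) : ℕ → Val S
  | 0 => W
  | 1 => V
  | i + 2 => .var i

/-- The substitution `[V/x]` for a variable `x` that is followed by `n` further variables. -/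
def subAt {S : Signature.{u}} (V : Val S) : ℕ → ℕ → Val S
  | 0 => sub1 V
  | n + 1 => liftSub (subAt V n)

/-- The substitution `[V/z]`, from terms over `Γ, z` to terms over `Γ, x`, for a value `V`
over `Γ, x`. -/
def subOver1 {S : Signature.{u}} (V : Val S) : ℕ → Val S
  | 0 => V
  | i + 1 => .var (i + 1)

/-- The substitution `[V/z]`, from terms over `Γ, z` to terms over `Γ, x, y`, for a value `V`
over `Γ, x, y`. -/
def subOver2 {S : Signature.{u}} (V : Val S) : ℕ → Val S
  | 0 => V
  | i + 1 => .var (i + 2)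

/-! ## Contexts -/

/-- Temporal typing contexts: `var Γ X` is `Γ, x : X` and `mod Γ τ` is `Γ, ⟨τ⟩`.
Variables are referred to by position, so removing a variable from the right of a context must not
renumber those before it. The entry `gap Γ` stands for `Γ` itself, together with one position
that no term can refer to: it is what is left behind when a variable is removed. -/
inductive Ctx (B : Type u) : Type u
  | nil : Ctx B
  | var (Γ : Ctx B) (X : VTy B) : Ctx B
  | mod (Γ : Ctx B) (τ : ℕ) : Ctx B
  | gap (Γ : Ctx B) : Ctx B

/-- The time captured by a context. -/
def Ctx.time {B : Type u} : Ctx B → ℕ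
  | .nil => 0
  | .var Γ _ => Γ.time
  | .mod Γ τ => Γ.time + τ
  | .gap Γ => Γ.time

/-- The time travelling operation `Γ - τ`; a removed variable leaves a gap. -/
def Ctx.minus {B : Type u} : Ctx B → ℕ → Ctx B
  | Γ, 0 => Γ
  | .nil, _ + 1 => .nil
  | .var Γ _, τ + 1 => .gap (Γ.minus (τ + 1))
  | .gap Γ, τ + 1 => .gap (Γ.minus (τ + 1))
  | .mod Γ τ', τ + 1 =>
      if τ + 1 ≤ τ' then .mod Γ (τ' - (τ + 1)) else Γ.minus (τ + 1 - τ')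

/-- Concatenation of contexts `Γ, Γ'`. -/
def Ctx.append {B : Type u} (Γ : Ctx B) : Ctx B → Ctx B
  | .nil => Γ
  | .var Γ' X => .var (Γ.append Γ') X
  | .mod Γ' τ => .mod (Γ.append Γ') τ
  | .gap Γ' => .gap (Γ.append Γ')

/-- The number of variable positions of a context. -/
def Ctx.length {B : Type u} : Ctx B → ℕ
  | .nil => 0
  | .var Γ _ => Γ.length + 1
  | .mod Γ _ => Γ.length
  | .gap Γ => Γ.length + 1

/-- `Lookup Γ i X`: the context `Γ` has the form `Γ₁, x : X, Γ₂`, and the variable `x` is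
at position `i`, counted from the right. -/
inductive Lookup {B : Type u} : Ctx B → ℕ → VTy B → Type u
  | here {Γ : Ctx B} {X : VTy B} : Lookup (.var Γ X) 0 X
  | var {Γ : Ctx B} {i : ℕ} {X Y : VTy B} : Lookup Γ i X → Lookup (.var Γ Y) (i + 1) X
  | mod {Γ : Ctx B} {i : ℕ} {X : VTy B} {τ : ℕ} : Lookup Γ i X → Lookup (.mod Γ τ) i X
  | gap {Γ : Ctx B} {i : ℕ} {X : VTy B} : Lookup Γ i X → Lookup (.gap Γ) (i + 1) X

/-- The part `Γ₁` of `Γ₁, x : X, Γ₂`. -/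
def Lookup.before {B : Type u} : {Γ : Ctx B} → {i : ℕ} → {X : VTy B} → Lookup Γ i X → Ctx B
  | .var Γ _, _, _, .here => Γ
  | _, _, _, .var v => v.before
  | _, _, _, .mod v => v.before
  | _, _, _, .gap v => v.before

/-- The part `Γ₂` of `Γ₁, x : X, Γ₂`. -/
def Lookup.after {B : Type u} : {Γ : Ctx B} → {i : ℕ} → {X : VTy B} → Lookup Γ i X → Ctx B
  | _, _, _, .here => .nil
  | .var _ Y, _, _, .var v => .var v.after Y
  | .mod _ τ, _, _, .mod v => .mod v.after τ
  | _, _, _, .gap v => .gap v.after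

/-! ## Typing derivations -/

mutual

/-- Derivations of `Γ ⊢ V : X`. -/
inductive HasV (S : Signature.{u}) : Ctx S.Base → Val S → VTy S.Base → Type u
  | var {Γ : Ctx S.Base} {i : ℕ} {X : VTy S.Base} :
      Lookup Γ i X → HasV S Γ (.var i) X
  | const {Γ : Ctx S.Base} (f : S.Const) {Vs : Fin (S.arity f) → Val S} :
      (∀ i, HasV S Γ (Vs i) (S.constDom f i).toVTy) →
      HasV S Γ (.const f Vs) (S.constCod f).toVTy
  | unit {Γ : Ctx S.Base} : HasV S Γ .unit .unit
  | pair {Γ : Ctx S.Base} {V W : Val S} {X Y : VTy S.Base} :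
      HasV S Γ V X → HasV S Γ W Y → HasV S Γ (.pair V W) (.prod X Y)
  | lam {Γ : Ctx S.Base} {X Y : VTy S.Base} {M : Comp S} {τ : ℕ} :
      HasC S (.var Γ X) M Y τ → HasV S Γ (.lam X M) (.fn X Y τ)
  | box {Γ : Ctx S.Base} {V : Val S} {X : VTy S.Base} {τ : ℕ} :
      HasV S (.mod Γ τ) V X → HasV S Γ (.box τ V) (.box τ X)

/-- Derivations of `Γ ⊢ M : X ! τ`. -/
inductive HasC (S : Signature.{u}) : Ctx S.Base → Comp S → VTy S.Base → ℕ → Type u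
  | ret {Γ : Ctx S.Base} {V : Val S} {X : VTy S.Base} :
      HasV S Γ V X → HasC S Γ (.ret V) X 0
  | letin {Γ : Ctx S.Base} {M N : Comp S} {X Y : VTy S.Base} {τ τ' : ℕ} :
      HasC S Γ M X τ → HasC S (.var (.mod Γ τ) X) N Y τ' →
      HasC S Γ (.letin M N) Y (τ + τ')
  | app {Γ : Ctx S.Base} {V W : Val S} {X Y : VTy S.Base} {τ : ℕ} :
      HasV S Γ V (.fn X Y τ) → HasV S Γ W X → HasC S Γ (.app V W) Y τ
  | split {Γ : Ctx S.Base} {V : Val S} {N : Comp S} {X Y Z : VTy S.Base} {τ : ℕ} :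
      HasV S Γ V (.prod X Y) → HasC S (.var (.var Γ X) Y) N Z τ →
      HasC S Γ (.split V N) Z τ
  | op {Γ : Ctx S.Base} (o : S.Op) {V : Val S} {M : Comp S} {X : VTy S.Base} {τ : ℕ} :
      HasV S Γ V (S.argTy o) →
      HasC S (.var (.mod Γ (S.opTime o)) (S.resTy o)) M X τ →
      HasC S Γ (.op o V M) X (S.opTime o + τ)
  | delay {Γ : Ctx S.Base} {M : Comp S} {X : VTy S.Base} {τ τ' : ℕ} :
      HasC S (.mod Γ τ) M X τ' → HasC S Γ (.delay τ M) X (τ + τ')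
  | handle {Γ : Ctx S.Base} {M N : Comp S} {H : S.Op → Comp S} {X Y : VTy S.Base} {τ τ' : ℕ} :
      HasC S Γ M X τ → HasC S (.var (.mod Γ τ) X) N Y τ' →
      (∀ (o : S.Op) (τ'' : ℕ),
        HasC S (.var (.var Γ (S.argTy o)) (.box (S.opTime o) (.fn (S.resTy o) Y τ'')))
          (H o) Y (S.opTime o + τ'')) →
      HasC S Γ (.handle M H N) Y (τ + τ')
  | unbox {Γ : Ctx S.Base} {V : Val S} {N : Comp S} {X Y : VTy S.Base} {τ τ' : ℕ} :
      τ ≤ Γ.time → HasV S (Γ.minus τ) V (.box τ X) → HasC S (.var Γ X) N Y τ' →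
      HasC S Γ (.unbox τ V N) Y τ'

end

/-! ## Equational theory -/

mutual

/-- Derivable equations `Γ ⊢ V ≡ W : X` between well-typed values. -/
inductive EqV (S : Signature.{u}) : Ctx S.Base → Val S → Val S → VTy S.Base → Prop
  -- equivalence
  | refl {Γ : Ctx S.Base} {V : Val S} {X : VTy S.Base} : HasV S Γ V X → EqV S Γ V V X
  | symm {Γ : Ctx S.Base} {V W : Val S} {X : VTy S.Base} : EqV S Γ V W X → EqV S Γ W V X
  | trans {Γ : Ctx S.Base} {U V W : Val S} {X : VTy S.Base} :
      EqV S Γ U V X → EqV S Γ V W X → EqV S Γ U W X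
  -- congruence
  | const {Γ : Ctx S.Base} (f : S.Const) {Vs Ws : Fin (S.arity f) → Val S} :
      (∀ i, EqV S Γ (Vs i) (Ws i) (S.constDom f i).toVTy) →
      EqV S Γ (.const f Vs) (.const f Ws) (S.constCod f).toVTy
  | pair {Γ : Ctx S.Base} {V V' W W' : Val S} {X Y : VTy S.Base} :
      EqV S Γ V V' X → EqV S Γ W W' Y → EqV S Γ (.pair V W) (.pair V' W') (.prod X Y)
  | lam {Γ : Ctx S.Base} {X Y : VTy S.Base} {M M' : Comp S} {τ : ℕ} :
      EqC S (.var Γ X) M M' Y τ → EqV S Γ (.lam X M) (.lam X M') (.fn X Y τ)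
  | box {Γ : Ctx S.Base} {V V' : Val S} {X : VTy S.Base} {τ : ℕ} :
      EqV S (.mod Γ τ) V V' X → EqV S Γ (.box τ V) (.box τ V') (.box τ X)
  -- substitutivity
  | subst {Γ Γ' : Ctx S.Base} {V W I J : Val S} {X Y : VTy S.Base} :
      EqV S ((Ctx.var Γ X).append Γ') I J Y → EqV S Γ V W X →
      EqV S (Γ.append Γ') (I.subst (subAt V Γ'.length)) (J.subst (subAt W Γ'.length)) Y
  -- `() ≡ V`
  | unit_eta {Γ : Ctx S.Base} {V : Val S} : HasV S Γ V .unit → EqV S Γ .unit V .unit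
  -- `fun (x : X) ↦ V x ≡ V`
  | fn_eta {Γ : Ctx S.Base} {V : Val S} {X Y : VTy S.Base} {τ : ℕ} :
      HasV S Γ V (.fn X Y τ) →
      EqV S Γ (.lam X (.app (V.rename Nat.succ) (.var 0))) V (.fn X Y τ)

/-- Derivable equations `Γ ⊢ M ≡ N : X ! τ` between well-typed computations. -/
inductive EqC (S : Signature.{u}) : Ctx S.Base → Comp S → Comp S → VTy S.Base → ℕ → Prop
  -- equivalence
  | refl {Γ : Ctx S.Base} {M : Comp S} {X : VTy S.Base} {τ : ℕ} :
      HasC S Γ M X τ → EqC S Γ M M X τ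
  | symm {Γ : Ctx S.Base} {M N : Comp S} {X : VTy S.Base} {τ : ℕ} :
      EqC S Γ M N X τ → EqC S Γ N M X τ
  | trans {Γ : Ctx S.Base} {M N P : Comp S} {X : VTy S.Base} {τ : ℕ} :
      EqC S Γ M N X τ → EqC S Γ N P X τ → EqC S Γ M P X τ
  -- congruence
  | ret {Γ : Ctx S.Base} {V V' : Val S} {X : VTy S.Base} :
      EqV S Γ V V' X → EqC S Γ (.ret V) (.ret V') X 0
  | letin {Γ : Ctx S.Base} {M M' N N' : Comp S} {X Y : VTy S.Base} {τ τ' : ℕ} :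
      EqC S Γ M M' X τ → EqC S (.var (.mod Γ τ) X) N N' Y τ' →
      EqC S Γ (.letin M N) (.letin M' N') Y (τ + τ')
  | app {Γ : Ctx S.Base} {V V' W W' : Val S} {X Y : VTy S.Base} {τ : ℕ} :
      EqV S Γ V V' (.fn X Y τ) → EqV S Γ W W' X → EqC S Γ (.app V W) (.app V' W') Y τ
  | split {Γ : Ctx S.Base} {V V' : Val S} {N N' : Comp S} {X Y Z : VTy S.Base} {τ : ℕ} :
      EqV S Γ V V' (.prod X Y) → EqC S (.var (.var Γ X) Y) N N' Z τ →
      EqC S Γ (.split V N) (.split V' N') Z τ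
  | op {Γ : Ctx S.Base} (o : S.Op) {V V' : Val S} {M M' : Comp S} {X : VTy S.Base} {τ : ℕ} :
      EqV S Γ V V' (S.argTy o) →
      EqC S (.var (.mod Γ (S.opTime o)) (S.resTy o)) M M' X τ →
      EqC S Γ (.op o V M) (.op o V' M') X (S.opTime o + τ)
  | delay {Γ : Ctx S.Base} {M M' : Comp S} {X : VTy S.Base} {τ τ' : ℕ} :
      EqC S (.mod Γ τ) M M' X τ' → EqC S Γ (.delay τ M) (.delay τ M') X (τ + τ')
  | handle {Γ : Ctx S.Base} {M M' N N' : Comp S} {H H' : S.Op → Comp S} {X Y : VTy S.Base}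
      {τ τ' : ℕ} :
      EqC S Γ M M' X τ → EqC S (.var (.mod Γ τ) X) N N' Y τ' →
      (∀ (o : S.Op) (τ'' : ℕ),
        EqC S (.var (.var Γ (S.argTy o)) (.box (S.opTime o) (.fn (S.resTy o) Y τ'')))
          (H o) (H' o) Y (S.opTime o + τ'')) →
      EqC S Γ (.handle M H N) (.handle M' H' N') Y (τ + τ')
  | unbox {Γ : Ctx S.Base} {V V' : Val S} {N N' : Comp S} {X Y : VTy S.Base} {τ τ' : ℕ} :
      τ ≤ Γ.time → EqV S (Γ.minus τ) V V' (.box τ X) → EqC S (.var Γ X) N N' Y τ' →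
      EqC S Γ (.unbox τ V N) (.unbox τ V' N') Y τ'
  -- substitutivity
  | subst {Γ Γ' : Ctx S.Base} {V W : Val S} {I J : Comp S} {X Y : VTy S.Base} {τ : ℕ} :
      EqC S ((Ctx.var Γ X).append Γ') I J Y τ → EqV S Γ V W X →
      EqC S (Γ.append Γ') (I.subst (subAt V Γ'.length)) (J.subst (subAt W Γ'.length)) Y τ
  -- `(fun (x : X) ↦ M) V ≡ M[V/x]`
  | fn_beta {Γ : Ctx S.Base} {M : Comp S} {V : Val S} {X Y : VTy S.Base} {τ : ℕ} :
      HasC S (.var Γ X) M Y τ → HasV S Γ V X →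
      EqC S Γ (.app (.lam X M) V) (M.subst (sub1 V)) Y τ
  -- `match (V, W) with {(x, y) ↦ N} ≡ N[V/x, W/y]`
  | prod_beta {Γ : Ctx S.Base} {V W : Val S} {N : Comp S} {X Y Z : VTy S.Base} {τ : ℕ} :
      HasV S Γ V X → HasV S Γ W Y → HasC S (.var (.var Γ X) Y) N Z τ →
      EqC S Γ (.split (.pair V W) N) (N.subst (sub2 V W)) Z τ
  -- `match V with {(x, y) ↦ N[(x, y)/z]} ≡ N[V/z]`
  | prod_eta {Γ : Ctx S.Base} {V : Val S} {N : Comp S} {X Y Z : VTy S.Base} {τ : ℕ} :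
      HasV S Γ V (.prod X Y) → HasC S (.var Γ (.prod X Y)) N Z τ →
      EqC S Γ (.split V (N.subst (subOver2 (.pair (.var 1) (.var 0))))) (N.subst (sub1 V)) Z τ
  -- `let x = return V in N ≡ N[V/x]`
  | let_ret {Γ : Ctx S.Base} {V : Val S} {N : Comp S} {X Y : VTy S.Base} {τ : ℕ} :
      HasV S Γ V X → HasC S (.var (.mod Γ 0) X) N Y τ →
      EqC S Γ (.letin (.ret V) N) (N.subst (sub1 V)) Y τ
  -- `let y = (let x = M in N) in P ≡ let x = M in (let y = N in P)`
  | let_let {Γ : Ctx S.Base} {M N P : Comp S} {X Y Z : VTy S.Base} {τ τ' τ'' : ℕ} :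
      HasC S Γ M X τ → HasC S (.var (.mod Γ τ) X) N Y τ' →
      HasC S (.var (.mod Γ (τ + τ')) Y) P Z τ'' →
      EqC S Γ (.letin (.letin M N) P) (.letin M (.letin N (P.rename (liftRen Nat.succ))))
        Z (τ + τ' + τ'')
  -- `let x = M in return x ≡ M`
  | let_eta {Γ : Ctx S.Base} {M : Comp S} {X : VTy S.Base} {τ : ℕ} :
      HasC S Γ M X τ → EqC S Γ (.letin M (.ret (.var 0))) M X τ
  -- `let x = op V (y . M) in N ≡ op V (y . let x = M in N)`
  | let_op {Γ : Ctx S.Base} (o : S.Op) {V : Val S} {M N : Comp S} {X Y : VTy S.Base} {τ τ' : ℕ} :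
      HasV S Γ V (S.argTy o) →
      HasC S (.var (.mod Γ (S.opTime o)) (S.resTy o)) M X τ →
      HasC S (.var (.mod Γ (S.opTime o + τ)) X) N Y τ' →
      EqC S Γ (.letin (.op o V M) N) (.op o V (.letin M (N.rename (liftRen Nat.succ))))
        Y (S.opTime o + τ + τ')
  -- `let x = delay τ M in N ≡ delay τ (let x = M in N)`
  | let_delay {Γ : Ctx S.Base} {M N : Comp S} {X Y : VTy S.Base} {τ τ' τ'' : ℕ} :
      HasC S (.mod Γ τ) M X τ' → HasC S (.var (.mod Γ (τ + τ')) X) N Y τ'' →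
      EqC S Γ (.letin (.delay τ M) N) (.delay τ (.letin M N)) Y (τ + τ' + τ'')
  -- `handle (return V) with H to x in N ≡ N[V/x]`
  | handle_ret {Γ : Ctx S.Base} {V : Val S} {N : Comp S} {H : S.Op → Comp S} {X Y : VTy S.Base}
      {τ : ℕ} :
      HasV S Γ V X → HasC S (.var (.mod Γ 0) X) N Y τ →
      (∀ (o : S.Op) (τ'' : ℕ),
        HasC S (.var (.var Γ (S.argTy o)) (.box (S.opTime o) (.fn (S.resTy o) Y τ'')))
          (H o) Y (S.opTime o + τ'')) →
      EqC S Γ (.handle (.ret V) H N) (N.subst (sub1 V)) Y τ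
  -- `handle (op V (y . M)) with H to x in N ≡
  --   H_op[V/x, box (fun (y : B_op) ↦ handle M with H to x in N)/k]`
  | handle_op {Γ : Ctx S.Base} (o : S.Op) {V : Val S} {M N : Comp S} {H : S.Op → Comp S}
      {X Y : VTy S.Base} {τ τ' : ℕ} :
      HasV S Γ V (S.argTy o) →
      HasC S (.var (.mod Γ (S.opTime o)) (S.resTy o)) M X τ →
      HasC S (.var (.mod Γ (S.opTime o + τ)) X) N Y τ' →
      (∀ (o' : S.Op) (τ'' : ℕ),
        HasC S (.var (.var Γ (S.argTy o')) (.box (S.opTime o') (.fn (S.resTy o') Y τ'')))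
          (H o') Y (S.opTime o' + τ'')) →
      EqC S Γ (.handle (.op o V M) H N)
        ((H o).subst (sub2 V (.box (S.opTime o) (.lam (S.resTy o)
          (.handle M (fun o' => (H o').rename (liftRen (liftRen Nat.succ)))
            (N.rename (liftRen Nat.succ)))))))
        Y (S.opTime o + τ + τ')
  -- `handle (delay τ M) with H to x in N ≡ delay τ (handle M with H to x in N)`
  | handle_delay {Γ : Ctx S.Base} {M N : Comp S} {H : S.Op → Comp S} {X Y : VTy S.Base}
      {τ τ' τ'' : ℕ} :
      HasC S (.mod Γ τ) M X τ' → HasC S (.var (.mod Γ (τ + τ')) X) N Y τ'' →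
      (∀ (o : S.Op) (θ : ℕ),
        HasC S (.var (.var Γ (S.argTy o)) (.box (S.opTime o) (.fn (S.resTy o) Y θ)))
          (H o) Y (S.opTime o + θ)) →
      EqC S Γ (.handle (.delay τ M) H N) (.delay τ (.handle M H N)) Y (τ + τ' + τ'')
  -- `unbox_τ (box_τ V) as x in N ≡ N[V/x]`
  | unbox_beta {Γ : Ctx S.Base} {V : Val S} {N : Comp S} {X Y : VTy S.Base} {τ τ' : ℕ} :
      τ ≤ Γ.time → HasV S (.mod (Γ.minus τ) τ) V X → HasC S (.var Γ X) N Y τ' →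
      EqC S Γ (.unbox τ (.box τ V) N) (N.subst (sub1 V)) Y τ'
  -- `unbox_τ V as x in N[box_τ x/y] ≡ N[V/y]`
  | unbox_eta {Γ : Ctx S.Base} {V : Val S} {N : Comp S} {X Y : VTy S.Base} {τ τ' : ℕ} :
      τ ≤ Γ.time → HasV S (Γ.minus τ) V (.box τ X) → HasC S (.var Γ (.box τ X)) N Y τ' →
      EqC S Γ (.unbox τ V (N.subst (subOver1 (.box τ (.var 0))))) (N.subst (sub1 V)) Y τ'

end

/-! ## Abstract models -/

open MonoidalCategory CartesianMonoidalCategory Limits Opposite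

noncomputable section

section Model

variable {C : Type v} [Category.{w} C] [CartesianMonoidalCategory C]

/-- The strong monoidal functor `[-] : (ℕ, ≤) → [C, C]`. -/
structure FutureModality (C : Type v) [Category.{w} C] where
  F : ℕ ⥤ C ⥤ C
  ε : F.obj 0 ≅ 𝟭 C
  δ : ∀ τ₁ τ₂ : ℕ, F.obj (τ₁ + τ₂) ≅ F.obj τ₂ ⋙ F.obj τ₁
  δ_ε : ∀ (A : C) (τ : ℕ),
    (δ 0 τ).hom.app A ≫ ε.hom.app ((F.obj τ).obj A) = (F.map (eqToHom (Nat.zero_add τ))).app A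
  δ_map_ε : ∀ (A : C) (τ : ℕ),
    (δ τ 0).hom.app A ≫ (F.obj τ).map (ε.hom.app A) = 𝟙 ((F.obj τ).obj A)
  δ_δ : ∀ (A : C) (τ₁ τ₂ τ₃ : ℕ),
    (δ (τ₁ + τ₂) τ₃).hom.app A ≫ (δ τ₁ τ₂).hom.app ((F.obj τ₃).obj A) =
      (F.map (eqToHom (Nat.add_assoc τ₁ τ₂ τ₃))).app A ≫
        (δ τ₁ (τ₂ + τ₃)).hom.app A ≫ (F.obj τ₁).map ((δ τ₂ τ₃).hom.app A)
  δ_mono : ∀ (A : C) {τ₁ τ₂ τ₁' τ₂' : ℕ} (h₁ : τ₁ ≤ τ₁') (h₂ : τ₂ ≤ τ₂'),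
    (F.map (homOfLE (Nat.add_le_add h₁ h₂))).app A ≫ (δ τ₁' τ₂').hom.app A =
      (δ τ₁ τ₂).hom.app A ≫ (F.map (homOfLE h₁)).app ((F.obj τ₂).obj A) ≫
        (F.obj τ₁').map ((F.map (homOfLE h₂)).app A)

/-- The strong monoidal functor `⟨-⟩ : (ℕ, ≤)ᵒᵖ → [C, C]`. -/
structure PastModality (C : Type v) [Category.{w} C] where
  P : ℕᵒᵖ ⥤ C ⥤ C
  η : 𝟭 C ≅ P.obj (op 0)
  μ : ∀ τ₁ τ₂ : ℕ, P.obj (op τ₂) ⋙ P.obj (op τ₁) ≅ P.obj (op (τ₁ + τ₂))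
  η_μ : ∀ (A : C) (τ : ℕ),
    η.hom.app ((P.obj (op τ)).obj A) ≫ (μ 0 τ).hom.app A =
      (P.map (eqToHom (congrArg op (Nat.zero_add τ).symm))).app A
  map_η_μ : ∀ (A : C) (τ : ℕ),
    (P.obj (op τ)).map (η.hom.app A) ≫ (μ τ 0).hom.app A = 𝟙 ((P.obj (op τ)).obj A)
  μ_μ : ∀ (A : C) (τ₁ τ₂ τ₃ : ℕ),
    (μ τ₁ τ₂).hom.app ((P.obj (op τ₃)).obj A) ≫ (μ (τ₁ + τ₂) τ₃).hom.app A ≫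
        (P.map (eqToHom (congrArg op (Nat.add_assoc τ₁ τ₂ τ₃)))).app A =
      (P.obj (op τ₁)).map ((μ τ₂ τ₃).hom.app A) ≫ (μ τ₁ (τ₂ + τ₃)).hom.app A
  μ_mono : ∀ (A : C) {τ₁ τ₂ τ₁' τ₂' : ℕ} (h₁ : τ₁ ≤ τ₁') (h₂ : τ₂ ≤ τ₂'),
    (μ τ₁' τ₂').hom.app A ≫ (P.map (homOfLE (Nat.add_le_add h₁ h₂)).op).app A =
      (P.map (homOfLE h₁).op).app ((P.obj (op τ₂')).obj A) ≫
        (P.obj (op τ₁)).map ((P.map (homOfLE h₂).op).app A) ≫ (μ τ₁ τ₂).hom.app A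

/-- The two modalities, and adjunctions `⟨τ⟩ ⊣ [τ]` that interact well with the strong monoidal
structures. -/
structure Modalities (C : Type v) [Category.{w} C] extends
    FutureModality C, PastModality C where
  adj : ∀ τ : ℕ, P.obj (op τ) ⊣ F.obj τ
  unit_zero_le : ∀ (A : C) (τ : ℕ),
    ε.hom.app ((P.obj (op 0)).obj A) ≫ η.inv.app A ≫ (adj τ).unit.app A ≫
        (F.obj τ).map ((P.map (homOfLE (Nat.zero_le τ)).op).app A) =
      (F.map (homOfLE (Nat.zero_le τ))).app ((P.obj (op 0)).obj A)
  counit_zero_le : ∀ (A : C) (τ : ℕ),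
    (adj τ).counit.app A ≫ ε.inv.app A ≫ η.hom.app ((F.obj 0).obj A) ≫
        (P.obj (op 0)).map ((F.map (homOfLE (Nat.zero_le τ))).app A) =
      (P.map (homOfLE (Nat.zero_le τ)).op).app ((F.obj τ).obj A)
  unit_add : ∀ (A : C) (τ₁ τ₂ : ℕ),
    (adj τ₁).unit.app A ≫
        (F.obj τ₁).map ((adj τ₂).unit.app ((P.obj (op τ₁)).obj A)) ≫
        (F.obj τ₁).map ((F.obj τ₂).map ((μ τ₂ τ₁).hom.app A)) ≫
        (F.obj τ₁).map ((F.obj τ₂).map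
          ((P.map (eqToHom (congrArg op (Nat.add_comm τ₂ τ₁)))).app A)) =
      (adj (τ₁ + τ₂)).unit.app A ≫ (δ τ₁ τ₂).hom.app ((P.obj (op (τ₁ + τ₂))).obj A)
  counit_add : ∀ (A : C) (τ₁ τ₂ : ℕ),
    (P.obj (op τ₁)).map ((P.obj (op τ₂)).map
          ((F.map (eqToHom (Nat.add_comm τ₁ τ₂))).app A)) ≫
        (P.obj (op τ₁)).map ((P.obj (op τ₂)).map ((δ τ₂ τ₁).hom.app A)) ≫
        (P.obj (op τ₁)).map ((adj τ₂).counit.app ((F.obj τ₁).obj A)) ≫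
        (adj τ₁).counit.app A =
      (μ τ₁ τ₂).hom.app ((F.obj (τ₁ + τ₂)).obj A) ≫ (adj (τ₁ + τ₂)).counit.app A

namespace Modalities

variable (𝓜 : Modalities C)

/-- The functor `[τ]`. -/
abbrev fut (τ : ℕ) : C ⥤ C := 𝓜.F.obj τ

/-- The functor `⟨τ⟩`. -/
abbrev past (τ : ℕ) : C ⥤ C := 𝓜.P.obj (op τ)

/-- `⟨τ' ≤ τ⟩ : ⟨τ⟩ A ⟶ ⟨τ'⟩ A`. -/
abbrev pastLE {τ' τ : ℕ} (h : τ' ≤ τ) (A : C) : (𝓜.past τ).obj A ⟶ (𝓜.past τ').obj A :=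
  (𝓜.P.map (homOfLE h).op).app A

/-- The unit `A ⟶ [τ] (⟨τ⟩ A)` of the adjunction. -/
abbrev unit (τ : ℕ) (A : C) : A ⟶ (𝓜.fut τ).obj ((𝓜.past τ).obj A) := (𝓜.adj τ).unit.app A

/-- The counit `⟨τ⟩ ([τ] A) ⟶ A` of the adjunction. -/
abbrev counit (τ : ℕ) (A : C) : (𝓜.past τ).obj ((𝓜.fut τ).obj A) ⟶ A := (𝓜.adj τ).counit.app A

/-- The counit-like composite `⟨τ⟩ A ⟶ ⟨0⟩ A ⟶ A`. -/
def now (τ : ℕ) (A : C) : (𝓜.past τ).obj A ⟶ A :=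
  𝓜.pastLE (Nat.zero_le τ) A ≫ 𝓜.η.inv.app A

/-- The canonical map `[τ] A × [τ] B ⟶ [τ] (A × B)` (the inverse of the product comparison map of
the right adjoint `[τ]`), as the transpose of
`⟨τ⟩ ([τ] A × [τ] B) ⟶ ⟨τ⟩ ([τ] A) × ⟨τ⟩ ([τ] B) ⟶ A × B`. -/
def m (τ : ℕ) (A B : C) : (𝓜.fut τ).obj A ⊗ (𝓜.fut τ).obj B ⟶ (𝓜.fut τ).obj (A ⊗ B) :=
  𝓜.unit τ _ ≫ (𝓜.fut τ).map
    (lift ((𝓜.past τ).map (fst _ _) ≫ 𝓜.counit τ A) ((𝓜.past τ).map (snd _ _) ≫ 𝓜.counit τ B))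

end Modalities

/-- The identity `T τ A ⟶ T τ' A` for `τ = τ'`. -/
def gradeCast (T : ℕ → C ⥤ C) {τ τ' : ℕ} (h : τ = τ') (A : C) : (T τ).obj A ⟶ (T τ').obj A :=
  eqToHom (congrArg (fun θ => (T θ).obj A) h)

/-- `[-]`-strong (discretely) graded monads. -/
structure StrongGradedMonad (𝓜 : Modalities C) where
  T : ℕ → C ⥤ C
  ret : 𝟭 C ⟶ T 0
  mult : ∀ τ₁ τ₂ : ℕ, T τ₂ ⋙ T τ₁ ⟶ T (τ₁ + τ₂)
  str : ∀ (τ : ℕ) (A B : C), (𝓜.fut τ).obj A ⊗ (T τ).obj B ⟶ (T τ).obj (A ⊗ B)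
  str_natural : ∀ (τ : ℕ) {A A' B B' : C} (f : A ⟶ A') (g : B ⟶ B'),
    ((𝓜.fut τ).map f ⊗ₘ (T τ).map g) ≫ str τ A' B' = str τ A B ≫ (T τ).map (f ⊗ₘ g)
  ret_mult : ∀ (τ : ℕ) (A : C),
    ret.app ((T τ).obj A) ≫ (mult 0 τ).app A = gradeCast T (Nat.zero_add τ).symm A
  map_ret_mult : ∀ (τ : ℕ) (A : C),
    (T τ).map (ret.app A) ≫ (mult τ 0).app A = 𝟙 ((T τ).obj A)
  mult_mult : ∀ (τ₁ τ₂ τ₃ : ℕ) (A : C),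
    (mult τ₁ τ₂).app ((T τ₃).obj A) ≫ (mult (τ₁ + τ₂) τ₃).app A ≫
        gradeCast T (Nat.add_assoc τ₁ τ₂ τ₃) A =
      (T τ₁).map ((mult τ₂ τ₃).app A) ≫ (mult τ₁ (τ₂ + τ₃)).app A
  str_ret : ∀ A B : C, (𝓜.ε.inv.app A ⊗ₘ ret.app B) ≫ str 0 A B = ret.app (A ⊗ B)
  str_snd : ∀ (τ : ℕ) (A B : C), str τ A B ≫ (T τ).map (snd A B) = snd _ _
  str_mult : ∀ (τ₁ τ₂ : ℕ) (A B : C),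
    str τ₁ ((𝓜.fut τ₂).obj A) ((T τ₂).obj B) ≫ (T τ₁).map (str τ₂ A B) ≫
        (mult τ₁ τ₂).app (A ⊗ B) =
      ((𝓜.δ τ₁ τ₂).inv.app A ⊗ₘ (mult τ₁ τ₂).app B) ≫ str (τ₁ + τ₂) A B
  str_assoc : ∀ (τ : ℕ) (A B D : C),
    (α_ _ _ _).inv ≫ (𝓜.m τ A B ▷ (T τ).obj D) ≫ str τ (A ⊗ B) D ≫ (T τ).map (α_ A B D).hom =
      ((𝓜.fut τ).obj A ◁ str τ B D) ≫ str τ A (B ⊗ D)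

variable [MonoidalClosed C]

/-- The exponential `A ⇒ B`. -/
abbrev exp (A B : C) : C := (ihom A).obj B

/-- Currying of the second argument. -/
def cur {G A B : C} (f : G ⊗ A ⟶ B) : G ⟶ exp A B :=
  MonoidalClosed.curry (lift (snd A G) (fst A G) ≫ f)

/-- Uncurrying, inverse to `cur`. -/
def unc {G A B : C} (f : G ⟶ exp A B) : G ⊗ A ⟶ B :=
  lift (snd G A) (fst G A) ≫ MonoidalClosed.uncurry f

/-- Postcomposition `A ⇒ f`. -/
abbrev expMap (A : C) {B B' : C} (f : B ⟶ B') : exp A B ⟶ exp A B' := (ihom A).map f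

/-- Pushing an argument under an exponential, `E × (A ⇒ B) ⟶ A ⇒ (E × B)`. -/
def pushExp (E A B : C) : E ⊗ exp A B ⟶ exp A (E ⊗ B) :=
  cur ((α_ E (exp A B) A).hom ≫ (E ◁ unc (𝟙 (exp A B))))

/-- Exchanging the first two factors, `A × (B × D) ⟶ B × (A × D)`. -/
def exch (A B D : C) : A ⊗ (B ⊗ D) ⟶ B ⊗ (A ⊗ D) :=
  lift (snd _ _ ≫ fst _ _) (lift (fst _ _) (snd _ _ ≫ snd _ _))

/-- The part of a model that is needed to interpret types. -/
structure TypeModel (S : Signature.{u}) (C : Type v) [Category.{w} C]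
    [CartesianMonoidalCategory C] where
  mods : Modalities C
  monad : StrongGradedMonad mods
  base : S.Base → C

namespace TypeModel

variable {S : Signature.{u}} (𝓜 : TypeModel S C)

/-- The functor `[τ]`. -/
abbrev fut (τ : ℕ) : C ⥤ C := 𝓜.mods.fut τ

/-- The functor `⟨τ⟩`. -/
abbrev past (τ : ℕ) : C ⥤ C := 𝓜.mods.past τ

/-- The functor `T τ`. -/
abbrev T (τ : ℕ) : C ⥤ C := 𝓜.monad.T τ

/-- The identity `T τ A ⟶ T τ' A` for `τ = τ'`. -/
abbrev castT {τ τ' : ℕ} (h : τ = τ') (A : C) : (𝓜.T τ).obj A ⟶ (𝓜.T τ').obj A :=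
  gradeCast 𝓜.monad.T h A

/-- Interpretation of value types. -/
def ty : VTy S.Base → C
  | .base b => 𝓜.base b
  | .unit => 𝟙_ C
  | .prod X Y => ty X ⊗ ty Y
  | .fn X Y τ => exp (ty X) ((𝓜.T τ).obj (ty Y))
  | .box τ X => (𝓜.fut τ).obj (ty X)

/-- Interpretation of the argument type of an operation. -/
abbrev arg (o : S.Op) : C := 𝓜.ty (S.argTy o)

/-- Interpretation of the result type of an operation. -/
abbrev res (o : S.Op) : C := 𝓜.ty (S.resTy o)

/-- The domain `⟦A_op⟧ × [τ_op] (⟦B_op⟧ ⇒ T τ A)` of an algebraic operation. -/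
abbrev opDom (o : S.Op) (τ : ℕ) (A : C) : C :=
  𝓜.arg o ⊗ (𝓜.fut (S.opTime o)).obj (exp (𝓜.res o) ((𝓜.T τ).obj A))

/-- The object of operation clauses for the operation `o`, at time grade `τ`. -/
abbrev clause (o : S.Op) (τ : ℕ) (A : C) : C :=
  exp (𝓜.opDom o τ A) ((𝓜.T (S.opTime o + τ)).obj A)

/-- The object of effect handlers `Π_op Π_τ (⟦A_op⟧ × [τ_op] (⟦B_op⟧ ⇒ T τ A)) ⇒ T (τ_op + τ) A`. -/
abbrev handlers [HasProductsOfShape ℕ C] [HasProductsOfShape S.Op C] (A : C) : C :=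
  ∏ᶜ fun o : S.Op => ∏ᶜ fun τ : ℕ => 𝓜.clause o τ A

/-- Interpretation of contexts as functors. -/
def ctx : Ctx S.Base → C ⥤ C
  | .nil => 𝟭 C
  | .var Γ X =>
      { obj := fun A => (ctx Γ).obj A ⊗ 𝓜.ty X
        map := fun f => (ctx Γ).map f ▷ 𝓜.ty X
        map_id := fun A => by simp
        map_comp := fun f g => by simp }
  | .mod Γ τ => ctx Γ ⋙ 𝓜.past τ
  | .gap Γ => ctx Γ

end TypeModel

/-- Abstract models of the calculus. -/
structure Model (S : Signature.{u}) (C : Type v) [Category.{w} C] [CartesianMonoidalCategory C]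
    [MonoidalClosed C] [HasProductsOfShape ℕ C] [HasProductsOfShape S.Op C] extends
    TypeModel S C where
  /-- Interpretation of constants. -/
  const : ∀ f : S.Const,
    (∏ᶜ fun i : Fin (S.arity f) => toTypeModel.ty (S.constDom f i).toVTy) ⟶
      toTypeModel.ty (S.constCod f).toVTy
  /-- Algebraic operations. -/
  opT : ∀ (o : S.Op) (τ : ℕ) (A : C),
    toTypeModel.opDom o τ A ⟶ (toTypeModel.T (S.opTime o + τ)).obj A
  opT_natural : ∀ (o : S.Op) (τ : ℕ) {A B : C} (f : A ⟶ B),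
    (toTypeModel.arg o ◁ (toTypeModel.fut (S.opTime o)).map
        (expMap (toTypeModel.res o) ((toTypeModel.T τ).map f))) ≫ opT o τ B =
      opT o τ A ≫ (toTypeModel.T (S.opTime o + τ)).map f
  /-- Delays. -/
  delayT : ∀ τ τ' : ℕ, toTypeModel.T τ' ⋙ toTypeModel.fut τ ⟶ toTypeModel.T (τ + τ')
  opT_mult : ∀ (o : S.Op) (τ τ' : ℕ) (A : C),
    opT o τ ((toTypeModel.T τ').obj A) ≫ (monad.mult (S.opTime o + τ) τ').app A =
      (toTypeModel.arg o ◁ (toTypeModel.fut (S.opTime o)).map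
        (expMap (toTypeModel.res o) ((monad.mult τ τ').app A))) ≫
      opT o (τ + τ') A ≫ toTypeModel.castT (Nat.add_assoc (S.opTime o) τ τ').symm A
  delayT_mult : ∀ (τ τ' τ'' : ℕ) (A : C),
    (delayT τ τ').app ((toTypeModel.T τ'').obj A) ≫ (monad.mult (τ + τ') τ'').app A =
      (toTypeModel.fut τ).map ((monad.mult τ' τ'').app A) ≫
      (delayT τ (τ' + τ'')).app A ≫ toTypeModel.castT (Nat.add_assoc τ τ' τ'').symm A
  opT_str : ∀ (o : S.Op) (τ : ℕ) (A B : C),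
    ((toTypeModel.fut (S.opTime o + τ)).obj A ◁ opT o τ B) ≫
        monad.str (S.opTime o + τ) A B =
      exch _ _ _ ≫
      (toTypeModel.arg o ◁ ((mods.δ (S.opTime o) τ).hom.app A ▷ _)) ≫
      (toTypeModel.arg o ◁ mods.m (S.opTime o) ((toTypeModel.fut τ).obj A)
        (exp (toTypeModel.res o) ((toTypeModel.T τ).obj B))) ≫
      (toTypeModel.arg o ◁ (toTypeModel.fut (S.opTime o)).map
        (pushExp ((toTypeModel.fut τ).obj A) (toTypeModel.res o) ((toTypeModel.T τ).obj B))) ≫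
      (toTypeModel.arg o ◁ (toTypeModel.fut (S.opTime o)).map
        (expMap (toTypeModel.res o) (monad.str τ A B))) ≫
      opT o τ (A ⊗ B)
  delayT_str : ∀ (τ τ' : ℕ) (A B : C),
    ((toTypeModel.fut (τ + τ')).obj A ◁ (delayT τ τ').app B) ≫ monad.str (τ + τ') A B =
      ((mods.δ τ τ').hom.app A ▷ _) ≫
      mods.m τ ((toTypeModel.fut τ').obj A) ((toTypeModel.T τ').obj B) ≫
      (toTypeModel.fut τ).map (monad.str τ' A B) ≫
      (delayT τ τ').app (A ⊗ B)
  /-- Handling morphisms. -/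
  hdl : ∀ (A : C) (τ τ' : ℕ),
    toTypeModel.handlers A ⟶
      exp ((toTypeModel.T τ).obj ((toTypeModel.T τ').obj A)) ((toTypeModel.T (τ + τ')).obj A)
  hdl_ret : ∀ (A : C) (τ : ℕ),
    (toTypeModel.handlers A ◁ monad.ret.app ((toTypeModel.T τ).obj A)) ≫ unc (hdl A 0 τ) =
      snd _ _ ≫ toTypeModel.castT (Nat.zero_add τ).symm A
  hdl_delay : ∀ (A : C) (τ τ' τ'' : ℕ),
    (toTypeModel.handlers A ◁ (delayT τ τ').app ((toTypeModel.T τ'').obj A)) ≫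
        unc (hdl A (τ + τ') τ'') =
      (mods.unit τ (toTypeModel.handlers A) ▷ _) ≫
      mods.m τ ((toTypeModel.past τ).obj (toTypeModel.handlers A))
        ((toTypeModel.T τ').obj ((toTypeModel.T τ'').obj A)) ≫
      (toTypeModel.fut τ).map (mods.now τ (toTypeModel.handlers A) ▷ _) ≫
      (toTypeModel.fut τ).map (unc (hdl A τ' τ'')) ≫
      (delayT τ (τ' + τ'')).app A ≫ toTypeModel.castT (Nat.add_assoc τ τ' τ'').symm A
  hdl_op : ∀ (A : C) (o : S.Op) (τ τ' : ℕ),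
    (toTypeModel.handlers A ◁ opT o τ ((toTypeModel.T τ').obj A)) ≫
        unc (hdl A (S.opTime o + τ) τ') =
      lift (fst _ _) (𝟙 _) ≫
      ((Pi.π (fun o' : S.Op => ∏ᶜ fun θ : ℕ => toTypeModel.clause o' θ A) o ≫
        Pi.π (fun θ : ℕ => toTypeModel.clause o θ A) (τ + τ')) ▷ _) ≫
      (toTypeModel.clause o (τ + τ') A ◁ exch _ _ _) ≫
      (toTypeModel.clause o (τ + τ') A ◁ (toTypeModel.arg o ◁
        (mods.unit (S.opTime o) (toTypeModel.handlers A) ▷ _))) ≫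
      (toTypeModel.clause o (τ + τ') A ◁ (toTypeModel.arg o ◁
        mods.m (S.opTime o) ((toTypeModel.past (S.opTime o)).obj (toTypeModel.handlers A))
          (exp (toTypeModel.res o) ((toTypeModel.T τ).obj ((toTypeModel.T τ').obj A))))) ≫
      (toTypeModel.clause o (τ + τ') A ◁ (toTypeModel.arg o ◁
        (toTypeModel.fut (S.opTime o)).map
          (mods.now (S.opTime o) (toTypeModel.handlers A) ▷ _))) ≫
      (toTypeModel.clause o (τ + τ') A ◁ (toTypeModel.arg o ◁
        (toTypeModel.fut (S.opTime o)).map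
          (pushExp (toTypeModel.handlers A) (toTypeModel.res o)
            ((toTypeModel.T τ).obj ((toTypeModel.T τ').obj A))))) ≫
      (toTypeModel.clause o (τ + τ') A ◁ (toTypeModel.arg o ◁
        (toTypeModel.fut (S.opTime o)).map
          (expMap (toTypeModel.res o) (unc (hdl A τ τ'))))) ≫
      unc (𝟙 (toTypeModel.clause o (τ + τ') A)) ≫
      toTypeModel.castT (Nat.add_assoc (S.opTime o) τ τ').symm A

/-! ## Interpretation of contexts and terms -/

namespace TypeModel

variable {S : Signature.{u}} (𝓜 : TypeModel S C)

/-- The splitting `⟦Γ₁, x : X, Γ₂⟧ A ⟶ ⟦Γ₂⟧ (⟦Γ₁⟧ A × ⟦X⟧)`. -/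
def splitAt : {Γ : Ctx S.Base} → {i : ℕ} → {X : VTy S.Base} → (v : Lookup Γ i X) → (A : C) →
    ((𝓜.ctx Γ).obj A ⟶ (𝓜.ctx v.after).obj ((𝓜.ctx v.before).obj A ⊗ 𝓜.ty X))
  | .var _ _, _, _, .here, _ => 𝟙 _
  | .var _ Y, _, _, .var v, A => splitAt v A ▷ 𝓜.ty Y
  | .mod _ τ, _, _, .mod v, A => (𝓜.past τ).map (splitAt v A)
  | .gap _, _, _, .gap v, A => splitAt v A

/-- The collapse `⟦Γ⟧ A ⟶ ⟨time Γ⟩ A` of all temporal modalities of a context. -/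
def collapse : (Γ : Ctx S.Base) → (A : C) → ((𝓜.ctx Γ).obj A ⟶ (𝓜.past Γ.time).obj A)
  | .nil, A => 𝓜.mods.η.hom.app A
  | .var Γ _, A => fst _ _ ≫ collapse Γ A
  | .mod Γ τ, A => (𝓜.past τ).map (collapse Γ A) ≫ (𝓜.mods.μ τ Γ.time).hom.app A ≫
      𝓜.mods.pastLE (le_of_eq (Nat.add_comm Γ.time τ)) A
  | .gap Γ, A => collapse Γ A

/-- The identity `⟦Γ⟧ A ⟶ ⟦Γ'⟧ A` for `Γ = Γ'`. -/
def ctxCast {Γ Γ' : Ctx S.Base} (h : Γ = Γ') (A : C) : (𝓜.ctx Γ).obj A ⟶ (𝓜.ctx Γ').obj A :=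
  eqToHom (congrArg (fun Δ => (𝓜.ctx Δ).obj A) h)

/-- The map `⟦Γ⟧ A ⟶ ⟨τ⟩ (⟦Γ - τ⟧ A)` that extracts and collapses `τ` worth of modalities. -/
def pra : (Γ : Ctx S.Base) → (τ : ℕ) → τ ≤ Γ.time → (A : C) →
    ((𝓜.ctx Γ).obj A ⟶ (𝓜.past τ).obj ((𝓜.ctx (Γ.minus τ)).obj A))
  | Γ, 0, _, A => 𝓜.mods.η.hom.app _ ≫
      (𝓜.past 0).map (𝓜.ctxCast (by cases Γ <;> rfl) A)
  | .nil, _ + 1, h, _ => absurd h (Nat.not_succ_le_zero _)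
  | .var Γ _, τ + 1, h, A => fst _ _ ≫ pra Γ (τ + 1) h A
  | .gap Γ, τ + 1, h, A => pra Γ (τ + 1) h A
  | .mod Γ τ', τ + 1, h, A =>
      if h' : τ + 1 ≤ τ' then
        𝓜.mods.pastLE (le_of_eq (Nat.add_sub_of_le h')) _ ≫
          (𝓜.mods.μ (τ + 1) (τ' - (τ + 1))).inv.app ((𝓜.ctx Γ).obj A) ≫
          (𝓜.past (τ + 1)).map (𝓜.ctxCast (Γ := .mod Γ (τ' - (τ + 1)))
            (by rw [Ctx.minus, if_pos h']) A)
      else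
        (𝓜.past τ').map (pra Γ (τ + 1 - τ') (Nat.sub_le_iff_le_add.mpr h) A) ≫
          (𝓜.mods.μ τ' (τ + 1 - τ')).hom.app ((𝓜.ctx (Γ.minus (τ + 1 - τ'))).obj A) ≫
          𝓜.mods.pastLE (le_of_eq (Nat.add_sub_of_le (Nat.le_of_not_le h')).symm) _ ≫
          (𝓜.past (τ + 1)).map (𝓜.ctxCast (Γ := Γ.minus (τ + 1 - τ'))
            (by rw [Ctx.minus, if_neg h']) A)

end TypeModel

namespace Model

variable {S : Signature.{u}} [HasProductsOfShape ℕ C] [HasProductsOfShape S.Op C]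
  (𝓜 : Model S C)

/-- Interpretation of the contexts, applied to the terminal object. -/
abbrev env (Γ : Ctx S.Base) : C := (𝓜.ctx Γ).obj (𝟙_ C)

mutual

/-- Interpretation of well-typed values. -/
def semV : {Γ : Ctx S.Base} → {V : Val S} → {X : VTy S.Base} →
    HasV S Γ V X → (𝓜.env Γ ⟶ 𝓜.ty X)
  | _, _, X, .var v =>
      𝓜.splitAt v (𝟙_ C) ≫ 𝓜.collapse v.after _ ≫ 𝓜.mods.now v.after.time _ ≫ snd _ (𝓜.ty X)
  | _, _, _, .const f ds => Pi.lift (fun i => semV (ds i)) ≫ 𝓜.const f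
  | Γ, _, _, .unit => toUnit (𝓜.env Γ)
  | _, _, _, .pair d e => lift (semV d) (semV e)
  | _, _, _, .lam d => cur (semC d)
  | Γ, _, _, .box (τ := τ) d => 𝓜.mods.unit τ (𝓜.env Γ) ≫ (𝓜.fut τ).map (semV d)

/-- Interpretation of well-typed computations. -/
def semC : {Γ : Ctx S.Base} → {M : Comp S} → {X : VTy S.Base} → {τ : ℕ} →
    HasC S Γ M X τ → (𝓜.env Γ ⟶ (𝓜.T τ).obj (𝓜.ty X))
  | _, _, X, _, .ret d => semV d ≫ 𝓜.monad.ret.app (𝓜.ty X)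
  | Γ, _, Y, _, .letin (X := X) (τ := τ) (τ' := τ') d e =>
      lift (𝓜.mods.unit τ (𝓜.env Γ)) (semC d) ≫
        𝓜.monad.str τ ((𝓜.past τ).obj (𝓜.env Γ)) (𝓜.ty X) ≫
        (𝓜.T τ).map (semC e) ≫ (𝓜.monad.mult τ τ').app (𝓜.ty Y)
  | _, _, _, _, .app d e => lift (semV d) (semV e) ≫ unc (𝟙 _)
  | Γ, _, _, _, .split (X := X) (Y := Y) d e =>
      lift (𝟙 (𝓜.env Γ)) (semV d) ≫ (α_ (𝓜.env Γ) (𝓜.ty X) (𝓜.ty Y)).inv ≫ semC e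
  | Γ, _, X, _, .op o (τ := τ) d e =>
      lift (semV d) (𝓜.mods.unit (S.opTime o) (𝓜.env Γ)) ≫
        (𝓜.arg o ◁ (𝓜.fut (S.opTime o)).map (cur (semC e))) ≫ 𝓜.opT o τ (𝓜.ty X)
  | Γ, _, X, _, .delay (τ := τ) (τ' := τ') d =>
      𝓜.mods.unit τ (𝓜.env Γ) ≫ (𝓜.fut τ).map (semC d) ≫ (𝓜.delayT τ τ').app (𝓜.ty X)
  | Γ, _, Y, _, .handle (X := X) (τ := τ) (τ' := τ') d e hs =>
      lift (𝟙 (𝓜.env Γ)) (lift (𝓜.mods.unit τ (𝓜.env Γ)) (semC d)) ≫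
        (𝓜.env Γ ◁ 𝓜.monad.str τ ((𝓜.past τ).obj (𝓜.env Γ)) (𝓜.ty X)) ≫
        (𝓜.env Γ ◁ (𝓜.T τ).map (semC e)) ≫
        (Pi.lift (fun o => Pi.lift (fun τ'' =>
          cur ((α_ (𝓜.env Γ) (𝓜.arg o) _).inv ≫ semC (hs o τ'')))) ▷ _) ≫
        unc (𝓜.hdl (𝓜.ty Y) τ τ')
  | Γ, _, _, _, .unbox (X := X) (τ := τ) h d e =>
      lift (𝟙 (𝓜.env Γ)) (𝓜.pra Γ τ h (𝟙_ C)) ≫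
        (𝓜.env Γ ◁ (𝓜.past τ).map (semV d)) ≫
        (𝓜.env Γ ◁ 𝓜.mods.counit τ (𝓜.ty X)) ≫ semC e

end

end Model

end Model

end

end LambdaTau

open CategoryTheory LambdaTau

open CategoryTheory LambdaTau

/-!
A derivable equation relates two terms whose interpretations agree because every axiom of the
equational theory is an equation between the corresponding operations on morphisms, and because
those operations, and substitution, are compatible with interpretation.

The operations are separated from the syntax. For objects `E, X, Y, …` of the category, the
combinators `boxS`, `letS`, `opS`, `delayS`, `handleS`, `unboxS` (and `splitS`, `appS`) are the
interpretations of the term formers with an arbitrary object `E` in the role of the context. Each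
of them is natural in `E` (`comp_letS` and the like), and each computation axiom becomes an
equation between combinators (`letS_letS`, `handleS_opS`, `unboxS_eta` and so on), proved from the
laws of the model. In these equations the environment of the inner computation has aged in two
steps, and it is brought back to the environment required by the outer one with
`Modalities.mu : ⟨a⟩ ⟨b⟩ A ⟶ ⟨c⟩ A`, for `c ≤ a + b`.

Interpretation is a function of the term alone: a term has at most one type, grade and typing
derivation in a given context (`HasV.unique`, `HasC.unique`), since functions are annotated with
their argument type, and the other rules are syntax directed. So one may work with the relations
`SemV Γ V X g` and `SemC Γ M X τ g`, saying that a term is well-typed with interpretation `g`.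

What remains is the substitution lemma. Its only difficult case is `unbox`, whose value is typed in
the context `Γ - τ`: a substitution for `Γ` has to restrict to one for `Γ - τ`, compatibly with
the maps `⟦Γ⟧ ⟶ ⟨τ⟩ ⟦Γ - τ⟧`. These maps are presented as an inductive relation `Pra`, closed
under composition and decomposition (`Pra.comp`, `Pra.split`). A simultaneous substitution
(`Subst`) matches each modality `⟨τ⟩` of `Γ` with a way to go back `τ` units of time in the target
context, so that restriction (`Subst.minus`) is an induction on `Pra`. All renamings and
substitutions in the equational theory are instances of `Subst`: variables in place of general
terms give weakening, and make terms over `Γ, ⟨a + b⟩` into terms over `Γ, ⟨a⟩, ⟨b⟩`, and terms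
over `Γ - τ, ⟨τ⟩` into terms over `Γ`. Given this, the theorem follows by induction on the
derivation of the equation (`soundV`, `soundC`).
-/

namespace LambdaTau

open MonoidalCategory CartesianMonoidalCategory Limits Opposite

noncomputable section

/-! ### Exponentials -/

section Exponentials

variable {C : Type v} [Category.{w} C] [CartesianMonoidalCategory C] [MonoidalClosed C]

theorem comp_cur {D G A B : C} (h : D ⟶ G) (f : G ⊗ A ⟶ B) :
    h ≫ cur f = cur ((h ▷ A) ≫ f) := by
  unfold cur
  rw [← MonoidalClosed.curry_natural_left]
  congr 1
  rw [← Category.assoc, ← Category.assoc]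
  congr 1
  ext <;> simp

theorem cur_expMap {G A B B' : C} (f : G ⊗ A ⟶ B) (g : B ⟶ B') :
    cur f ≫ expMap A g = cur (f ≫ g) := by
  unfold cur
  rw [← MonoidalClosed.curry_natural_right, Category.assoc]

theorem unc_cur {G A B : C} (f : G ⊗ A ⟶ B) : unc (cur f) = f := by
  unfold unc cur
  rw [MonoidalClosed.uncurry_curry, ← Category.assoc]
  have : lift (snd G A) (fst G A) ≫ lift (snd A G) (fst A G) = 𝟙 _ := by ext <;> simp
  rw [this, Category.id_comp]

theorem cur_unc {G A B : C} (f : G ⟶ exp A B) : cur (unc f) = f := by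
  unfold unc cur
  have : lift (snd A G) (fst A G) ≫ lift (snd G A) (fst G A) = 𝟙 _ := by ext <;> simp
  rw [← Category.assoc, this, Category.id_comp, MonoidalClosed.curry_uncurry]

theorem whiskerRight_unc {D G A B : C} (h : D ⟶ G) (f : G ⟶ exp A B) :
    (h ▷ A) ≫ unc f = unc (h ≫ f) := by
  rw [← unc_cur ((h ▷ A) ≫ unc f), ← comp_cur, cur_unc]

theorem lift_unc {D G A B : C} (a : D ⟶ G) (b : D ⟶ A) (f : G ⟶ exp A B) :
    lift a b ≫ unc f = lift (a ≫ f) b ≫ unc (𝟙 _) := by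
  have h : unc f = (f ▷ A) ≫ unc (𝟙 _) := by rw [whiskerRight_unc, Category.comp_id]
  rw [h, ← Category.assoc]
  congr 1
  ext <;> simp

/-- The β-law of exponentials. -/
theorem lift_cur_eval {D A B : C} (f : D ⊗ A ⟶ B) (b : D ⟶ A) :
    lift (cur f) b ≫ unc (𝟙 _) = lift (𝟙 _) b ≫ f := by
  have h := lift_unc (𝟙 D) b (cur f)
  rw [Category.id_comp, unc_cur] at h
  exact h.symm

/-- The η-law of exponentials. -/
theorem cur_eval {D A B : C} (f : D ⟶ exp A B) :
    cur (lift (fst D A ≫ f) (snd D A) ≫ unc (𝟙 _)) = f := by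
  rw [← lift_unc, lift_fst_snd, Category.id_comp, cur_unc]

/-- The map `pushExp` pairs a value with the results of a function. -/
theorem lift_cur_pushExp {D E A B : C} (a : D ⟶ E) (k : D ⊗ A ⟶ B) :
    lift a (cur k) ≫ pushExp E A B = cur (lift (fst D A ≫ a) k) := by
  unfold pushExp
  rw [comp_cur]
  congr 1
  have h : (lift a (cur k) ▷ A) ≫ (α_ E (exp A B) A).hom ≫ (E ◁ unc (𝟙 (exp A B))) =
      lift (fst D A ≫ a) (lift (fst D A ≫ cur k) (snd D A) ≫ unc (𝟙 _)) := by
    ext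
    · simp
    · simp only [Category.assoc, whiskerLeft_snd, lift_snd]
      rw [← Category.assoc, ← Category.assoc]
      congr 1
      ext <;> simp
  rw [h, ← lift_unc, unc_cur, lift_fst_snd, Category.id_comp]

end Exponentials

/-! ### The calculus of the past modality -/

section Modalities

variable {C : Type v} [Category.{w} C]

namespace Modalities

variable (𝓜 : Modalities C)

theorem pastLE_refl {τ : ℕ} (h : τ ≤ τ) (A : C) : 𝓜.pastLE h A = 𝟙 _ := by
  simp [pastLE]

theorem pastLE_trans {a b c : ℕ} (h : b ≤ a) (h' : c ≤ b) (A : C) :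
    𝓜.pastLE h A ≫ 𝓜.pastLE h' A = 𝓜.pastLE (h'.trans h) A := by
  have : (homOfLE h).op ≫ (homOfLE h').op = (homOfLE (h'.trans h)).op := rfl
  simp only [pastLE, ← this, Functor.map_comp, NatTrans.comp_app]

theorem pastLE_natural {a b : ℕ} (h : b ≤ a) {A B : C} (f : A ⟶ B) :
    𝓜.pastLE h A ≫ (𝓜.past b).map f = (𝓜.past a).map f ≫ 𝓜.pastLE h B :=
  ((𝓜.P.map (homOfLE h).op).naturality f).symm

/-- The canonical map `⟨a⟩ ⟨b⟩ A ⟶ ⟨c⟩ A` for `c ≤ a + b`: multiplication followed by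
restriction. Restrictions before, inside or after such a map can be absorbed into it, and `now` at
either of two modalities is of this form, so that equations between composites of these maps hold
as soon as their end points agree. -/
def mu {a b c : ℕ} (h : c ≤ a + b) (A : C) :
    (𝓜.past a).obj ((𝓜.past b).obj A) ⟶ (𝓜.past c).obj A :=
  (𝓜.μ a b).hom.app A ≫ 𝓜.pastLE h A

theorem mu_natural {a b c : ℕ} (h : c ≤ a + b) {A B : C} (f : A ⟶ B) :
    (𝓜.past a).map ((𝓜.past b).map f) ≫ 𝓜.mu h B = 𝓜.mu h A ≫ (𝓜.past c).map f := by
  have := (𝓜.μ a b).hom.naturality f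
  dsimp only [Functor.comp_map] at this
  rw [mu, mu, Category.assoc, pastLE_natural, ← Category.assoc, ← Category.assoc]
  exact congrArg (· ≫ 𝓜.pastLE h B) this

theorem mu_pastLE {a b c d : ℕ} (h : c ≤ a + b) (h' : d ≤ c) (A : C) :
    𝓜.mu h A ≫ 𝓜.pastLE h' A = 𝓜.mu (h'.trans h) A := by
  rw [mu, mu, Category.assoc, pastLE_trans]

theorem pastLE_mu {a a' b c : ℕ} (h : a ≤ a') (h' : c ≤ a + b) (A : C) :
    𝓜.pastLE h ((𝓜.past b).obj A) ≫ 𝓜.mu h' A =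
      𝓜.mu (h'.trans (Nat.add_le_add_right h b)) A := by
  have := 𝓜.μ_mono A h (le_refl b)
  have e : (𝓜.P.map (homOfLE (le_refl b)).op).app A = 𝟙 _ := 𝓜.pastLE_refl _ A
  rw [e, CategoryTheory.Functor.map_id, Category.id_comp] at this
  rw [mu, ← Category.assoc]
  erw [← this]
  rw [Category.assoc]
  exact congrArg ((𝓜.μ a' b).hom.app A ≫ ·) (𝓜.pastLE_trans _ _ A)

theorem map_pastLE_mu {a b b' c : ℕ} (h : b ≤ b') (h' : c ≤ a + b) (A : C) :
    (𝓜.past a).map (𝓜.pastLE h A) ≫ 𝓜.mu h' A =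
      𝓜.mu (h'.trans (Nat.add_le_add_left h a)) A := by
  have := 𝓜.μ_mono A (le_refl a) h
  have e : (𝓜.P.map (homOfLE (le_refl a)).op).app ((𝓜.past b').obj A) = 𝟙 _ :=
    𝓜.pastLE_refl _ _
  erw [e, Category.id_comp] at this
  rw [mu, ← Category.assoc]
  erw [← this]
  rw [Category.assoc]
  exact congrArg ((𝓜.μ a b').hom.app A ≫ ·) (𝓜.pastLE_trans _ _ A)

theorem past_map_eqToHom {a b : ℕ} (h : a = b) (h' : op a = op b) (A : C) :
    (𝓜.P.map (eqToHom h')).app A = 𝓜.pastLE (le_of_eq h.symm) A := by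
  congr 1

/-- Associativity: three modalities can be merged in either order. -/
theorem mu_mu {a b c d e f : ℕ} (h₁ : d ≤ b + c) (h₂ : e ≤ a + d) (k₁ : f ≤ a + b)
    (k₂ : e ≤ f + c) (A : C) :
    (𝓜.past a).map (𝓜.mu h₁ A) ≫ 𝓜.mu h₂ A =
      𝓜.mu k₁ ((𝓜.past c).obj A) ≫ 𝓜.mu k₂ A := by
  have := 𝓜.μ_μ A a b c
  erw [𝓜.past_map_eqToHom (Nat.add_assoc a b c)] at this
  rw [mu, Functor.map_comp, Category.assoc, map_pastLE_mu]
  change _ = ((𝓜.μ a b).hom.app _ ≫ 𝓜.pastLE k₁ _) ≫ _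
  rw [Category.assoc, pastLE_mu, mu, mu, ← Category.assoc]
  erw [← this]
  simp only [Category.assoc]
  congr 2
  exact 𝓜.pastLE_trans _ _ A

theorem η_now (A : C) : 𝓜.η.hom.app A ≫ 𝓜.now 0 A = 𝟙 A := by
  rw [now, pastLE_refl, Category.id_comp]
  exact 𝓜.η.hom_inv_id_app A

theorem η_natural {A B : C} (f : A ⟶ B) :
    𝓜.η.hom.app A ≫ (𝓜.past 0).map f = f ≫ 𝓜.η.hom.app B :=
  (𝓜.η.hom.naturality f).symm

theorem now_natural (τ : ℕ) {A B : C} (f : A ⟶ B) :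
    (𝓜.past τ).map f ≫ 𝓜.now τ B = 𝓜.now τ A ≫ f := by
  have := 𝓜.η.inv.naturality f
  rw [now, now, Category.assoc]
  erw [← this]
  rw [← Category.assoc, ← pastLE_natural, Category.assoc]

theorem pastLE_now {a b : ℕ} (h : b ≤ a) (A : C) :
    𝓜.pastLE h A ≫ 𝓜.now b A = 𝓜.now a A := by
  rw [now, now, ← Category.assoc, pastLE_trans]

/-- Forgetting the outer of two modalities is the same as merging them and restricting. By
`map_now_eq_mu`, so is forgetting the inner one. -/
theorem now_eq_mu {a b : ℕ} (h : b ≤ a + b) (A : C) :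
    𝓜.now a ((𝓜.past b).obj A) = 𝓜.mu h A := by
  have h0 := 𝓜.η_μ A b
  erw [𝓜.past_map_eqToHom (Nat.zero_add b).symm] at h0
  have h1 : 𝓜.η.inv.app ((𝓜.past b).obj A) = 𝓜.mu (Nat.zero_add b).symm.le A := by
    rw [← cancel_epi (𝓜.η.hom.app ((𝓜.past b).obj A))]
    erw [𝓜.η.hom_inv_id_app]
    rw [mu, ← Category.assoc]
    erw [h0]
    rw [pastLE_trans, pastLE_refl]
    rfl
  rw [now, h1, pastLE_mu]

theorem map_now_eq_mu {a b : ℕ} (h : a ≤ a + b) (A : C) :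
    (𝓜.past a).map (𝓜.now b A) = 𝓜.mu h A := by
  have h0 := 𝓜.map_η_μ A a
  have h1 : (𝓜.past a).map (𝓜.η.inv.app A) = 𝓜.mu (le_refl (a + 0)) A := by
    rw [← cancel_epi ((𝓜.past a).map (𝓜.η.hom.app A)), ← Functor.map_comp, mu, pastLE_refl]
    erw [𝓜.η.hom_inv_id_app, CategoryTheory.Functor.map_id, Category.comp_id, h0]
    rfl
  rw [now, Functor.map_comp, h1, map_pastLE_mu]

theorem mu_now {a b c : ℕ} (h : c ≤ a + b) (A : C) :
    𝓜.mu h A ≫ 𝓜.now c A = 𝓜.now a _ ≫ 𝓜.now b A := by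
  rw [𝓜.now_eq_mu (Nat.le_add_left b a), ← 𝓜.pastLE_now (Nat.zero_le c),
    ← 𝓜.pastLE_now (Nat.zero_le b), ← Category.assoc, ← Category.assoc, mu_pastLE, mu_pastLE]

end Modalities
end Modalities

/-! ### The adjunction between the past and the future modality -/

section Modalities

variable {C : Type v} [Category.{w} C]

namespace Modalities

variable (𝓜 : Modalities C)

theorem unit_natural (τ : ℕ) {A B : C} (f : A ⟶ B) :
    f ≫ 𝓜.unit τ B = 𝓜.unit τ A ≫ (𝓜.fut τ).map ((𝓜.past τ).map f) :=
  (𝓜.adj τ).unit.naturality f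

theorem counit_natural (τ : ℕ) {A B : C} (f : A ⟶ B) :
    (𝓜.past τ).map ((𝓜.fut τ).map f) ≫ 𝓜.counit τ B = 𝓜.counit τ A ≫ f :=
  (𝓜.adj τ).counit.naturality f

theorem fut_map_comp_unit {τ : ℕ} {A B D : C} (f : (𝓜.past τ).obj B ⟶ D) (g : A ⟶ B) :
    g ≫ 𝓜.unit τ B ≫ (𝓜.fut τ).map f = 𝓜.unit τ A ≫ (𝓜.fut τ).map ((𝓜.past τ).map g ≫ f) := by
  rw [← Category.assoc, unit_natural, Category.assoc, Functor.map_comp]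

/-- Transposition along `⟨τ⟩ ⊣ [τ]` loses no information: the counit undoes it. -/
theorem map_transpose_counit {τ : ℕ} {A B : C} (f : (𝓜.past τ).obj A ⟶ B) :
    (𝓜.past τ).map (𝓜.unit τ A ≫ (𝓜.fut τ).map f) ≫ 𝓜.counit τ B = f := by
  rw [Functor.map_comp, Category.assoc, counit_natural, ← Category.assoc,
    (𝓜.adj τ).left_triangle_components, Category.id_comp]

/-- Maps into `[τ] B` are determined by their transposes along `⟨τ⟩ ⊣ [τ]`. -/
theorem hom_ext_fut {τ : ℕ} {A B : C} {f g : A ⟶ (𝓜.fut τ).obj B}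
    (h : (𝓜.past τ).map f ≫ 𝓜.counit τ B = (𝓜.past τ).map g ≫ 𝓜.counit τ B) : f = g := by
  apply ((𝓜.adj τ).homEquiv A B).symm.injective
  rw [Adjunction.homEquiv_counit, Adjunction.homEquiv_counit]
  exact h

theorem unit_zero (A : C) : 𝓜.unit 0 A = 𝓜.η.hom.app A ≫ 𝓜.ε.inv.app _ := by
  -- For `τ = 0` the restriction maps in the law for the unit are identities.
  have h := 𝓜.unit_zero_le A 0
  have e : (𝓜.P.map (homOfLE (Nat.zero_le 0)).op).app A = 𝟙 _ := 𝓜.pastLE_refl _ A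
  have e' : (𝓜.F.map (homOfLE (Nat.zero_le 0))).app ((𝓜.past 0).obj A) = 𝟙 _ := by
    have : homOfLE (Nat.zero_le 0) = 𝟙 0 := rfl
    rw [this]
    simp
  erw [e, e', CategoryTheory.Functor.map_id, Category.comp_id] at h
  rw [← cancel_epi (𝓜.η.inv.app A), ← cancel_epi (𝓜.ε.hom.app ((𝓜.past 0).obj A))]
  refine h.trans ?_
  rw [← Category.assoc (𝓜.η.inv.app A), 𝓜.η.inv_hom_id_app]
  erw [Category.id_comp]
  rw [𝓜.ε.hom_inv_id_app]

/-- The η-law of boxes: rewrapping the content of a box, weakened to the present, is weakening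
the box to the present. -/
theorem counit_unit_now (τ : ℕ) (A : C) :
    𝓜.counit τ A ≫ 𝓜.unit τ A ≫ (𝓜.fut τ).map (𝓜.now τ A) =
      𝓜.now τ ((𝓜.fut τ).obj A) := by
  have h2 := 𝓜.counit_zero_le A τ
  -- This is the law for the unit, with `η` and `ε` moved to the right-hand side.
  have key : 𝓜.unit τ A ≫ (𝓜.fut τ).map (𝓜.now τ A) =
      𝓜.ε.inv.app A ≫ (𝓜.F.map (homOfLE (Nat.zero_le τ))).app A := by
    have h1 := 𝓜.unit_zero_le A τ
    rw [← cancel_epi (𝓜.η.inv.app A), ← cancel_epi (𝓜.ε.hom.app ((𝓜.past 0).obj A))]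
    rw [now, Functor.map_comp]
    have h3 := congrArg (· ≫ (𝓜.fut τ).map (𝓜.η.inv.app A)) h1
    simp only [Category.assoc] at h3
    refine h3.trans ?_
    have n1 := (𝓜.F.map (homOfLE (Nat.zero_le τ))).naturality (𝓜.η.inv.app A)
    have n2 := 𝓜.ε.inv.naturality (𝓜.η.inv.app A)
    refine n1.symm.trans ?_
    rw [← Category.assoc (𝓜.η.inv.app A)]
    erw [n2]
    rw [Category.assoc]
    erw [Iso.hom_inv_id_app_assoc]
    rfl
  rw [key, now]
  have h3 := congrArg (· ≫ 𝓜.η.inv.app ((𝓜.fut τ).obj A)) h2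
  simp only [Category.assoc] at h3
  have n := 𝓜.η.inv.naturality ((𝓜.F.map (homOfLE (Nat.zero_le τ))).app A)
  erw [n] at h3
  erw [Iso.hom_inv_id_app_assoc] at h3
  exact h3

/-- Boxing the environment for `a + b` units of time is boxing it for `b` and then for `a` units.
Here the past modality `⟨b⟩` is added outside `⟨a⟩`, which gives `⟨b + a⟩` when merged; this is why
commutativity of addition occurs, in the form of the inequality that `mu` requires. -/
theorem unit_δ (A : C) (a b : ℕ) (h : a + b ≤ b + a) :
    𝓜.unit (a + b) A ≫ (𝓜.δ a b).hom.app _ =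
      𝓜.unit a A ≫ (𝓜.fut a).map (𝓜.unit b _ ≫ (𝓜.fut b).map (𝓜.mu h A)) := by
  have := 𝓜.unit_add A a b
  erw [𝓜.past_map_eqToHom (Nat.add_comm b a)] at this
  refine this.symm.trans ?_
  simp only [← Functor.map_comp]
  rfl

theorem unit_eq (A : C) (a b : ℕ) (h : a + b ≤ b + a) :
    𝓜.unit (a + b) A =
      𝓜.unit a A ≫ (𝓜.fut a).map (𝓜.unit b _ ≫ (𝓜.fut b).map (𝓜.mu h A)) ≫
        (𝓜.δ a b).inv.app _ := by
  rw [← Category.assoc, ← unit_δ, Category.assoc, (𝓜.δ a b).hom_inv_id_app]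
  exact (Category.comp_id _).symm

variable [CartesianMonoidalCategory C]

theorem m_fst (τ : ℕ) (A B : C) : 𝓜.m τ A B ≫ (𝓜.fut τ).map (fst A B) = fst _ _ := by
  apply 𝓜.hom_ext_fut
  rw [m, Category.assoc, ← Functor.map_comp, map_transpose_counit, lift_fst]

theorem m_snd (τ : ℕ) (A B : C) : 𝓜.m τ A B ≫ (𝓜.fut τ).map (snd A B) = snd _ _ := by
  apply 𝓜.hom_ext_fut
  rw [m, Category.assoc, ← Functor.map_comp, map_transpose_counit, lift_snd]

/-- The right adjoint `[τ]` preserves binary products: maps into `[τ] (A × B)` are determined by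
their components. -/
theorem hom_ext_fut_prod {τ : ℕ} {D A B : C} {f g : D ⟶ (𝓜.fut τ).obj (A ⊗ B)}
    (h₁ : f ≫ (𝓜.fut τ).map (fst A B) = g ≫ (𝓜.fut τ).map (fst A B))
    (h₂ : f ≫ (𝓜.fut τ).map (snd A B) = g ≫ (𝓜.fut τ).map (snd A B)) : f = g := by
  apply 𝓜.hom_ext_fut
  ext
  · rw [Category.assoc, Category.assoc, ← counit_natural, ← Functor.map_comp_assoc, h₁,
      Functor.map_comp_assoc]
  · rw [Category.assoc, Category.assoc, ← counit_natural, ← Functor.map_comp_assoc, h₂,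
      Functor.map_comp_assoc]

theorem lift_map_m {τ : ℕ} {D E A B : C} (u : D ⟶ (𝓜.fut τ).obj E) (f : E ⟶ A) (g : E ⟶ B) :
    lift (u ≫ (𝓜.fut τ).map f) (u ≫ (𝓜.fut τ).map g) ≫ 𝓜.m τ A B =
      u ≫ (𝓜.fut τ).map (lift f g) := by
  apply 𝓜.hom_ext_fut_prod
  · rw [Category.assoc, m_fst, lift_fst, Category.assoc, ← Functor.map_comp, lift_fst]
  · rw [Category.assoc, m_snd, lift_snd, Category.assoc, ← Functor.map_comp, lift_snd]

end Modalities
end Modalities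

/-! ### Extension of maps along the strong graded monad -/

namespace StrongGradedMonad

variable {C : Type v} [Category.{w} C] [CartesianMonoidalCategory C] {𝓜 : Modalities C}
  (𝓣 : StrongGradedMonad 𝓜)

/-- Running a computation `t` in the environment `E` and mapping its result, paired with the
environment aged by the running time of `t`, along `k`. Sequencing and handling are both of this
form, followed by the multiplication or by a handling morphism. -/
def ext {E X Z : C} {τ : ℕ} (t : E ⟶ (𝓣.T τ).obj X) (k : (𝓜.past τ).obj E ⊗ X ⟶ Z) :
    E ⟶ (𝓣.T τ).obj Z :=
  lift (𝓜.unit τ E) t ≫ 𝓣.str τ _ _ ≫ (𝓣.T τ).map k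

theorem lift_str {D A A' B B' : C} {τ : ℕ} (a : D ⟶ (𝓜.fut τ).obj A) (t : D ⟶ (𝓣.T τ).obj B)
    (f : A ⟶ A') (g : B ⟶ B') :
    lift (a ≫ (𝓜.fut τ).map f) (t ≫ (𝓣.T τ).map g) ≫ 𝓣.str τ A' B' =
      lift a t ≫ 𝓣.str τ A B ≫ (𝓣.T τ).map (f ⊗ₘ g) := by
  rw [← 𝓣.str_natural, ← Category.assoc, lift_map]

theorem lift_str_left {D A A' B : C} {τ : ℕ} (a : D ⟶ (𝓜.fut τ).obj A) (t : D ⟶ (𝓣.T τ).obj B)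
    (f : A ⟶ A') :
    lift (a ≫ (𝓜.fut τ).map f) t ≫ 𝓣.str τ A' B =
      lift a t ≫ 𝓣.str τ A B ≫ (𝓣.T τ).map (f ▷ B) := by
  have := 𝓣.lift_str a t f (𝟙 B)
  rwa [CategoryTheory.Functor.map_id, Category.comp_id, tensorHom_id] at this

theorem comp_ext {D E X Z : C} {τ : ℕ} (f : D ⟶ E) (t : E ⟶ (𝓣.T τ).obj X)
    (k : (𝓜.past τ).obj E ⊗ X ⟶ Z) :
    f ≫ 𝓣.ext t k = 𝓣.ext (f ≫ t) (((𝓜.past τ).map f ▷ X) ≫ k) := by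
  rw [ext, ext, ← Category.assoc, comp_lift, Modalities.unit_natural, Functor.map_comp,
    ← Category.assoc, lift_str_left, Category.assoc, Category.assoc]

theorem ext_map {E X Z Z' : C} {τ : ℕ} (t : E ⟶ (𝓣.T τ).obj X)
    (k : (𝓜.past τ).obj E ⊗ X ⟶ Z) (g : Z ⟶ Z') :
    𝓣.ext t k ≫ (𝓣.T τ).map g = 𝓣.ext t (k ≫ g) := by
  rw [ext, ext, Functor.map_comp, Category.assoc, Category.assoc]

theorem ext_ret {E X Z : C} (x : E ⟶ X) (k : (𝓜.past 0).obj E ⊗ X ⟶ Z) :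
    𝓣.ext (x ≫ 𝓣.ret.app X) k = lift (𝓜.η.hom.app E) x ≫ k ≫ 𝓣.ret.app Z := by
  have h : lift (𝓜.unit 0 E) (x ≫ 𝓣.ret.app X) =
      lift (𝓜.η.hom.app E) x ≫ (𝓜.ε.inv.app _ ⊗ₘ 𝓣.ret.app X) := by
    rw [Modalities.unit_zero]
    exact (lift_map _ _ _ _).symm
  rw [ext, h, Category.assoc, ← Category.assoc (_ ⊗ₘ _)]
  erw [𝓣.str_ret]
  have n := 𝓣.ret.naturality k
  erw [← n]
  rfl

/-- An extension that ignores the environment is the action of the functor `T τ`. -/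
theorem ext_snd {E X Z : C} {τ : ℕ} (t : E ⟶ (𝓣.T τ).obj X) (g : X ⟶ Z) :
    𝓣.ext t (snd _ X ≫ g) = t ≫ (𝓣.T τ).map g := by
  rw [ext, Functor.map_comp, ← Category.assoc (𝓣.str _ _ _), 𝓣.str_snd, ← Category.assoc,
    lift_snd]

/-- Pairing a result with the same environment twice is pairing it once, and then duplicating the
environment. -/
theorem lift_lift_str {E A X : C} {τ : ℕ} (a : E ⟶ (𝓜.fut τ).obj A) (t : E ⟶ (𝓣.T τ).obj X) :
    lift a (lift a t ≫ 𝓣.str τ A X) ≫ 𝓣.str τ A (A ⊗ X) =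
      lift a t ≫ 𝓣.str τ A X ≫ (𝓣.T τ).map (lift (fst A X) (𝟙 _)) := by
  have h := congrArg (lift a (lift a t) ≫ ·) (𝓣.str_assoc τ A A X)
  rw [← Category.assoc, ← Category.assoc, lift_lift_associator_inv, lift_whiskerRight,
    ← Category.assoc (lift _ _) (_ ◁ _), lift_whiskerLeft] at h
  rw [← h]
  have d : lift a a ≫ 𝓜.m τ A A = a ≫ (𝓜.fut τ).map (lift (𝟙 A) (𝟙 A)) := by
    have := 𝓜.lift_map_m a (𝟙 A) (𝟙 A)
    rwa [CategoryTheory.Functor.map_id, Category.comp_id] at this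
  rw [d, ← Category.assoc, lift_str_left, Category.assoc, Category.assoc, ← Functor.map_comp]
  congr 3
  ext <;> simp

/-- Associativity of sequencing. In the nested computation on the right, the environment ages by
`τ` and then by `τ'`, and `mu` merges the two modalities. -/
theorem ext_ext {E X Y Z : C} {τ τ' : ℕ} (t : E ⟶ (𝓣.T τ).obj X)
    (k : (𝓜.past τ).obj E ⊗ X ⟶ (𝓣.T τ').obj Y) (p : (𝓜.past (τ + τ')).obj E ⊗ Y ⟶ Z)
    (h : τ + τ' ≤ τ' + τ) :
    𝓣.ext (𝓣.ext t k ≫ (𝓣.mult τ τ').app Y) p =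
      𝓣.ext t (𝓣.ext k ((((𝓜.past τ').map (fst _ X) ≫ 𝓜.mu h E) ▷ Y) ≫ p)) ≫
        (𝓣.mult τ τ').app Z := by
  -- Split the box around the environment into two, and use that the strength respects `mult`.
  have e1 : lift (𝓜.unit (τ + τ') E) (𝓣.ext t k ≫ (𝓣.mult τ τ').app Y) =
      lift (𝓜.unit τ E ≫ (𝓜.fut τ).map (𝓜.unit τ' _ ≫ (𝓜.fut τ').map (𝓜.mu h E))) (𝓣.ext t k) ≫
        ((𝓜.δ τ τ').inv.app _ ⊗ₘ (𝓣.mult τ τ').app Y) := by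
    rw [𝓜.unit_eq E τ τ' h, ← Category.assoc]
    exact (lift_map _ _ _ _).symm
  rw [ext, e1, Category.assoc, ← Category.assoc (_ ⊗ₘ _), ← 𝓣.str_mult]
  have e2 : lift (𝓜.unit τ E ≫ (𝓜.fut τ).map (𝓜.unit τ' _ ≫ (𝓜.fut τ').map (𝓜.mu h E)))
      (𝓣.ext t k) ≫ 𝓣.str τ _ _ =
      lift (𝓜.unit τ E) t ≫ 𝓣.str τ _ _ ≫ (𝓣.T τ).map (lift (fst _ X) (𝟙 _) ≫
        ((𝓜.unit τ' _ ≫ (𝓜.fut τ').map (𝓜.mu h E)) ⊗ₘ k)) := by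
    rw [ext, ← Category.assoc (lift _ _) (𝓣.str _ _ _), lift_str, ← Category.assoc,
      lift_lift_str, Category.assoc, Category.assoc, ← Functor.map_comp]
  rw [Category.assoc (𝓣.str _ _ _), ← Category.assoc (lift _ _) (𝓣.str _ _ _), e2]
  have n := (𝓣.mult τ τ').naturality p
  have n' : (𝓣.mult τ τ').app (((𝓜.past (τ + τ')).obj E) ⊗ Y) ≫ (𝓣.T (τ + τ')).map p =
    (𝓣.T τ).map ((𝓣.T τ').map p) ≫ (𝓣.mult τ τ').app Z := n.symm
  simp only [Category.assoc]
  rw [n']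
  conv_rhs => rw [ext]
  simp only [Category.assoc]
  congr 2
  simp only [← Functor.map_comp_assoc]
  congr 2
  rw [ext, Functor.map_comp, ← Category.assoc (𝓣.str _ _ _), ← Category.assoc (lift _ _)]
  conv_rhs => rw [← lift_str_left, ← 𝓜.fut_map_comp_unit]
  rw [lift_map, Category.id_comp]
  simp only [Category.assoc]

end StrongGradedMonad

/-! ### Combinators interpreting the term formers -/

namespace Model

variable {S : Signature.{u}} {C : Type v} [Category.{w} C] [CartesianMonoidalCategory C]
  [MonoidalClosed C] [HasProductsOfShape ℕ C] [HasProductsOfShape S.Op C] (𝓜 : Model S C)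

/-- The interpretation of boxing a value. -/
def boxS (τ : ℕ) {E X : C} (x : (𝓜.past τ).obj E ⟶ X) : E ⟶ (𝓜.fut τ).obj X :=
  𝓜.mods.unit τ E ≫ (𝓜.fut τ).map x

/-- The interpretation of sequencing. -/
def letS {τ τ' : ℕ} {E X Y : C} (t : E ⟶ (𝓜.T τ).obj X)
    (k : (𝓜.past τ).obj E ⊗ X ⟶ (𝓜.T τ').obj Y) : E ⟶ (𝓜.T (τ + τ')).obj Y :=
  𝓜.monad.ext t k ≫ (𝓜.monad.mult τ τ').app Y

/-- The interpretation of performing an operation. -/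
def opS (o : S.Op) {τ : ℕ} {E A : C} (x : E ⟶ 𝓜.arg o)
    (k : (𝓜.past (S.opTime o)).obj E ⊗ 𝓜.res o ⟶ (𝓜.T τ).obj A) :
    E ⟶ (𝓜.T (S.opTime o + τ)).obj A :=
  lift x (𝓜.boxS (S.opTime o) (cur k)) ≫ 𝓜.opT o τ A

/-- The interpretation of delaying. -/
def delayS (τ : ℕ) {τ' : ℕ} {E A : C} (k : (𝓜.past τ).obj E ⟶ (𝓜.T τ').obj A) :
    E ⟶ (𝓜.T (τ + τ')).obj A :=
  𝓜.boxS τ k ≫ (𝓜.delayT τ τ').app A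

/-- The interpretation of a family of operation clauses. -/
def clausesS {E Y : C}
    (hs : ∀ (o : S.Op) (θ : ℕ), (E ⊗ 𝓜.arg o) ⊗
      (𝓜.fut (S.opTime o)).obj (exp (𝓜.res o) ((𝓜.T θ).obj Y)) ⟶
        (𝓜.T (S.opTime o + θ)).obj Y) : E ⟶ 𝓜.handlers Y :=
  Pi.lift fun o => Pi.lift fun θ => cur ((α_ _ _ _).inv ≫ hs o θ)

/-- The interpretation of handling. -/
def handleS {τ τ' : ℕ} {E X Y : C} (t : E ⟶ (𝓜.T τ).obj X)
    (k : (𝓜.past τ).obj E ⊗ X ⟶ (𝓜.T τ').obj Y)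
    (hs : ∀ (o : S.Op) (θ : ℕ), (E ⊗ 𝓜.arg o) ⊗
      (𝓜.fut (S.opTime o)).obj (exp (𝓜.res o) ((𝓜.T θ).obj Y)) ⟶
        (𝓜.T (S.opTime o + θ)).obj Y) : E ⟶ (𝓜.T (τ + τ')).obj Y :=
  lift (𝓜.clausesS hs) (𝓜.monad.ext t k) ≫ unc (𝓜.hdl Y τ τ')

/-- The interpretation of unboxing, along a map `p` to the environment in which the box lives. -/
def unboxS {τ : ℕ} {E D X Z : C} (p : E ⟶ (𝓜.past τ).obj D) (x : D ⟶ (𝓜.fut τ).obj X)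
    (k : E ⊗ X ⟶ Z) : E ⟶ Z :=
  lift (𝟙 E) (p ≫ (𝓜.past τ).map x ≫ 𝓜.mods.counit τ X) ≫ k

/-! ### Stability under change of environment -/

theorem comp_boxS {τ : ℕ} {D E X : C} (f : D ⟶ E) (x : (𝓜.past τ).obj E ⟶ X) :
    f ≫ 𝓜.boxS τ x = 𝓜.boxS τ ((𝓜.past τ).map f ≫ x) :=
  𝓜.mods.fut_map_comp_unit _ _

theorem comp_letS {τ τ' : ℕ} {D E X Y : C} (f : D ⟶ E) (t : E ⟶ (𝓜.T τ).obj X)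
    (k : (𝓜.past τ).obj E ⊗ X ⟶ (𝓜.T τ').obj Y) :
    f ≫ 𝓜.letS t k = 𝓜.letS (f ≫ t) (((𝓜.past τ).map f ▷ X) ≫ k) := by
  rw [letS, letS, ← Category.assoc, StrongGradedMonad.comp_ext]

theorem comp_opS (o : S.Op) {τ : ℕ} {D E A : C} (f : D ⟶ E) (x : E ⟶ 𝓜.arg o)
    (k : (𝓜.past (S.opTime o)).obj E ⊗ 𝓜.res o ⟶ (𝓜.T τ).obj A) :
    f ≫ 𝓜.opS o x k = 𝓜.opS o (f ≫ x) (((𝓜.past (S.opTime o)).map f ▷ 𝓜.res o) ≫ k) := by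
  rw [opS, opS, ← Category.assoc, comp_lift, comp_boxS, comp_cur]

theorem comp_delayS {τ τ' : ℕ} {D E A : C} (f : D ⟶ E)
    (k : (𝓜.past τ).obj E ⟶ (𝓜.T τ').obj A) :
    f ≫ 𝓜.delayS τ k = 𝓜.delayS τ ((𝓜.past τ).map f ≫ k) := by
  rw [delayS, delayS, ← Category.assoc, comp_boxS]

theorem comp_clausesS {D E Y : C} (f : D ⟶ E)
    (hs : ∀ (o : S.Op) (θ : ℕ), (E ⊗ 𝓜.arg o) ⊗
      (𝓜.fut (S.opTime o)).obj (exp (𝓜.res o) ((𝓜.T θ).obj Y)) ⟶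
        (𝓜.T (S.opTime o + θ)).obj Y) :
    f ≫ 𝓜.clausesS hs = 𝓜.clausesS fun o θ => ((f ▷ 𝓜.arg o) ▷ _) ≫ hs o θ := by
  unfold clausesS
  apply Pi.hom_ext
  intro o
  apply Pi.hom_ext
  intro θ
  simp only [Category.assoc, Pi.lift_π, comp_cur]
  congr 1
  rw [← Category.assoc, ← Category.assoc]
  congr 1
  ext <;> simp

theorem comp_handleS {τ τ' : ℕ} {D E X Y : C} (f : D ⟶ E) (t : E ⟶ (𝓜.T τ).obj X)
    (k : (𝓜.past τ).obj E ⊗ X ⟶ (𝓜.T τ').obj Y)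
    (hs : ∀ (o : S.Op) (θ : ℕ), (E ⊗ 𝓜.arg o) ⊗
      (𝓜.fut (S.opTime o)).obj (exp (𝓜.res o) ((𝓜.T θ).obj Y)) ⟶
        (𝓜.T (S.opTime o + θ)).obj Y) :
    f ≫ 𝓜.handleS t k hs =
      𝓜.handleS (f ≫ t) (((𝓜.past τ).map f ▷ X) ≫ k) fun o θ => ((f ▷ 𝓜.arg o) ▷ _) ≫ hs o θ := by
  rw [handleS, handleS, ← Category.assoc, comp_lift, comp_clausesS, StrongGradedMonad.comp_ext]

theorem comp_unboxS {τ : ℕ} {D E D' E' X Z : C} (f : E' ⟶ E) (p : E ⟶ (𝓜.past τ).obj D)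
    (f' : D' ⟶ D) (p' : E' ⟶ (𝓜.past τ).obj D') (hp : p' ≫ (𝓜.past τ).map f' = f ≫ p)
    (x : D ⟶ (𝓜.fut τ).obj X) (k : E ⊗ X ⟶ Z) :
    f ≫ 𝓜.unboxS p x k = 𝓜.unboxS p' (f' ≫ x) ((f ▷ X) ≫ k) := by
  rw [unboxS, unboxS, ← Category.assoc, ← Category.assoc (lift _ _), comp_lift, lift_whiskerRight,
    Category.comp_id, Category.id_comp, Functor.map_comp, Category.assoc, ← Category.assoc p', hp,
    Category.assoc]

/-! ### The equations of sequencing -/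

theorem letS_ret {τ : ℕ} {E X Y : C} (x : E ⟶ X)
    (k : (𝓜.past 0).obj E ⊗ X ⟶ (𝓜.T τ).obj Y) :
    𝓜.letS (x ≫ 𝓜.monad.ret.app X) k =
      (lift (𝓜.mods.η.hom.app E) x ≫ k) ≫ 𝓜.castT (Nat.zero_add τ).symm Y := by
  rw [letS, StrongGradedMonad.ext_ret, Category.assoc, Category.assoc, Category.assoc,
    𝓜.monad.ret_mult]

theorem letS_eta {τ : ℕ} {E X : C} (t : E ⟶ (𝓜.T τ).obj X) :
    𝓜.letS t (snd _ X ≫ 𝓜.monad.ret.app X) = t := by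
  rw [letS, StrongGradedMonad.ext_snd, Category.assoc, 𝓜.monad.map_ret_mult, Category.comp_id]

theorem letS_letS {τ τ' τ'' : ℕ} {E X Y Z : C} (t : E ⟶ (𝓜.T τ).obj X)
    (k : (𝓜.past τ).obj E ⊗ X ⟶ (𝓜.T τ').obj Y)
    (p : (𝓜.past (τ + τ')).obj E ⊗ Y ⟶ (𝓜.T τ'').obj Z) (h : τ + τ' ≤ τ' + τ) :
    𝓜.letS (𝓜.letS t k) p ≫ 𝓜.castT (Nat.add_assoc τ τ' τ'') Z =
      𝓜.letS t (𝓜.letS k ((((𝓜.past τ').map (fst _ X) ≫ 𝓜.mods.mu h E) ▷ Y) ≫ p)) := by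
  unfold letS
  rw [StrongGradedMonad.ext_ext _ _ _ _ h, Category.assoc, Category.assoc, 𝓜.monad.mult_mult,
    ← Category.assoc, StrongGradedMonad.ext_map]

/-- A box for `τ + τ'` units of time as a box within a box. -/
theorem boxS_δ {τ τ' : ℕ} {E : C} (h : τ + τ' ≤ τ' + τ) :
    𝓜.mods.unit (τ + τ') E ≫ (𝓜.mods.δ τ τ').hom.app _ =
      𝓜.boxS τ (𝓜.boxS τ' (𝓜.mods.mu h E)) :=
  𝓜.mods.unit_δ E τ τ' h

theorem lift_boxS_m {τ : ℕ} {E X Y : C} (f : (𝓜.past τ).obj E ⟶ X)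
    (g : (𝓜.past τ).obj E ⟶ Y) :
    lift (𝓜.boxS τ f) (𝓜.boxS τ g) ≫ 𝓜.mods.m τ X Y = 𝓜.boxS τ (lift f g) :=
  𝓜.mods.lift_map_m _ _ _

theorem boxS_map {τ : ℕ} {E X Y : C} (f : (𝓜.past τ).obj E ⟶ X) (g : X ⟶ Y) :
    𝓜.boxS τ f ≫ (𝓜.fut τ).map g = 𝓜.boxS τ (f ≫ g) := by
  rw [boxS, boxS, Category.assoc, Functor.map_comp]

/-- Extensions can be moved under a delay. The continuation then runs in an environment that has
aged in two steps, which are merged by `mu`. -/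
theorem ext_delayS {τ τ' : ℕ} {E X Z : C} (k : (𝓜.past τ).obj E ⟶ (𝓜.T τ').obj X)
    (n : (𝓜.past (τ + τ')).obj E ⊗ X ⟶ Z) (h : τ + τ' ≤ τ' + τ) :
    𝓜.monad.ext (𝓜.delayS τ k) n =
      𝓜.delayS τ (𝓜.monad.ext k ((𝓜.mods.mu h E ▷ X) ≫ n)) := by
  have h1 : lift (𝓜.mods.unit (τ + τ') E) (𝓜.delayS τ k) =
      lift (𝓜.mods.unit (τ + τ') E) (𝓜.boxS τ k) ≫ (_ ◁ (𝓜.delayT τ τ').app X) := by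
    rw [lift_whiskerLeft, delayS]
  have nat := (𝓜.delayT τ τ').naturality n
  dsimp only [Functor.comp_map] at nat
  rw [StrongGradedMonad.ext, h1, Category.assoc, ← Category.assoc (_ ◁ _), 𝓜.delayT_str]
  simp only [Category.assoc]
  rw [← nat, ← Category.assoc, lift_whiskerRight, boxS_δ _ h, ← Category.assoc, lift_boxS_m,
    ← Category.assoc, boxS_map, ← Category.assoc, boxS_map]
  rw [delayS]
  congr 2
  rw [StrongGradedMonad.ext, Functor.map_comp, ← Category.assoc (𝓜.monad.str _ _ _),
    ← Category.assoc (lift _ _) (_ ≫ _), ← StrongGradedMonad.lift_str_left, Category.assoc]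
  exact (Category.assoc _ _ _).symm

theorem letS_delayS {τ τ' τ'' : ℕ} {E X Y : C} (k : (𝓜.past τ).obj E ⟶ (𝓜.T τ').obj X)
    (n : (𝓜.past (τ + τ')).obj E ⊗ X ⟶ (𝓜.T τ'').obj Y) (h : τ + τ' ≤ τ' + τ) :
    𝓜.letS (𝓜.delayS τ k) n =
      𝓜.delayS τ (𝓜.letS k ((𝓜.mods.mu h E ▷ X) ≫ n)) ≫
        𝓜.castT (Nat.add_assoc τ τ' τ'').symm Y := by
  rw [letS, ext_delayS _ _ _ h, delayS, Category.assoc, 𝓜.delayT_mult, ← Category.assoc, boxS_map,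
    delayS, Category.assoc]
  rfl

theorem opS_map (o : S.Op) {τ : ℕ} {E A B : C} (x : E ⟶ 𝓜.arg o)
    (k : (𝓜.past (S.opTime o)).obj E ⊗ 𝓜.res o ⟶ (𝓜.T τ).obj A) (f : A ⟶ B) :
    𝓜.opS o x k ≫ (𝓜.T (S.opTime o + τ)).map f = 𝓜.opS o x (k ≫ (𝓜.T τ).map f) := by
  rw [opS, opS, Category.assoc, ← 𝓜.opT_natural, ← Category.assoc, lift_whiskerLeft, boxS_map,
    cur_expMap]

/-- Extensions can be moved into the continuation of an operation, where the environment has aged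
in two steps, and the result of the operation has to be projected away. -/
theorem ext_opS (o : S.Op) {τ : ℕ} {E X Z : C} (x : E ⟶ 𝓜.arg o)
    (k : (𝓜.past (S.opTime o)).obj E ⊗ 𝓜.res o ⟶ (𝓜.T τ).obj X)
    (n : (𝓜.past (S.opTime o + τ)).obj E ⊗ X ⟶ Z) (h : S.opTime o + τ ≤ τ + S.opTime o) :
    𝓜.monad.ext (𝓜.opS o x k) n =
      𝓜.opS o x (𝓜.monad.ext k
        ((((𝓜.past τ).map (fst _ (𝓜.res o)) ≫ 𝓜.mods.mu h E) ▷ X) ≫ n)) := by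
  have h1 : lift (𝓜.mods.unit (S.opTime o + τ) E) (𝓜.opS o x k) ≫ 𝓜.monad.str _ _ _ =
      𝓜.opS o x (lift (fst _ _ ≫ 𝓜.boxS τ (𝓜.mods.mu h E)) k ≫ 𝓜.monad.str τ _ X) := by
    have h2 : lift (𝓜.mods.unit (S.opTime o + τ) E) (𝓜.opS o x k) =
      lift (𝓜.mods.unit (S.opTime o + τ) E) (lift x (𝓜.boxS (S.opTime o) (cur k))) ≫
        (_ ◁ 𝓜.opT o τ X) := by
      rw [lift_whiskerLeft, opS]
    have h3 : lift (𝓜.mods.unit (S.opTime o + τ) E)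
        (lift x (𝓜.boxS (S.opTime o) (cur k))) ≫ exch _ _ _ =
        lift x (lift (𝓜.mods.unit (S.opTime o + τ) E) (𝓜.boxS (S.opTime o) (cur k))) := by
      unfold exch
      ext <;> simp
    rw [h2, Category.assoc, 𝓜.opT_str, ← Category.assoc, h3]
    rw [← Category.assoc, lift_whiskerLeft, lift_whiskerRight, boxS_δ _ h, ← Category.assoc,
      lift_whiskerLeft, lift_boxS_m, ← Category.assoc, lift_whiskerLeft, boxS_map,
      ← Category.assoc, lift_whiskerLeft, boxS_map, lift_cur_pushExp, cur_expMap]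
    rfl
  rw [StrongGradedMonad.ext, ← Category.assoc, h1, opS_map]
  congr 1
  rw [comp_boxS, StrongGradedMonad.ext, Functor.map_comp, ← Category.assoc (𝓜.monad.str _ _ _),
    ← Category.assoc (lift _ _) (_ ≫ _), ← StrongGradedMonad.lift_str_left, Category.assoc]
  exact (Category.assoc _ _ _).symm

theorem letS_opS (o : S.Op) {τ τ' : ℕ} {E X Y : C} (x : E ⟶ 𝓜.arg o)
    (k : (𝓜.past (S.opTime o)).obj E ⊗ 𝓜.res o ⟶ (𝓜.T τ).obj X)
    (n : (𝓜.past (S.opTime o + τ)).obj E ⊗ X ⟶ (𝓜.T τ').obj Y)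
    (h : S.opTime o + τ ≤ τ + S.opTime o) :
    𝓜.letS (𝓜.opS o x k) n =
      𝓜.opS o x (𝓜.letS k
        ((((𝓜.past τ).map (fst _ (𝓜.res o)) ≫ 𝓜.mods.mu h E) ▷ X) ≫ n)) ≫
        𝓜.castT (Nat.add_assoc (S.opTime o) τ τ').symm Y := by
  rw [letS, ext_opS _ _ _ _ _ h, opS, Category.assoc, 𝓜.opT_mult, ← Category.assoc,
    lift_whiskerLeft, boxS_map, cur_expMap, opS, Category.assoc]
  rfl

/-! ### The equations of handling -/

theorem handleS_ret {τ : ℕ} {E X Y : C} (x : E ⟶ X)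
    (k : (𝓜.past 0).obj E ⊗ X ⟶ (𝓜.T τ).obj Y)
    (hs : ∀ (o : S.Op) (θ : ℕ), (E ⊗ 𝓜.arg o) ⊗
      (𝓜.fut (S.opTime o)).obj (exp (𝓜.res o) ((𝓜.T θ).obj Y)) ⟶
        (𝓜.T (S.opTime o + θ)).obj Y) :
    𝓜.handleS (x ≫ 𝓜.monad.ret.app X) k hs =
      (lift (𝓜.mods.η.hom.app E) x ≫ k) ≫ 𝓜.castT (Nat.zero_add τ).symm Y := by
  have h : lift (𝓜.clausesS hs) (𝓜.monad.ext (x ≫ 𝓜.monad.ret.app X) k) =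
      lift (𝓜.clausesS hs) (lift (𝓜.mods.η.hom.app E) x ≫ k) ≫
        (_ ◁ 𝓜.monad.ret.app ((𝓜.T τ).obj Y)) := by
    rw [lift_whiskerLeft, StrongGradedMonad.ext_ret, Category.assoc]
  rw [handleS, h, Category.assoc, 𝓜.hdl_ret, ← Category.assoc, lift_snd]

/-- The handler clauses move under `[τ]` in the form in which they occur in the laws `hdl_delay` and
`hdl_op`: they are aged by `τ`, and then brought back to the present by `now`. -/
theorem unit_now {τ : ℕ} {E H A : C} (h : E ⟶ H) (k : (𝓜.past τ).obj E ⟶ A) :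
    (lift (h ≫ 𝓜.mods.unit τ H) (𝓜.boxS τ k) ≫ 𝓜.mods.m τ _ A) ≫
      (𝓜.fut τ).map (𝓜.mods.now τ H ▷ A) =
      𝓜.boxS τ (lift (𝓜.mods.now τ E ≫ h) k) := by
  rw [Modalities.unit_natural]
  change (lift (𝓜.boxS τ _) _ ≫ _) ≫ _ = _
  rw [lift_boxS_m, boxS_map, lift_whiskerRight, Modalities.now_natural]

/-- Handling moves under a delay. The clauses, which are made for the present environment, are
weakened along `now` to the aged one. -/
theorem handleS_delayS {τ τ' τ'' : ℕ} {E X Y : C} (k : (𝓜.past τ).obj E ⟶ (𝓜.T τ').obj X)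
    (n : (𝓜.past (τ + τ')).obj E ⊗ X ⟶ (𝓜.T τ'').obj Y)
    (hs : ∀ (o : S.Op) (θ : ℕ), (E ⊗ 𝓜.arg o) ⊗
      (𝓜.fut (S.opTime o)).obj (exp (𝓜.res o) ((𝓜.T θ).obj Y)) ⟶
        (𝓜.T (S.opTime o + θ)).obj Y) (h : τ + τ' ≤ τ' + τ) :
    𝓜.handleS (𝓜.delayS τ k) n hs =
      𝓜.delayS τ (𝓜.handleS k ((𝓜.mods.mu h E ▷ X) ≫ n)
        fun o θ => ((𝓜.mods.now τ E ▷ 𝓜.arg o) ▷ _) ≫ hs o θ) ≫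
        𝓜.castT (Nat.add_assoc τ τ' τ'').symm Y := by
  rw [handleS, ext_delayS _ _ _ h]
  have h1 : ∀ x : (𝓜.past τ).obj E ⟶ (𝓜.T τ').obj ((𝓜.T τ'').obj Y),
      lift (𝓜.clausesS hs) (𝓜.delayS τ x) =
      lift (𝓜.clausesS hs) (𝓜.boxS τ x) ≫ (_ ◁ (𝓜.delayT τ τ').app _) := by
    intro x
    rw [lift_whiskerLeft, delayS]
  rw [h1, Category.assoc, 𝓜.hdl_delay, ← Category.assoc, lift_whiskerRight, ← Category.assoc,
    ← Category.assoc, unit_now, ← Category.assoc, boxS_map, comp_clausesS, delayS, Category.assoc]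
  rfl

/-- Handling an operation runs its clause, with a boxed continuation in which the rest of the
computation is handled by the same clauses, weakened to the environment of the box. -/
theorem handleS_opS (o : S.Op) {τ τ' : ℕ} {E X Y : C} (x : E ⟶ 𝓜.arg o)
    (k : (𝓜.past (S.opTime o)).obj E ⊗ 𝓜.res o ⟶ (𝓜.T τ).obj X)
    (n : (𝓜.past (S.opTime o + τ)).obj E ⊗ X ⟶ (𝓜.T τ').obj Y)
    (hs : ∀ (o : S.Op) (θ : ℕ), (E ⊗ 𝓜.arg o) ⊗
      (𝓜.fut (S.opTime o)).obj (exp (𝓜.res o) ((𝓜.T θ).obj Y)) ⟶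
        (𝓜.T (S.opTime o + θ)).obj Y)
    (h : S.opTime o + τ ≤ τ + S.opTime o) :
    𝓜.handleS (𝓜.opS o x k) n hs =
      (lift (lift (𝟙 E) x) (𝓜.boxS (S.opTime o) (cur (𝓜.handleS k
        ((((𝓜.past τ).map (fst _ (𝓜.res o)) ≫ 𝓜.mods.mu h E) ▷ X) ≫ n)
        fun o' θ => (((fst _ (𝓜.res o) ≫ 𝓜.mods.now (S.opTime o) E) ▷ 𝓜.arg o') ▷ _) ≫
          hs o' θ))) ≫ hs o (τ + τ')) ≫
        𝓜.castT (Nat.add_assoc (S.opTime o) τ τ').symm Y := by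
  rw [handleS, ext_opS _ _ _ _ _ h]
  have h1 : ∀ (H : E ⟶ 𝓜.handlers Y)
      (y : (𝓜.past (S.opTime o)).obj E ⊗ 𝓜.res o ⟶ (𝓜.T τ).obj ((𝓜.T τ').obj Y)),
      lift H (𝓜.opS o x y) =
        lift H (lift x (𝓜.boxS (S.opTime o) (cur y))) ≫ (_ ◁ 𝓜.opT o τ _) := by
    intro H y
    rw [lift_whiskerLeft, opS]
  have h2 : ∀ (H : E ⟶ 𝓜.handlers Y)
      (b : E ⟶ (𝓜.fut (S.opTime o)).obj (exp (𝓜.res o) ((𝓜.T τ).obj ((𝓜.T τ').obj Y)))),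
      lift H (lift x b) ≫ exch _ _ _ = lift x (lift H b) := by
    intro H b
    unfold exch
    ext <;> simp
  have h3 : 𝓜.clausesS hs ≫ Pi.π (fun o' : S.Op => ∏ᶜ fun θ : ℕ => 𝓜.clause o' θ Y) o ≫
      Pi.π (fun θ : ℕ => 𝓜.clause o θ Y) (τ + τ') = cur ((α_ _ _ _).inv ≫ hs o (τ + τ')) := by
    unfold clausesS
    rw [Pi.lift_π_assoc, Pi.lift_π]
  -- The remaining steps push the pairing through the right-hand side of `hdl_op`, one factor at a
  -- time.
  rw [h1, Category.assoc, 𝓜.hdl_op, ← Category.assoc, comp_lift, lift_fst, Category.comp_id]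
  rw [← Category.assoc, lift_whiskerRight, h3, ← Category.assoc, lift_whiskerLeft, h2]
  rw [← Category.assoc, lift_whiskerLeft, lift_whiskerLeft, lift_whiskerRight]
  rw [← Category.assoc, lift_whiskerLeft, lift_whiskerLeft]
  rw [← Category.assoc, lift_whiskerLeft, lift_whiskerLeft, unit_now]
  rw [← Category.assoc, lift_whiskerLeft, lift_whiskerLeft, boxS_map, lift_cur_pushExp]
  rw [← Category.assoc, lift_whiskerLeft, lift_whiskerLeft, boxS_map, cur_expMap]
  rw [← Category.assoc, lift_cur_eval, ← Category.assoc, lift_lift_associator_inv,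
    ← Category.assoc (fst _ _), comp_clausesS]
  rfl

/-! ### The equations of boxes -/

theorem unboxS_boxS {τ : ℕ} {E D X Z : C} (p : E ⟶ (𝓜.past τ).obj D)
    (x : (𝓜.past τ).obj D ⟶ X) (k : E ⊗ X ⟶ Z) :
    𝓜.unboxS p (𝓜.boxS τ x) k = lift (𝟙 E) (p ≫ x) ≫ k := by
  rw [unboxS, boxS, Modalities.map_transpose_counit]

/-- The η-law of boxes. The continuation on the left rewraps the unboxed value as a box for `τ`
units of time, which weakens the box at the time `τ` units ago to the present. -/
theorem unboxS_eta {τ : ℕ} {E D X Z : C} (p : E ⟶ (𝓜.past τ).obj D)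
    (x : D ⟶ (𝓜.fut τ).obj X) (k : E ⊗ (𝓜.fut τ).obj X ⟶ Z) :
    𝓜.unboxS p x (lift (fst E X) (𝓜.boxS τ (𝓜.mods.now τ _ ≫ snd E X)) ≫ k) =
      lift (𝟙 E) (p ≫ 𝓜.mods.now τ D ≫ x) ≫ k := by
  rw [unboxS, ← Category.assoc, comp_lift, lift_fst, comp_boxS, ← Category.assoc,
    Modalities.now_natural, Category.assoc, lift_snd, ← Modalities.now_natural, ← comp_boxS,
    ← Modalities.now_natural, ← Modalities.counit_unit_now]
  simp only [Category.assoc]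
  rfl

end Model

/-! ### Sequences of steps into the past -/

section Cancellation

variable {C : Type v} [Category.{w} C]

theorem comp_cancel {A B D : C} (f : A ⟶ B) {g : B ⟶ D} {h : D ⟶ B} (e : g ≫ h = 𝟙 B) :
    (f ≫ g) ≫ h = f := by
  rw [Category.assoc, e, Category.comp_id]

theorem comp_cancel₂ {A B D E : C} (f : A ⟶ B) (f' : B ⟶ D) {g : D ⟶ E} {h : E ⟶ D}
    (e : g ≫ h = 𝟙 D) : (f ≫ f' ≫ g) ≫ h = f ≫ f' := by
  rw [Category.assoc, Category.assoc, e, Category.comp_id]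

theorem comp_cancel₃ {A B D E F : C} (f : A ⟶ B) (f' : B ⟶ D) (f'' : D ⟶ E) {g : E ⟶ F}
    {h : F ⟶ E} (e : g ≫ h = 𝟙 E) : (f ≫ f' ≫ f'' ≫ g) ≫ h = f ≫ f' ≫ f'' := by
  rw [Category.assoc, Category.assoc, Category.assoc, e, Category.comp_id]

end Cancellation

namespace Modalities

variable {C : Type v} [Category.{w} C] (𝓜 : Modalities C)

/-- The splitting `⟨c⟩ A ⟶ ⟨a⟩ ⟨b⟩ A` for `c = a + b`, inverse to `mu`. -/
def comu {a b c : ℕ} (h : c = a + b) (A : C) :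
    (𝓜.past c).obj A ⟶ (𝓜.past a).obj ((𝓜.past b).obj A) :=
  𝓜.pastLE h.ge A ≫ (𝓜.μ a b).inv.app A

theorem comu_mu {a b c d : ℕ} (h : c = a + b) (h' : d ≤ a + b) (A : C) :
    𝓜.comu h A ≫ 𝓜.mu h' A = 𝓜.pastLE (h'.trans h.ge) A := by
  rw [comu, mu, Category.assoc]
  erw [Iso.inv_hom_id_app_assoc]
  rw [pastLE_trans]

theorem mu_comu {a b c : ℕ} (h : c = a + b) (A : C) :
    𝓜.mu h.le A ≫ 𝓜.comu h A = 𝟙 _ := by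
  rw [comu, mu, Category.assoc, ← Category.assoc (𝓜.pastLE _ _), pastLE_trans, pastLE_refl]
  erw [Category.id_comp, Iso.hom_inv_id_app]
  rfl

theorem mu_injective {a b c : ℕ} (h : c = a + b) {A B : C}
    {f g : B ⟶ (𝓜.past a).obj ((𝓜.past b).obj A)}
    (e : f ≫ 𝓜.mu h.le A = g ≫ 𝓜.mu h.le A) : f = g := by
  have := congrArg (· ≫ 𝓜.comu h A) e
  simpa only [Category.assoc, mu_comu, Category.comp_id] using this

theorem η_mu {b c : ℕ} (h : c ≤ 0 + b) (A : C) :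
    𝓜.η.hom.app ((𝓜.past b).obj A) ≫ 𝓜.mu h A = 𝓜.pastLE (h.trans (Nat.zero_add b).le) A := by
  have h0 := 𝓜.η_μ A b
  erw [𝓜.past_map_eqToHom (Nat.zero_add b).symm] at h0
  rw [mu, ← Category.assoc]
  erw [h0]
  rw [pastLE_trans]

theorem map_η_mu {a c : ℕ} (h : c ≤ a + 0) (A : C) :
    (𝓜.past a).map (𝓜.η.hom.app A) ≫ 𝓜.mu h A = 𝓜.pastLE h A := by
  rw [mu, ← Category.assoc]
  erw [𝓜.map_η_μ, Category.id_comp]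

/-- A map `B ⟶ ⟨a⟩ A` goes back `a` units of time. Two such maps in a row are composed as
`p ≫ ⟨a⟩ q ≫ mu`; the unit `η` is neutral for this composition. -/
theorem seq_zero_left {B A : C} {a : ℕ} (q : B ⟶ (𝓜.past a).obj A) (h : a ≤ 0 + a) :
    𝓜.η.hom.app B ≫ (𝓜.past 0).map q ≫ 𝓜.mu h A = q := by
  rw [← Category.assoc, η_natural, Category.assoc, η_mu, pastLE_refl, Category.comp_id]

theorem seq_zero_right {B A : C} {a : ℕ} (p : B ⟶ (𝓜.past a).obj A) (h : a ≤ a + 0) :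
    p ≫ (𝓜.past a).map (𝓜.η.hom.app A) ≫ 𝓜.mu h A = p := by
  rw [map_η_mu, pastLE_refl, Category.comp_id]

theorem seq_comu_comu {A : C} {a b c d e : ℕ} (h₁ : d = a + b) (h₂ : b = c + e)
    (k : a + c ≤ a + c) (l : d = (a + c) + e) :
    𝓜.comu h₁ A ≫ (𝓜.past a).map (𝓜.comu h₂ A) ≫ 𝓜.mu k _ = 𝓜.comu l A := by
  apply 𝓜.mu_injective l
  rw [comu_mu, Category.assoc, Category.assoc,
    ← 𝓜.mu_mu h₂.le h₁.le k l.le, ← Functor.map_comp_assoc, comu_mu, pastLE_refl, pastLE_refl,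
    CategoryTheory.Functor.map_id, Category.id_comp, comu_mu, pastLE_refl]

theorem seq_comu_map {A B : C} {a b c d e f : ℕ} (h₁ : d = a + b) (h₂ : c = b + e)
    (k : f ≤ a + c) (l : f ≤ d + e) (q : B ⟶ (𝓜.past e).obj A) :
    𝓜.comu h₁ B ≫ (𝓜.past a).map ((𝓜.past b).map q ≫ 𝓜.mu h₂.le A) ≫ 𝓜.mu k A =
      (𝓜.past d).map q ≫ 𝓜.mu l A := by
  rw [Functor.map_comp, Category.assoc, 𝓜.mu_mu h₂.le k h₁.le l,
    ← Category.assoc ((𝓜.past a).map _), mu_natural, ← Category.assoc, ← Category.assoc, comu_mu,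
    pastLE_refl, Category.id_comp]

/-- Composition of steps into the past is associative. -/
theorem seq_assoc {A B D E : C} {a b c d e f : ℕ} (h₁ : d ≤ b + c) (h₂ : e ≤ a + d)
    (k₁ : f ≤ a + b) (k₂ : e ≤ f + c) (o : E ⟶ (𝓜.past a).obj D) (p : D ⟶ (𝓜.past b).obj B)
    (q : B ⟶ (𝓜.past c).obj A) :
    o ≫ (𝓜.past a).map (p ≫ (𝓜.past b).map q ≫ 𝓜.mu h₁ A) ≫ 𝓜.mu h₂ A =
      (o ≫ (𝓜.past a).map p ≫ 𝓜.mu k₁ B) ≫ (𝓜.past f).map q ≫ 𝓜.mu k₂ A := by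
  simp only [Functor.map_comp, Category.assoc]
  rw [𝓜.mu_mu h₁ h₂ k₁ k₂, ← Category.assoc ((𝓜.past a).map ((𝓜.past b).map q)), mu_natural,
    Category.assoc]

end Modalities

/-! ### Removing time from a context -/

namespace Model

variable {S : Signature.{u}} {C : Type v} [Category.{w} C] [CartesianMonoidalCategory C]
  [MonoidalClosed C] [HasProductsOfShape ℕ C] [HasProductsOfShape S.Op C] (𝓜 : Model S C)

/-- `𝓜.Pra Γ τ Γ' p` presents `Γ' = Γ - τ`, for `τ` at most the time of `Γ`, and the map
`p : ⟦Γ⟧ ⟶ ⟨τ⟩ ⟦Γ - τ⟧` as a relation. This allows for induction on the way in which `τ` units of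
time are removed from `Γ`. The conditions `0 < τ` make the rule `zero` the only one for `τ = 0`, as
in the definition of `Γ - τ`. -/
inductive Pra : (Γ : Ctx S.Base) → (τ : ℕ) → (Γ' : Ctx S.Base) →
    (𝓜.env Γ ⟶ (𝓜.past τ).obj (𝓜.env Γ')) → Prop
  | zero {Γ : Ctx S.Base} : Pra Γ 0 Γ (𝓜.mods.η.hom.app (𝓜.env Γ))
  | var {Γ Γ' : Ctx S.Base} {X : VTy S.Base} {τ : ℕ}
      {p : 𝓜.env Γ ⟶ (𝓜.past τ).obj (𝓜.env Γ')} :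
      0 < τ → Pra Γ τ Γ' p → Pra (.var Γ X) τ (.gap Γ') (fst (𝓜.env Γ) (𝓜.ty X) ≫ p)
  | gap {Γ Γ' : Ctx S.Base} {τ : ℕ} {p : 𝓜.env Γ ⟶ (𝓜.past τ).obj (𝓜.env Γ')} :
      0 < τ → Pra Γ τ Γ' p → Pra (.gap Γ) τ (.gap Γ') p
  | le {Γ : Ctx S.Base} {τ τ' s : ℕ} (hτ : 0 < τ) (h : τ' = τ + s) :
      Pra (.mod Γ τ') τ (.mod Γ s) (𝓜.mods.comu h (𝓜.env Γ))
  | gt {Γ Γ' : Ctx S.Base} {τ' s θ : ℕ} {p : 𝓜.env Γ ⟶ (𝓜.past s).obj (𝓜.env Γ')} (hs : 0 < s) :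
      Pra Γ s Γ' p → (h : θ = τ' + s) →
      Pra (.mod Γ τ') θ Γ' ((𝓜.past τ').map p ≫ 𝓜.mods.mu h.le (𝓜.env Γ'))

variable {𝓜}

theorem Pra.congr {Γ Γ' : Ctx S.Base} {τ : ℕ} {p q : 𝓜.env Γ ⟶ (𝓜.past τ).obj (𝓜.env Γ')}
    (h : 𝓜.Pra Γ τ Γ' p) (e : p = q) : 𝓜.Pra Γ τ Γ' q := e ▸ h

/-- Removing `τ₁` and then `τ₂` units of time removes `τ₁ + τ₂` units. -/
theorem Pra.comp {Γ Γ₁ Γ₂ : Ctx S.Base} {τ₁ τ₂ θ : ℕ}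
    {p : 𝓜.env Γ ⟶ (𝓜.past τ₁).obj (𝓜.env Γ₁)} {q : 𝓜.env Γ₁ ⟶ (𝓜.past τ₂).obj (𝓜.env Γ₂)}
    (hp : 𝓜.Pra Γ τ₁ Γ₁ p) (hq : 𝓜.Pra Γ₁ τ₂ Γ₂ q) (h : θ = τ₁ + τ₂) :
    𝓜.Pra Γ θ Γ₂ (p ≫ (𝓜.past τ₁).map q ≫ 𝓜.mods.mu h.le (𝓜.env Γ₂)) := by
  induction hp generalizing τ₂ θ Γ₂ with
  | zero =>
    obtain rfl : θ = τ₂ := by omega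
    exact hq.congr (𝓜.mods.seq_zero_left q _).symm
  | @var Γ Γ' X τ p hτ hp ih =>
    cases hq with
    | zero =>
      obtain rfl : θ = τ := h
      exact (Pra.var hτ hp).congr (𝓜.mods.seq_zero_right _ _).symm
    | gap _ hq => exact (Pra.var (by omega) (ih hq h)).congr (Category.assoc _ _ _).symm
  | @gap Γ Γ' τ p hτ hp ih =>
    cases hq with
    | zero =>
      obtain rfl : θ = τ := h
      exact (Pra.gap hτ hp).congr (𝓜.mods.seq_zero_right _ _).symm
    | gap _ hq => exact Pra.gap (by omega) (ih hq h)
  | @le Γ τ τ' s hτ h₁ =>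
    cases hq with
    | zero =>
      obtain rfl : θ = τ := h
      exact (Pra.le hτ h₁).congr (𝓜.mods.seq_zero_right _ _).symm
    | le _ h₂ =>
      subst h
      exact (Pra.le (by omega) (by omega)).congr
        (𝓜.mods.seq_comu_comu h₁ h₂ (le_refl _) (by omega)).symm
    | gt hs hq h₂ =>
      exact (Pra.gt hs hq (by omega)).congr (𝓜.mods.seq_comu_map h₁ h₂ _ _ _).symm
  | @gt Γ Γ' τ' s θ' p hs hp h₁ ih =>
    have e := 𝓜.mods.seq_assoc (le_refl (s + τ₂)) (by omega : θ ≤ τ' + (s + τ₂)) h₁.le h.le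
      (𝟙 ((𝓜.past τ').obj (𝓜.env Γ))) p q
    rw [Category.id_comp, Category.id_comp] at e
    exact (Pra.gt (by omega) (ih hq rfl) (by omega)).congr e

/-- Removing `τ₁ + τ₂` units of time can be done in two steps. -/
theorem Pra.split {Γ Γ₂ : Ctx S.Base} {τ₁ τ₂ θ : ℕ} {r : 𝓜.env Γ ⟶ (𝓜.past θ).obj (𝓜.env Γ₂)}
    (hr : 𝓜.Pra Γ θ Γ₂ r) (h : θ = τ₁ + τ₂) :
    ∃ (Γ₁ : Ctx S.Base) (p : 𝓜.env Γ ⟶ (𝓜.past τ₁).obj (𝓜.env Γ₁))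
      (q : 𝓜.env Γ₁ ⟶ (𝓜.past τ₂).obj (𝓜.env Γ₂)),
      𝓜.Pra Γ τ₁ Γ₁ p ∧ 𝓜.Pra Γ₁ τ₂ Γ₂ q ∧
        p ≫ (𝓜.past τ₁).map q ≫ 𝓜.mods.mu h.le (𝓜.env Γ₂) = r := by
  rcases Nat.eq_zero_or_pos τ₁ with rfl | h₁
  · obtain rfl : θ = τ₂ := by omega
    exact ⟨_, _, _, .zero, hr, 𝓜.mods.seq_zero_left _ _⟩
  rcases Nat.eq_zero_or_pos τ₂ with rfl | h₂
  · obtain rfl : θ = τ₁ := h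
    exact ⟨_, _, _, hr, .zero, 𝓜.mods.seq_zero_right _ _⟩
  induction hr generalizing τ₁ with
  | zero => omega
  | var hτ hr ih =>
    obtain ⟨Γ₁, p, q, hp, hq, e⟩ := ih h h₁
    refine ⟨_, _, _, .var h₁ hp, .gap h₂ hq, ?_⟩
    rw [← e]
    exact Category.assoc _ _ _
  | gap hτ hr ih =>
    obtain ⟨Γ₁, p, q, hp, hq, e⟩ := ih h h₁
    exact ⟨_, _, _, .gap h₁ hp, .gap h₂ hq, e⟩
  | @le Γ τ τ' s hτ h' =>
    subst h
    exact ⟨_, _, _, .le h₁ (by omega : τ' = τ₁ + (τ₂ + s)), .le h₂ rfl,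
      𝓜.mods.seq_comu_comu _ _ _ _⟩
  | @gt Γ Γ' τ' s θ p hs hp h' ih =>
    rcases Nat.lt_or_ge τ' τ₁ with hlt | hge
    · obtain ⟨s₁, rfl⟩ := Nat.exists_eq_add_of_lt hlt
      obtain ⟨Γ₁, a, b, ha, hb, e⟩ := ih (τ₁ := s₁ + 1) (by omega) (by omega)
      refine ⟨_, _, _, .gt (by omega) ha (by omega), hb, ?_⟩
      rw [← e]
      have e' := 𝓜.mods.seq_assoc (by omega : s ≤ s₁ + 1 + τ₂) h'.le
        (by omega : τ' + s₁ + 1 ≤ τ' + (s₁ + 1)) h.le (𝟙 ((𝓜.past τ').obj (𝓜.env Γ))) a b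
      rw [Category.id_comp, Category.id_comp] at e'
      exact e'.symm
    · obtain ⟨s₁, rfl⟩ := Nat.exists_eq_add_of_le hge
      have h'' : τ₂ = s₁ + s := by omega
      exact ⟨_, _, _, .le h₁ rfl, .gt hs hp h'', 𝓜.mods.seq_comu_map _ h'' _ _ _⟩

variable (𝓜)

/-- As much time as a context captures can be removed from it. -/
theorem exists_pra {Γ : Ctx S.Base} {τ : ℕ} (h : τ ≤ Γ.time) : ∃ Γ' p, 𝓜.Pra Γ τ Γ' p := by
  induction Γ generalizing τ with
  | nil =>
    obtain rfl : τ = 0 := by simpa [Ctx.time] using h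
    exact ⟨_, _, .zero⟩
  | var Γ X ih =>
    rcases Nat.eq_zero_or_pos τ with rfl | hτ
    · exact ⟨_, _, .zero⟩
    obtain ⟨Γ', p, hp⟩ := ih h
    exact ⟨_, _, .var hτ hp⟩
  | mod Γ τ' ih =>
    rcases Nat.eq_zero_or_pos τ with rfl | hτ
    · exact ⟨_, _, .zero⟩
    rcases Nat.lt_or_ge τ' τ with hlt | hge
    · obtain ⟨s, rfl⟩ := Nat.exists_eq_add_of_lt hlt
      rw [Ctx.time] at h
      obtain ⟨Γ', p, hp⟩ := ih (τ := s + 1) (by omega)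
      exact ⟨_, _, .gt (by omega) hp (by omega)⟩
    · obtain ⟨s, rfl⟩ := Nat.exists_eq_add_of_le hge
      exact ⟨_, _, .le hτ rfl⟩
  | gap Γ ih =>
    rcases Nat.eq_zero_or_pos τ with rfl | hτ
    · exact ⟨_, _, .zero⟩
    obtain ⟨Γ', p, hp⟩ := ih h
    exact ⟨_, _, .gap hτ hp⟩

variable {𝓜}

theorem ctxCast_refl {Γ : Ctx S.Base} (h : Γ = Γ) (A : C) : 𝓜.ctxCast h A = 𝟙 _ := rfl

theorem map_ctxCast_cancel {Γ Γ' : Ctx S.Base} (τ : ℕ) (h : Γ = Γ') (h' : Γ' = Γ) (A : C) :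
    (𝓜.past τ).map (𝓜.ctxCast h A) ≫ (𝓜.past τ).map (𝓜.ctxCast h' A) = 𝟙 _ := by
  subst h
  rw [ctxCast_refl, CategoryTheory.Functor.map_id, Category.id_comp]

/-- The relation `Pra` describes the time travelling operation and its interpretation. The context
is only equal to `Γ - τ` up to unfolding, hence the cast. -/
theorem Pra.eq_pra {Γ Γ' : Ctx S.Base} {τ : ℕ} {p : 𝓜.env Γ ⟶ (𝓜.past τ).obj (𝓜.env Γ')}
    (hp : 𝓜.Pra Γ τ Γ' p) :
    ∃ (h : τ ≤ Γ.time) (e : Γ.minus τ = Γ'),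
      𝓜.pra Γ τ h (𝟙_ C) ≫ (𝓜.past τ).map (𝓜.ctxCast e (𝟙_ C)) = p := by
  induction hp with
  | @zero Γ =>
    refine ⟨Nat.zero_le _, by cases Γ <;> rfl, ?_⟩
    cases Γ <;> exact comp_cancel _ (map_ctxCast_cancel 0 _ _ _)
  | @var Γ Γ' X τ p hτ hp ih =>
    obtain ⟨h, rfl, e⟩ := ih
    obtain ⟨t, rfl⟩ := Nat.exists_eq_succ_of_ne_zero hτ.ne'
    refine ⟨h, rfl, ?_⟩
    rw [← e]
    exact Category.assoc _ _ _
  | @gap Γ Γ' τ p hτ hp ih =>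
    obtain ⟨h, rfl, e⟩ := ih
    obtain ⟨t, rfl⟩ := Nat.exists_eq_succ_of_ne_zero hτ.ne'
    exact ⟨h, rfl, e⟩
  | @le Γ τ τ' s hτ h =>
    obtain ⟨t, rfl⟩ := Nat.exists_eq_succ_of_ne_zero hτ.ne'
    obtain rfl : s = τ' - (t + 1) := by omega
    have h' : t + 1 ≤ τ' := by omega
    refine ⟨by rw [Ctx.time]; omega, by rw [Ctx.minus, if_pos h'], ?_⟩
    rw [TypeModel.pra, dif_pos h']
    exact comp_cancel₂ _ _ (map_ctxCast_cancel _ _ _ _)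
  | @gt Γ Γ' τ' s θ p hs hp h ih =>
    obtain ⟨hl, rfl, e⟩ := ih
    obtain ⟨t, rfl⟩ : ∃ t, θ = t + 1 := ⟨θ - 1, by omega⟩
    obtain rfl : s = t + 1 - τ' := by omega
    have h' : ¬ t + 1 ≤ τ' := by omega
    refine ⟨by rw [Ctx.time]; omega, by rw [Ctx.minus, if_neg h'], ?_⟩
    rw [TypeModel.pra, dif_neg h']
    rw [ctxCast_refl, CategoryTheory.Functor.map_id, Category.comp_id] at e
    subst e
    exact comp_cancel₃ _ _ _ (map_ctxCast_cancel _ _ _ _)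

theorem pra_minus {Γ : Ctx S.Base} {τ : ℕ} (h : τ ≤ Γ.time) :
    𝓜.Pra Γ τ (Γ.minus τ) (𝓜.pra Γ τ h (𝟙_ C)) := by
  obtain ⟨Γ', p, hp⟩ := 𝓜.exists_pra h
  obtain ⟨h', rfl, e⟩ := hp.eq_pra
  rw [ctxCast_refl, CategoryTheory.Functor.map_id, Category.comp_id] at e
  rwa [e]

end Model

/-! ### Renamings are substitutions -/

theorem liftRen_id : liftRen id = id := by
  funext i
  cases i <;> rfl

theorem liftSub_var {S : Signature.{u}} (ρ : ℕ → ℕ) :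
    liftSub (fun i => Val.var (S := S) (ρ i)) = fun i => Val.var (liftRen ρ i) := by
  funext i
  cases i <;> rfl

mutual

theorem Val.rename_eq_subst {S : Signature.{u}} (ρ : ℕ → ℕ) : ∀ V : Val S,
    V.rename ρ = V.subst fun i => .var (ρ i)
  | .var i => rfl
  | .const f Vs => by
    simp only [Val.rename, Val.subst]
    congr 1
    funext i
    exact Val.rename_eq_subst ρ (Vs i)
  | .unit => rfl
  | .pair V W => by
    simp only [Val.rename, Val.subst]
    rw [Val.rename_eq_subst ρ V, Val.rename_eq_subst ρ W]
  | .lam X M => by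
    simp only [Val.rename, Val.subst]
    rw [Comp.rename_eq_subst _ M, liftSub_var]
  | .box τ V => by
    simp only [Val.rename, Val.subst]
    rw [Val.rename_eq_subst ρ V]

theorem Comp.rename_eq_subst {S : Signature.{u}} (ρ : ℕ → ℕ) : ∀ M : Comp S,
    M.rename ρ = M.subst fun i => .var (ρ i)
  | .ret V => by
    simp only [Comp.rename, Comp.subst]
    rw [Val.rename_eq_subst ρ V]
  | .letin M N => by
    simp only [Comp.rename, Comp.subst]
    rw [Comp.rename_eq_subst ρ M, Comp.rename_eq_subst _ N, liftSub_var]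
  | .app V W => by
    simp only [Comp.rename, Comp.subst]
    rw [Val.rename_eq_subst ρ V, Val.rename_eq_subst ρ W]
  | .split V N => by
    simp only [Comp.rename, Comp.subst]
    rw [Val.rename_eq_subst ρ V, Comp.rename_eq_subst _ N, liftSub_var, liftSub_var]
  | .op o V M => by
    simp only [Comp.rename, Comp.subst]
    rw [Val.rename_eq_subst ρ V, Comp.rename_eq_subst _ M, liftSub_var]
  | .delay τ M => by
    simp only [Comp.rename, Comp.subst]
    rw [Comp.rename_eq_subst ρ M]
  | .handle M H N => by
    simp only [Comp.rename, Comp.subst]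
    rw [Comp.rename_eq_subst ρ M, Comp.rename_eq_subst _ N, liftSub_var, liftSub_var]
    congr 1
    funext o
    exact Comp.rename_eq_subst _ (H o)
  | .unbox τ V N => by
    simp only [Comp.rename, Comp.subst]
    rw [Val.rename_eq_subst ρ V, Comp.rename_eq_subst _ N, liftSub_var]

end

mutual

theorem Val.rename_id {S : Signature.{u}} : ∀ V : Val S, V.rename id = V
  | .var i => rfl
  | .const f Vs => by
    simp only [Val.rename]
    congr 1
    funext i
    exact Val.rename_id (Vs i)
  | .unit => rfl
  | .pair V W => by
    simp only [Val.rename]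
    rw [Val.rename_id V, Val.rename_id W]
  | .lam X M => by
    simp only [Val.rename]
    rw [liftRen_id, Comp.rename_id M]
  | .box τ V => by
    simp only [Val.rename]
    rw [Val.rename_id V]

theorem Comp.rename_id {S : Signature.{u}} : ∀ M : Comp S, M.rename id = M
  | .ret V => by
    simp only [Comp.rename]
    rw [Val.rename_id V]
  | .letin M N => by
    simp only [Comp.rename]
    rw [liftRen_id, Comp.rename_id M, Comp.rename_id N]
  | .app V W => by
    simp only [Comp.rename]
    rw [Val.rename_id V, Val.rename_id W]
  | .split V N => by
    simp only [Comp.rename]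
    rw [liftRen_id, liftRen_id, Val.rename_id V, Comp.rename_id N]
  | .op o V M => by
    simp only [Comp.rename]
    rw [liftRen_id, Val.rename_id V, Comp.rename_id M]
  | .delay τ M => by
    simp only [Comp.rename]
    rw [Comp.rename_id M]
  | .handle M H N => by
    simp only [Comp.rename]
    rw [liftRen_id, liftRen_id, Comp.rename_id M, Comp.rename_id N]
    congr 1
    funext o
    exact Comp.rename_id (H o)
  | .unbox τ V N => by
    simp only [Comp.rename]
    rw [liftRen_id, Val.rename_id V, Comp.rename_id N]

end

/-! ### Uniqueness of typing -/

theorem Lookup.unique {B : Type u} {Γ : Ctx B} {i : ℕ} {X : VTy B} (v : Lookup Γ i X) :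
    ∀ {Y : VTy B} (w : Lookup Γ i Y), X = Y ∧ HEq v w := by
  induction v with
  | here => intro Y w; cases w; exact ⟨rfl, HEq.rfl⟩
  | var v ih =>
    intro Y w
    cases w with
    | var w => obtain ⟨rfl, h⟩ := ih w; cases h; exact ⟨rfl, HEq.rfl⟩
  | mod v ih =>
    intro Y w
    cases w with
    | mod w => obtain ⟨rfl, h⟩ := ih w; cases h; exact ⟨rfl, HEq.rfl⟩
  | gap v ih =>
    intro Y w
    cases w with
    | gap w => obtain ⟨rfl, h⟩ := ih w; cases h; exact ⟨rfl, HEq.rfl⟩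

mutual

/-- A value has at most one type in a given context, and at most one typing derivation. -/
theorem HasV.unique {S : Signature.{u}} : ∀ {Γ : Ctx S.Base} {V : Val S} {X Y : VTy S.Base}
    (d : HasV S Γ V X) (e : HasV S Γ V Y), X = Y ∧ HEq d e
  | _, _, _, _, .var v, e => by
    cases e with
    | var w => obtain ⟨rfl, h⟩ := v.unique w; cases h; exact ⟨rfl, HEq.rfl⟩
  | _, _, _, _, .const f ds, e => by
    cases e with
    | const _ es =>
      have : ds = es := funext fun i => eq_of_heq (HasV.unique (ds i) (es i)).2
      subst this
      exact ⟨rfl, HEq.rfl⟩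
  | _, _, _, _, .unit, e => by cases e; exact ⟨rfl, HEq.rfl⟩
  | _, _, _, _, .pair d₁ d₂, e => by
    cases e with
    | pair e₁ e₂ =>
      obtain ⟨rfl, h₁⟩ := HasV.unique d₁ e₁
      obtain ⟨rfl, h₂⟩ := HasV.unique d₂ e₂
      cases h₁; cases h₂
      exact ⟨rfl, HEq.rfl⟩
  | _, _, _, _, .lam d, e => by
    cases e with
    | lam e =>
      obtain ⟨rfl, rfl, h⟩ := HasC.unique d e
      cases h
      exact ⟨rfl, HEq.rfl⟩
  | _, _, _, _, .box d, e => by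
    cases e with
    | box e =>
      obtain ⟨rfl, h⟩ := HasV.unique d e
      cases h
      exact ⟨rfl, HEq.rfl⟩

/-- A computation has at most one type and grade in a given context, and at most one typing
derivation. -/
theorem HasC.unique {S : Signature.{u}} : ∀ {Γ : Ctx S.Base} {M : Comp S} {X Y : VTy S.Base}
    {τ θ : ℕ} (d : HasC S Γ M X τ) (e : HasC S Γ M Y θ), X = Y ∧ τ = θ ∧ HEq d e
  | _, _, _, _, _, _, .ret d, e => by
    cases e with
    | ret e =>
      obtain ⟨rfl, h⟩ := HasV.unique d e
      cases h
      exact ⟨rfl, rfl, HEq.rfl⟩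
  | _, _, _, _, _, _, .letin d₁ d₂, e => by
    cases e with
    | letin e₁ e₂ =>
      obtain ⟨rfl, rfl, h₁⟩ := HasC.unique d₁ e₁
      obtain ⟨rfl, rfl, h₂⟩ := HasC.unique d₂ e₂
      cases h₁; cases h₂
      exact ⟨rfl, rfl, HEq.rfl⟩
  | _, _, _, _, _, _, .app d₁ d₂, e => by
    cases e with
    | app e₁ e₂ =>
      obtain ⟨h, h₁⟩ := HasV.unique d₁ e₁
      cases h
      obtain ⟨-, h₂⟩ := HasV.unique d₂ e₂
      cases h₁; cases h₂
      exact ⟨rfl, rfl, HEq.rfl⟩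
  | _, _, _, _, _, _, .split d₁ d₂, e => by
    cases e with
    | split e₁ e₂ =>
      obtain ⟨h, h₁⟩ := HasV.unique d₁ e₁
      cases h
      obtain ⟨rfl, rfl, h₂⟩ := HasC.unique d₂ e₂
      cases h₁; cases h₂
      exact ⟨rfl, rfl, HEq.rfl⟩
  | _, _, _, _, _, _, .op o d₁ d₂, e => by
    cases e with
    | op _ e₁ e₂ =>
      obtain ⟨-, h₁⟩ := HasV.unique d₁ e₁
      obtain ⟨rfl, rfl, h₂⟩ := HasC.unique d₂ e₂
      cases h₁; cases h₂
      exact ⟨rfl, rfl, HEq.rfl⟩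
  | _, _, _, _, _, _, .delay d, e => by
    cases e with
    | delay e =>
      obtain ⟨rfl, rfl, h⟩ := HasC.unique d e
      cases h
      exact ⟨rfl, rfl, HEq.rfl⟩
  | _, _, _, _, _, _, .handle d₁ d₂ ds, e => by
    cases e with
    | handle e₁ e₂ es =>
      obtain ⟨rfl, rfl, h₁⟩ := HasC.unique d₁ e₁
      obtain ⟨rfl, rfl, h₂⟩ := HasC.unique d₂ e₂
      have : ds = es := funext fun o => funext fun θ =>
        eq_of_heq (HasC.unique (ds o θ) (es o θ)).2.2
      cases h₁; cases h₂; cases this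
      exact ⟨rfl, rfl, HEq.rfl⟩
  | _, _, _, _, _, _, .unbox _ d₁ d₂, e => by
    cases e with
    | unbox _ e₁ e₂ =>
      obtain ⟨h, h₁⟩ := HasV.unique d₁ e₁
      cases h
      obtain ⟨rfl, rfl, h₂⟩ := HasC.unique d₂ e₂
      cases h₁; cases h₂
      exact ⟨rfl, rfl, HEq.rfl⟩

end

/-! ### The interpretation of variables, matching and application -/

section VariableEquations

variable {C : Type v} [Category.{w} C]

theorem whiskerRight_fst_comp [CartesianMonoidalCategory C] {A A' B D E : C} (f : A ⟶ A')
    (c : A' ⟶ D) (n : D ⟶ E) :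
    (f ▷ B) ≫ (fst A' B ≫ c) ≫ n = fst A B ≫ f ≫ c ≫ n := by
  simp

/-- Collapsing a further modality before forgetting all of them amounts to forgetting that modality
first. -/
theorem Modalities.map_collapse_now (𝓜 : Modalities C) {a b c : ℕ} (h : a + b = c)
    {A A' B D : C}
    (f : A ⟶ A') (p : A' ⟶ (𝓜.past b).obj B) (g : B ⟶ D) :
    (𝓜.past a).map f ≫ ((𝓜.past a).map p ≫ (𝓜.μ a b).hom.app B ≫ 𝓜.pastLE h.ge B) ≫
      𝓜.now c B ≫ g = 𝓜.now a A ≫ f ≫ p ≫ 𝓜.now b B ≫ g := by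
  have e : (𝓜.μ a b).hom.app B ≫ 𝓜.pastLE h.ge B = 𝓜.mu h.ge B := rfl
  rw [e]
  simp only [Category.assoc]
  rw [← Category.assoc (𝓜.mu _ _), mu_now, Category.assoc, ← Category.assoc ((𝓜.past a).map p),
    now_natural, ← Category.assoc ((𝓜.past a).map f), ← Category.assoc ((𝓜.past a).map f),
    now_natural]
  simp only [Category.assoc]

end VariableEquations

section Combinators

variable {C : Type v} [Category.{w} C] {E E' X Y : C}

/-- The interpretation of matching on a pair. -/
def splitS [CartesianMonoidalCategory C] {Z : C} (g : E ⟶ X ⊗ Y) (k : (E ⊗ X) ⊗ Y ⟶ Z) : E ⟶ Z :=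
  lift (𝟙 E) g ≫ (α_ E X Y).inv ≫ k

theorem comp_splitS [CartesianMonoidalCategory C] {Z : C} (f : E' ⟶ E) (g : E ⟶ X ⊗ Y)
    (k : (E ⊗ X) ⊗ Y ⟶ Z) :
    f ≫ splitS g k = splitS (f ≫ g) (((f ▷ X) ▷ Y) ≫ k) := by
  unfold splitS
  simp only [← Category.assoc]
  congr 1
  ext <;> simp

/-- The interpretation of application. -/
def appS [CartesianMonoidalCategory C] [MonoidalClosed C] (g : E ⟶ exp X Y) (x : E ⟶ X) : E ⟶ Y :=
  lift g x ≫ unc (𝟙 _)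

theorem comp_appS [CartesianMonoidalCategory C] [MonoidalClosed C]
    (f : E' ⟶ E) (g : E ⟶ exp X Y) (x : E ⟶ X) :
    f ≫ appS g x = appS (f ≫ g) (f ≫ x) := by
  rw [appS, appS, ← Category.assoc, comp_lift]

theorem comp_piLift {n : ℕ} {X : Fin n → C} {Y : C} (f : E' ⟶ E) (gs : ∀ i, E ⟶ X i)
    [HasProduct X] (c : ∏ᶜ X ⟶ Y) :
    f ≫ Pi.lift gs ≫ c = Pi.lift (fun i => f ≫ gs i) ≫ c := by
  rw [← Category.assoc]
  congr 1
  apply Pi.hom_ext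
  intro i
  simp

end Combinators

namespace Model

variable {S : Signature.{u}} {C : Type v} [Category.{w} C] [CartesianMonoidalCategory C]
  [MonoidalClosed C] [HasProductsOfShape ℕ C] [HasProductsOfShape S.Op C] (𝓜 : Model S C)

/-- The interpretation of a variable, by recursion on its position: each modality passed on the way
to the variable is discarded by `now`. -/
def lookup : {Γ : Ctx S.Base} → {i : ℕ} → {X : VTy S.Base} → Lookup Γ i X →
    (𝓜.env Γ ⟶ 𝓜.ty X)
  | .var Γ X, _, _, .here => snd (𝓜.env Γ) (𝓜.ty X)
  | .var Γ Y, _, _, .var v => fst (𝓜.env Γ) (𝓜.ty Y) ≫ lookup v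
  | .mod Γ τ, _, _, .mod v => 𝓜.mods.now τ (𝓜.env Γ) ≫ lookup v
  | .gap Γ, _, _, .gap v => lookup (Γ := Γ) v

theorem semV_var {Γ : Ctx S.Base} {i : ℕ} {X : VTy S.Base} (v : Lookup Γ i X) :
    𝓜.semV (.var v) = 𝓜.lookup v := by
  rw [semV]
  induction v with
  | here =>
    exact (Category.id_comp _).trans ((Category.assoc _ _ _).symm.trans
      ((congrArg (· ≫ snd _ _) (𝓜.mods.η_now _)).trans (Category.id_comp _)))
  | var v ih => exact (whiskerRight_fst_comp _ _ _).trans (congrArg (fst _ _ ≫ ·) ih)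
  | @mod Γ i X τ v ih =>
    exact (𝓜.mods.map_collapse_now (Nat.add_comm τ v.after.time) _ _ _).trans
      (congrArg (𝓜.mods.now τ (𝓜.env Γ) ≫ ·) ih)
  | gap v ih => exact ih

/-! ### Interpretations of computations in terms of the combinators -/

section

variable {E E' X Y : C} {τ τ' : ℕ}

theorem letS_def (t : E ⟶ (𝓜.T τ).obj X) (k : (𝓜.past τ).obj E ⊗ X ⟶ (𝓜.T τ').obj Y) :
    𝓜.letS t k = lift (𝓜.mods.unit τ E) t ≫ 𝓜.monad.str τ _ X ≫ (𝓜.T τ).map k ≫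
      (𝓜.monad.mult τ τ').app Y := by
  simp only [letS, StrongGradedMonad.ext, Category.assoc]

theorem opS_def (o : S.Op) (x : E ⟶ 𝓜.arg o)
    (k : (𝓜.past (S.opTime o)).obj E ⊗ 𝓜.res o ⟶ (𝓜.T τ).obj X) :
    𝓜.opS o x k = lift x (𝓜.mods.unit (S.opTime o) E) ≫
      (𝓜.arg o ◁ (𝓜.fut (S.opTime o)).map (cur k)) ≫ 𝓜.opT o τ X := by
  rw [opS, boxS, ← lift_whiskerLeft, Category.assoc]

theorem delayS_def (k : (𝓜.past τ).obj E ⟶ (𝓜.T τ').obj X) :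
    𝓜.delayS τ k = 𝓜.mods.unit τ E ≫ (𝓜.fut τ).map k ≫ (𝓜.delayT τ τ').app X := by
  rw [delayS, boxS, Category.assoc]

theorem handleS_def (t : E ⟶ (𝓜.T τ).obj X) (k : (𝓜.past τ).obj E ⊗ X ⟶ (𝓜.T τ').obj Y)
    (hs : ∀ (o : S.Op) (θ : ℕ), (E ⊗ 𝓜.arg o) ⊗
      (𝓜.fut (S.opTime o)).obj (exp (𝓜.res o) ((𝓜.T θ).obj Y)) ⟶
        (𝓜.T (S.opTime o + θ)).obj Y) :
    𝓜.handleS t k hs = lift (𝟙 E) (lift (𝓜.mods.unit τ E) t) ≫ (E ◁ 𝓜.monad.str τ _ X) ≫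
      (E ◁ (𝓜.T τ).map k) ≫
      (Pi.lift (fun o => Pi.lift fun θ => cur ((α_ E (𝓜.arg o) _).inv ≫ hs o θ)) ▷ _) ≫
        unc (𝓜.hdl Y τ τ') := by
  rw [handleS, clausesS, StrongGradedMonad.ext]
  have a : ∀ {A B D E G H : C} (r : A ⟶ B) (s : B ⟶ D) (t : D ⟶ E) (h : A ⟶ G)
      (q : G ⊗ E ⟶ H),
      lift h (r ≫ s ≫ t) ≫ q = lift (𝟙 A) r ≫ (A ◁ s) ≫ (A ◁ t) ≫ (h ▷ E) ≫ q := by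
    intros
    simp
  exact a _ _ _ _ _

theorem unboxS_def (p : E ⟶ (𝓜.past τ).obj E') (x : E' ⟶ (𝓜.fut τ).obj X) (k : E ⊗ X ⟶ Y) :
    𝓜.unboxS p x k = lift (𝟙 E) p ≫ (E ◁ (𝓜.past τ).map x) ≫ (E ◁ 𝓜.mods.counit τ X) ≫ k := by
  rw [unboxS, ← Category.assoc (lift _ _), lift_whiskerLeft, ← Category.assoc (lift _ _),
    lift_whiskerLeft, Category.assoc]

end

section

variable {Γ : Ctx S.Base} {X Y Z : VTy S.Base} {τ τ' : ℕ} {V W : Val S} {M N : Comp S}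

theorem semC_letin (d : HasC S Γ M X τ) (e : HasC S (.var (.mod Γ τ) X) N Y τ') :
    𝓜.semC (.letin d e) = 𝓜.letS (𝓜.semC d) (𝓜.semC e) :=
  (𝓜.letS_def _ _).symm

theorem semC_op (o : S.Op) (d : HasV S Γ V (S.argTy o))
    (e : HasC S (.var (.mod Γ (S.opTime o)) (S.resTy o)) M X τ) :
    𝓜.semC (.op o d e) = 𝓜.opS o (𝓜.semV d) (𝓜.semC e) :=
  (𝓜.opS_def _ _ _).symm

theorem semC_delay (e : HasC S (.mod Γ τ) M X τ') :
    𝓜.semC (.delay e) = 𝓜.delayS τ (𝓜.semC e) :=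
  (𝓜.delayS_def _).symm

theorem semC_handle {H : S.Op → Comp S} (d : HasC S Γ M X τ)
    (e : HasC S (.var (.mod Γ τ) X) N Y τ')
    (ds : ∀ (o : S.Op) (θ : ℕ),
      HasC S (.var (.var Γ (S.argTy o)) (.box (S.opTime o) (.fn (S.resTy o) Y θ)))
        (H o) Y (S.opTime o + θ)) :
    𝓜.semC (.handle d e ds) = 𝓜.handleS (𝓜.semC d) (𝓜.semC e) fun o θ => 𝓜.semC (ds o θ) :=
  (𝓜.handleS_def _ _ _).symm

theorem semC_unbox (h : τ ≤ Γ.time) (d : HasV S (Γ.minus τ) V (.box τ X))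
    (e : HasC S (.var Γ X) N Y τ') :
    𝓜.semC (.unbox h d e) = 𝓜.unboxS (𝓜.pra Γ τ h (𝟙_ C)) (𝓜.semV d) (𝓜.semC e) :=
  (𝓜.unboxS_def _ _ _).symm

end

/-! ### Typing and interpretation combined -/

/-- The value `V` has type `X` in the context `Γ`, and its interpretation is `g`. -/
def SemV (Γ : Ctx S.Base) (V : Val S) (X : VTy S.Base) (g : 𝓜.env Γ ⟶ 𝓜.ty X) : Prop :=
  ∃ d : HasV S Γ V X, 𝓜.semV d = g

/-- The computation `M` has type `X ! τ` in the context `Γ`, and its interpretation is `g`. -/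
def SemC (Γ : Ctx S.Base) (M : Comp S) (X : VTy S.Base) (τ : ℕ)
    (g : 𝓜.env Γ ⟶ (𝓜.T τ).obj (𝓜.ty X)) : Prop :=
  ∃ d : HasC S Γ M X τ, 𝓜.semC d = g

variable {𝓜} {Γ : Ctx S.Base} {X Y Z : VTy S.Base} {τ τ' : ℕ} {V W : Val S} {M N : Comp S}

/-- The interpretation of a value is determined by the value, its context and its type, because
there is at most one typing derivation. -/
theorem SemV.unique {g g' : 𝓜.env Γ ⟶ 𝓜.ty X} (h : 𝓜.SemV Γ V X g) (h' : 𝓜.SemV Γ V X g') :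
    g = g' := by
  obtain ⟨d, rfl⟩ := h
  obtain ⟨d', rfl⟩ := h'
  rw [eq_of_heq (d.unique d').2]

theorem SemC.unique {g g' : 𝓜.env Γ ⟶ (𝓜.T τ).obj (𝓜.ty X)} (h : 𝓜.SemC Γ M X τ g)
    (h' : 𝓜.SemC Γ M X τ g') : g = g' := by
  obtain ⟨d, rfl⟩ := h
  obtain ⟨d', rfl⟩ := h'
  rw [eq_of_heq (d.unique d').2.2]

theorem SemV.congr {g g' : 𝓜.env Γ ⟶ 𝓜.ty X} (h : 𝓜.SemV Γ V X g) (e : g = g') :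
    𝓜.SemV Γ V X g' := e ▸ h

theorem SemC.congr {g g' : 𝓜.env Γ ⟶ (𝓜.T τ).obj (𝓜.ty X)} (h : 𝓜.SemC Γ M X τ g)
    (e : g = g') : 𝓜.SemC Γ M X τ g' := e ▸ h

/-- Grades can be changed along an equation. -/
theorem SemC.cast {g : 𝓜.env Γ ⟶ (𝓜.T τ).obj (𝓜.ty X)} (h : 𝓜.SemC Γ M X τ g) (e : τ = τ') :
    𝓜.SemC Γ M X τ' (g ≫ 𝓜.castT e _) := by
  subst e
  exact h.congr (Category.comp_id g).symm

theorem SemV.var {i : ℕ} (v : Lookup Γ i X) : 𝓜.SemV Γ (.var i) X (𝓜.lookup v) :=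
  ⟨.var v, 𝓜.semV_var v⟩

theorem SemV.const (f : S.Const) {Vs : Fin (S.arity f) → Val S}
    {gs : ∀ i, 𝓜.env Γ ⟶ 𝓜.ty (S.constDom f i).toVTy}
    (h : ∀ i, 𝓜.SemV Γ (Vs i) (S.constDom f i).toVTy (gs i)) :
    𝓜.SemV Γ (.const f Vs) (S.constCod f).toVTy (Pi.lift gs ≫ 𝓜.const f) := by
  choose ds h using h
  obtain rfl : (fun i => 𝓜.semV (ds i)) = gs := funext h
  exact ⟨.const f ds, rfl⟩

theorem SemV.unit : 𝓜.SemV Γ .unit .unit (toUnit (𝓜.env Γ)) := ⟨.unit, rfl⟩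

theorem SemV.pair {g : 𝓜.env Γ ⟶ 𝓜.ty X} {g' : 𝓜.env Γ ⟶ 𝓜.ty Y} (h : 𝓜.SemV Γ V X g)
    (h' : 𝓜.SemV Γ W Y g') : 𝓜.SemV Γ (.pair V W) (.prod X Y) (lift g g') := by
  obtain ⟨d, rfl⟩ := h
  obtain ⟨d', rfl⟩ := h'
  exact ⟨.pair d d', rfl⟩

theorem SemV.lam {g : 𝓜.env Γ ⊗ 𝓜.ty X ⟶ (𝓜.T τ).obj (𝓜.ty Y)}
    (h : 𝓜.SemC (.var Γ X) M Y τ g) : 𝓜.SemV Γ (.lam X M) (.fn X Y τ) (cur g) := by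
  obtain ⟨d, rfl⟩ := h
  exact ⟨.lam d, rfl⟩

theorem SemV.box {g : (𝓜.past τ).obj (𝓜.env Γ) ⟶ 𝓜.ty X} (h : 𝓜.SemV (.mod Γ τ) V X g) :
    𝓜.SemV Γ (.box τ V) (.box τ X) (𝓜.boxS τ g) := by
  obtain ⟨d, rfl⟩ := h
  exact ⟨.box d, rfl⟩

theorem SemC.ret {g : 𝓜.env Γ ⟶ 𝓜.ty X} (h : 𝓜.SemV Γ V X g) :
    𝓜.SemC Γ (.ret V) X 0 (g ≫ 𝓜.monad.ret.app (𝓜.ty X)) := by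
  obtain ⟨d, rfl⟩ := h
  exact ⟨.ret d, rfl⟩

theorem SemC.letin {g : 𝓜.env Γ ⟶ (𝓜.T τ).obj (𝓜.ty X)}
    {k : (𝓜.past τ).obj (𝓜.env Γ) ⊗ 𝓜.ty X ⟶ (𝓜.T τ').obj (𝓜.ty Y)}
    (h : 𝓜.SemC Γ M X τ g) (hk : 𝓜.SemC (.var (.mod Γ τ) X) N Y τ' k) :
    𝓜.SemC Γ (.letin M N) Y (τ + τ') (𝓜.letS g k) := by
  obtain ⟨d, rfl⟩ := h
  obtain ⟨e, rfl⟩ := hk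
  exact ⟨.letin d e, 𝓜.semC_letin d e⟩

theorem SemC.app {g : 𝓜.env Γ ⟶ exp (𝓜.ty X) ((𝓜.T τ).obj (𝓜.ty Y))} {g' : 𝓜.env Γ ⟶ 𝓜.ty X}
    (h : 𝓜.SemV Γ V (.fn X Y τ) g) (h' : 𝓜.SemV Γ W X g') :
    𝓜.SemC Γ (.app V W) Y τ (appS g g') := by
  obtain ⟨d, rfl⟩ := h
  obtain ⟨e, rfl⟩ := h'
  exact ⟨.app d e, rfl⟩

theorem SemC.split {g : 𝓜.env Γ ⟶ 𝓜.ty X ⊗ 𝓜.ty Y}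
    {k : (𝓜.env Γ ⊗ 𝓜.ty X) ⊗ 𝓜.ty Y ⟶ (𝓜.T τ).obj (𝓜.ty Z)}
    (h : 𝓜.SemV Γ V (.prod X Y) g) (hk : 𝓜.SemC (.var (.var Γ X) Y) N Z τ k) :
    𝓜.SemC Γ (.split V N) Z τ (splitS g k) := by
  obtain ⟨d, rfl⟩ := h
  obtain ⟨e, rfl⟩ := hk
  exact ⟨.split d e, rfl⟩

theorem SemC.op (o : S.Op) {g : 𝓜.env Γ ⟶ 𝓜.arg o}
    {k : (𝓜.past (S.opTime o)).obj (𝓜.env Γ) ⊗ 𝓜.res o ⟶ (𝓜.T τ).obj (𝓜.ty X)}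
    (h : 𝓜.SemV Γ V (S.argTy o) g)
    (hk : 𝓜.SemC (.var (.mod Γ (S.opTime o)) (S.resTy o)) M X τ k) :
    𝓜.SemC Γ (.op o V M) X (S.opTime o + τ) (𝓜.opS o g k) := by
  obtain ⟨d, rfl⟩ := h
  obtain ⟨e, rfl⟩ := hk
  exact ⟨.op o d e, 𝓜.semC_op o d e⟩

theorem SemC.delay {k : (𝓜.past τ).obj (𝓜.env Γ) ⟶ (𝓜.T τ').obj (𝓜.ty X)}
    (hk : 𝓜.SemC (.mod Γ τ) M X τ' k) :
    𝓜.SemC Γ (.delay τ M) X (τ + τ') (𝓜.delayS τ k) := by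
  obtain ⟨e, rfl⟩ := hk
  exact ⟨.delay e, 𝓜.semC_delay e⟩

theorem SemC.handle {H : S.Op → Comp S} {g : 𝓜.env Γ ⟶ (𝓜.T τ).obj (𝓜.ty X)}
    {k : (𝓜.past τ).obj (𝓜.env Γ) ⊗ 𝓜.ty X ⟶ (𝓜.T τ').obj (𝓜.ty Y)}
    {hs : ∀ (o : S.Op) (θ : ℕ), (𝓜.env Γ ⊗ 𝓜.arg o) ⊗
      (𝓜.fut (S.opTime o)).obj (exp (𝓜.res o) ((𝓜.T θ).obj (𝓜.ty Y))) ⟶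
        (𝓜.T (S.opTime o + θ)).obj (𝓜.ty Y)}
    (h : 𝓜.SemC Γ M X τ g) (hk : 𝓜.SemC (.var (.mod Γ τ) X) N Y τ' k)
    (hh : ∀ (o : S.Op) (θ : ℕ),
      𝓜.SemC (.var (.var Γ (S.argTy o)) (.box (S.opTime o) (.fn (S.resTy o) Y θ)))
        (H o) Y (S.opTime o + θ) (hs o θ)) :
    𝓜.SemC Γ (.handle M H N) Y (τ + τ') (𝓜.handleS g k hs) := by
  obtain ⟨d, rfl⟩ := h
  obtain ⟨e, rfl⟩ := hk
  choose ds hds using hh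
  obtain rfl : (fun o θ => 𝓜.semC (ds o θ)) = hs := funext fun o => funext fun θ => hds o θ
  exact ⟨.handle d e ds, 𝓜.semC_handle d e ds⟩

theorem SemC.unbox {Γ' : Ctx S.Base} {p : 𝓜.env Γ ⟶ (𝓜.past τ).obj (𝓜.env Γ')}
    {g : 𝓜.env Γ' ⟶ (𝓜.fut τ).obj (𝓜.ty X)}
    {k : 𝓜.env Γ ⊗ 𝓜.ty X ⟶ (𝓜.T τ').obj (𝓜.ty Y)}
    (hp : 𝓜.Pra Γ τ Γ' p) (h : 𝓜.SemV Γ' V (.box τ X) g) (hk : 𝓜.SemC (.var Γ X) N Y τ' k) :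
    𝓜.SemC Γ (.unbox τ V N) Y τ' (𝓜.unboxS p g k) := by
  obtain ⟨hτ, rfl, rfl⟩ := hp.eq_pra
  obtain ⟨d, rfl⟩ := h
  obtain ⟨e, rfl⟩ := hk
  refine ⟨.unbox hτ d e, (𝓜.semC_unbox hτ d e).trans ?_⟩
  rw [ctxCast_refl, CategoryTheory.Functor.map_id, Category.comp_id]

/-! ### The substitution lemma for abstract environment morphisms -/

variable (𝓜)

/-- A class of environment morphisms `f : ⟦Δ⟧ ⟶ ⟦Γ⟧` that interpret simultaneous substitutions `σ`
of terms over `Δ` for the variables of `Γ`, closed under the ways in which the typing rules change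
the context. Closure under time travel is what makes substitution commute with unboxing. -/
structure SubstClass
    (R : (Δ Γ : Ctx S.Base) → (ℕ → Val S) → (𝓜.env Δ ⟶ 𝓜.env Γ) → Prop) : Prop where
  lookup : ∀ {Δ Γ σ f}, R Δ Γ σ f → ∀ {i X} (v : Lookup Γ i X),
    𝓜.SemV Δ (σ i) X (f ≫ 𝓜.lookup v)
  var : ∀ {Δ Γ σ f}, R Δ Γ σ f → ∀ X,
    R (.var Δ X) (.var Γ X) (liftSub σ) (f ▷ 𝓜.ty X)
  mod : ∀ {Δ Γ σ f}, R Δ Γ σ f → ∀ τ, R (.mod Δ τ) (.mod Γ τ) σ ((𝓜.past τ).map f)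
  minus : ∀ {Δ Γ σ f}, R Δ Γ σ f → ∀ {τ Γ' q}, 𝓜.Pra Γ τ Γ' q →
    ∃ Δ' p f', 𝓜.Pra Δ τ Δ' p ∧ R Δ' Γ' σ f' ∧ p ≫ (𝓜.past τ).map f' = f ≫ q

variable {𝓜} {R : (Δ Γ : Ctx S.Base) → (ℕ → Val S) → (𝓜.env Δ ⟶ 𝓜.env Γ) → Prop}

mutual

/-- The substitution lemma for values: the interpretation of `V[σ]` is that of `V` precomposed with
the interpretation of `σ`. -/
theorem SubstClass.semV (hR : 𝓜.SubstClass R) :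
    ∀ {Γ : Ctx S.Base} {V : Val S} {X : VTy S.Base} (d : HasV S Γ V X) {Δ : Ctx S.Base}
      {σ : ℕ → Val S} {f : 𝓜.env Δ ⟶ 𝓜.env Γ}, R Δ Γ σ f →
      𝓜.SemV Δ (V.subst σ) X (f ≫ 𝓜.semV d)
  | _, _, _, .var v, _, _, _, h => (hR.lookup h v).congr (by rw [semV_var])
  | _, _, _, .const c ds, _, _, _, h =>
      (SemV.const c fun i => hR.semV (ds i) h).congr (comp_piLift _ _ _).symm
  | _, _, _, .unit, _, _, _, _ => SemV.unit.congr (toUnit_unique _ _)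
  | _, _, _, .pair d e, _, _, _, h =>
      (SemV.pair (hR.semV d h) (hR.semV e h)).congr (comp_lift _ _ _).symm
  | _, _, _, .lam d, _, _, _, h =>
      (SemV.lam (hR.semC d (hR.var h _))).congr (comp_cur _ _).symm
  | _, _, _, .box d, _, _, _, h =>
      (SemV.box (hR.semV d (hR.mod h _))).congr (𝓜.comp_boxS _ _).symm

/-- The substitution lemma for computations. -/
theorem SubstClass.semC (hR : 𝓜.SubstClass R) :
    ∀ {Γ : Ctx S.Base} {M : Comp S} {X : VTy S.Base} {τ : ℕ} (d : HasC S Γ M X τ)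
      {Δ : Ctx S.Base} {σ : ℕ → Val S} {f : 𝓜.env Δ ⟶ 𝓜.env Γ}, R Δ Γ σ f →
      𝓜.SemC Δ (M.subst σ) X τ (f ≫ 𝓜.semC d)
  | _, _, _, _, .ret d, _, _, _, h =>
      (SemC.ret (hR.semV d h)).congr (Category.assoc _ _ _)
  | _, _, _, _, .letin d e, _, _, f, h =>
      (SemC.letin (hR.semC d h) (hR.semC e (hR.var (hR.mod h _) _))).congr
        ((𝓜.comp_letS _ _ _).symm.trans (congrArg (f ≫ ·) (𝓜.semC_letin d e).symm))
  | _, _, _, _, .app d e, _, _, _, h =>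
      (SemC.app (hR.semV d h) (hR.semV e h)).congr (comp_appS _ _ _).symm
  | _, _, _, _, .split d e, _, _, _, h =>
      (SemC.split (hR.semV d h) (hR.semC e (hR.var (hR.var h _) _))).congr
        (comp_splitS _ _ _).symm
  | _, _, _, _, .op o d e, _, _, f, h =>
      (SemC.op o (hR.semV d h) (hR.semC e (hR.var (hR.mod h _) _))).congr
        ((𝓜.comp_opS _ _ _ _).symm.trans (congrArg (f ≫ ·) (𝓜.semC_op o d e).symm))
  | _, _, _, _, .delay e, _, _, f, h =>
      (SemC.delay (hR.semC e (hR.mod h _))).congr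
        ((𝓜.comp_delayS _ _).symm.trans (congrArg (f ≫ ·) (𝓜.semC_delay e).symm))
  | _, _, _, _, .handle d e ds, _, _, f, h =>
      (SemC.handle (hR.semC d h) (hR.semC e (hR.var (hR.mod h _) _))
        fun o θ => hR.semC (ds o θ) (hR.var (hR.var h _) _)).congr
        ((𝓜.comp_handleS _ _ _ _).symm.trans (congrArg (f ≫ ·) (𝓜.semC_handle d e ds).symm))
  | _, _, _, _, .unbox hτ d e, _, _, f, h => by
      obtain ⟨Δ', p, f', hp, h', e'⟩ := hR.minus h (pra_minus hτ)
      exact (SemC.unbox hp (hR.semV d h') (hR.semC e (hR.var h _))).congr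
        ((𝓜.comp_unboxS f _ f' p e' _ _).symm.trans
          (congrArg (f ≫ ·) (𝓜.semC_unbox hτ d e).symm))

end

end Model

/-! ### Equations for weakening and substitution -/

section

variable {C : Type v} [Category.{w} C]

theorem comp_map_id {A B : C} (F : C ⥤ C) (f : A ⟶ F.obj B) : f ≫ F.map (𝟙 B) = f := by simp

theorem comp_map_id_eq_id_comp {A B : C} (F : C ⥤ C) (f : A ⟶ F.obj B) :
    f ≫ F.map (𝟙 B) = 𝟙 A ≫ f := by simp

theorem comp_map_comp (F : C ⥤ C) {A A' B B' D : C} {p : A ⟶ F.obj B} {p' : A' ⟶ F.obj B'}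
    {g : A' ⟶ A} {g' : B' ⟶ B} (e : p' ≫ F.map g' = g ≫ p) (f : B ⟶ D) :
    p' ≫ F.map (g' ≫ f) = g ≫ p ≫ F.map f := by
  rw [Functor.map_comp, ← Category.assoc, e, Category.assoc]

theorem lift_fst_comp_snd [CartesianMonoidalCategory C] {A A' B : C} (f : A ⟶ A') :
    lift (fst A B ≫ f) (snd A B) = f ▷ B := by
  ext <;> simp

end

namespace Modalities

variable {C : Type v} [Category.{w} C] (𝓜 : Modalities C)

/-- The unit of the past modality under `⟨τ⟩` is the splitting of `τ` as `τ + 0`. -/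
theorem map_η_eq_comu {τ : ℕ} (A : C) :
    (𝓜.past τ).map (𝓜.η.hom.app A) = 𝓜.comu (b := 0) rfl A := by
  apply 𝓜.mu_injective (b := 0) rfl
  rw [map_η_mu, comu_mu]

theorem map_η_eq_η (A : C) :
    (𝓜.past 0).map (𝓜.η.hom.app A) = 𝓜.η.hom.app ((𝓜.past 0).obj A) := by
  apply 𝓜.mu_injective (Nat.add_zero 0).symm
  rw [map_η_mu, η_mu]

theorem map_η_comp_now {τ : ℕ} {A B : C} (f : A ⟶ B) :
    (𝓜.past τ).map (𝓜.η.hom.app A) ≫ (𝓜.past τ).map (𝓜.now 0 A ≫ f) = (𝓜.past τ).map f := by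
  rw [← Functor.map_comp, ← Category.assoc, η_now]
  exact congrArg _ (Category.id_comp f)

theorem comu_now {a b c : ℕ} (h : c = a + b) (A : C) :
    𝓜.comu h A ≫ 𝓜.now a _ ≫ 𝓜.now b A = 𝓜.now c A := by
  rw [← 𝓜.mu_now h.le, ← Category.assoc, comu_mu, pastLE_now]

theorem map_mu_now {a b c : ℕ} (h : c ≤ a + b) {A B D : C} (p : A ⟶ (𝓜.past b).obj B)
    (g : B ⟶ D) :
    ((𝓜.past a).map p ≫ 𝓜.mu h B) ≫ 𝓜.now c B ≫ g = 𝓜.now a A ≫ p ≫ 𝓜.now b B ≫ g := by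
  rw [Category.assoc, ← Category.assoc (𝓜.mu _ _), mu_now, Category.assoc,
    ← Category.assoc ((𝓜.past a).map p), now_natural, Category.assoc]

theorem map_comp_now {τ : ℕ} {A B D E : C} (p : A ⟶ (𝓜.past τ).obj B) (f : B ⟶ D) (g : D ⟶ E) :
    (p ≫ (𝓜.past τ).map f) ≫ 𝓜.now τ D ≫ g = (p ≫ 𝓜.now τ B) ≫ f ≫ g := by
  rw [Category.assoc, ← Category.assoc ((𝓜.past τ).map f), now_natural]
  simp only [Category.assoc]

theorem map_mu_zero {τ : ℕ} {A B : C} (q : A ⟶ (𝓜.past τ).obj B) (h : τ ≤ 0 + τ) :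
    (𝓜.past 0).map q ≫ 𝓜.mu h B = 𝓜.now 0 A ≫ q := by
  rw [← now_eq_mu, now_natural]

/-- Travelling `τ` units into the past and then forgetting the age commutes with travelling `τ'`
units into the past. -/
theorem swap_now {τ τ' θ : ℕ} (h : θ = τ + τ') (h' : θ = τ' + τ) {A A₁ A₂ B : C}
    {p : A ⟶ (𝓜.past τ).obj A₁} {q : A₁ ⟶ (𝓜.past τ').obj B}
    {p' : A ⟶ (𝓜.past τ').obj A₂} {q' : A₂ ⟶ (𝓜.past τ).obj B}
    (e : p' ≫ (𝓜.past τ').map q' ≫ 𝓜.mu h'.le B = p ≫ (𝓜.past τ).map q ≫ 𝓜.mu h.le B) :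
    p' ≫ (𝓜.past τ').map (q' ≫ 𝓜.now τ B) = (p ≫ 𝓜.now τ A₁) ≫ q := by
  have h₁ := congrArg (· ≫ 𝓜.pastLE (by omega : τ' ≤ θ) B) e
  simp only [Category.assoc, mu_pastLE] at h₁
  rw [← map_now_eq_mu, ← now_eq_mu, now_natural] at h₁
  rw [Functor.map_comp, h₁, Category.assoc]

theorem split_comu {a b c : ℕ} (h : c = a + b) {A B D E : C} (p : A ⟶ (𝓜.past a).obj B)
    (q : B ⟶ (𝓜.past b).obj D) (f : D ⟶ E) :
    p ≫ (𝓜.past a).map (q ≫ (𝓜.past b).map f) =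
      ((p ≫ (𝓜.past a).map q ≫ 𝓜.mu h.le D) ≫ (𝓜.past c).map f) ≫ 𝓜.comu h E := by
  apply 𝓜.mu_injective h
  simp only [Category.assoc]
  rw [comu_mu, pastLE_refl, Category.comp_id, ← mu_natural, Functor.map_comp, Category.assoc]

theorem seq_map {a b c : ℕ} (h : c ≤ a + b) {A B B' D D' : C} (p : A ⟶ (𝓜.past a).obj B)
    {f : B ⟶ B'} {q : B' ⟶ (𝓜.past b).obj D'} {q' : B ⟶ (𝓜.past b).obj D} {f' : D ⟶ D'}
    (e : q' ≫ (𝓜.past b).map f' = f ≫ q) :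
    (p ≫ (𝓜.past a).map q' ≫ 𝓜.mu h D) ≫ (𝓜.past c).map f' =
      (p ≫ (𝓜.past a).map f) ≫ (𝓜.past a).map q ≫ 𝓜.mu h D' := by
  simp only [Category.assoc]
  rw [← mu_natural, ← Functor.map_comp_assoc, e, Functor.map_comp_assoc]

end Modalities

namespace Model

variable {S : Signature.{u}} {C : Type v} [Category.{w} C] [CartesianMonoidalCategory C]
  [MonoidalClosed C] [HasProductsOfShape ℕ C] [HasProductsOfShape S.Op C] (𝓜 : Model S C)

/-! ### Weakening -/

/-- The basic weakenings. `𝓜.Weaken Δ' Δ ρ g` says that `g : ⟦Δ'⟧ ⟶ ⟦Δ⟧` interprets the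
reindexing `ρ` of terms over `Δ` as terms over `Δ'`. The weakening `pra` is by the part of a
context that time travel removes; it arises from looking up a variable to the left of a modality.
These weakenings are what is needed for the family to be closed under time travel. -/
inductive Weaken : (Δ' Δ : Ctx S.Base) → (ℕ → ℕ) → (𝓜.env Δ' ⟶ 𝓜.env Δ) → Prop
  | refl {Δ : Ctx S.Base} : Weaken Δ Δ id (𝟙 (𝓜.env Δ))
  | var {Δ : Ctx S.Base} {X : VTy S.Base} :
      Weaken (.var Δ X) Δ Nat.succ (fst (𝓜.env Δ) (𝓜.ty X))
  | gap {Δ : Ctx S.Base} : Weaken (.gap Δ) Δ Nat.succ (𝟙 (𝓜.env Δ))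
  | mod_zero {Δ : Ctx S.Base} : Weaken (.mod Δ 0) Δ id (𝓜.mods.now 0 (𝓜.env Δ))
  | pra {Δ' Δ : Ctx S.Base} {τ : ℕ} {p : 𝓜.env Δ' ⟶ (𝓜.past τ).obj (𝓜.env Δ)} :
      𝓜.Pra Δ' τ Δ p → Weaken Δ' Δ id (p ≫ 𝓜.mods.now τ (𝓜.env Δ))

variable {𝓜}

/-- Weakenings can be restricted to a time `τ` units in the past. -/
theorem Weaken.minus {Δ' Δ Γ : Ctx S.Base} {ρ : ℕ → ℕ} {g : 𝓜.env Δ' ⟶ 𝓜.env Δ} {τ : ℕ}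
    {q : 𝓜.env Δ ⟶ (𝓜.past τ).obj (𝓜.env Γ)} (h : 𝓜.Weaken Δ' Δ ρ g) (hq : 𝓜.Pra Δ τ Γ q) :
    ∃ Γ' p g', 𝓜.Pra Δ' τ Γ' p ∧ 𝓜.Weaken Γ' Γ ρ g' ∧ p ≫ (𝓜.past τ).map g' = g ≫ q := by
  rcases Nat.eq_zero_or_pos τ with rfl | hτ
  · cases hq with
    | zero => exact ⟨_, _, _, .zero, h, 𝓜.mods.η_natural _⟩
    | _ => omega
  cases h with
  | refl => exact ⟨_, _, _, hq, .refl, comp_map_id_eq_id_comp _ _⟩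
  | var => exact ⟨_, _, _, .var hτ hq, .gap, comp_map_id _ _⟩
  | gap => exact ⟨_, _, _, .gap hτ hq, .gap, comp_map_id_eq_id_comp _ _⟩
  | mod_zero =>
    exact ⟨_, _, _, .gt hτ hq (Nat.zero_add τ).symm, .refl,
      (comp_map_id _ _).trans (𝓜.mods.map_mu_zero _ _)⟩
  | @pra _ _ t p hp =>
    obtain ⟨Γ', p', q', hp', hq', e⟩ := (hp.comp hq (Nat.add_comm τ t)).split rfl
    exact ⟨_, _, _, hp', .pra hq', 𝓜.mods.swap_now (Nat.add_comm τ t) rfl e⟩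

/-! ### Simultaneous substitutions -/

variable (𝓜)

/-- Simultaneous substitutions `σ` of terms over `Δ` for the variables of `Γ`, with their
interpretation `⟦Δ⟧ ⟶ ⟦Γ⟧`. The terms are specified by `Q Δ V X g`, for a term `V` of type `X` over
`Δ` with interpretation `g`. A modality `⟨τ⟩` of `Γ` is matched by going back `τ` units of time in
`Δ`; nothing is substituted at a gap. -/
inductive Subst (Q : (Δ : Ctx S.Base) → Val S → (X : VTy S.Base) → (𝓜.env Δ ⟶ 𝓜.ty X) → Prop) :
    (Δ Γ : Ctx S.Base) → (ℕ → Val S) → (𝓜.env Δ ⟶ 𝓜.env Γ) → Prop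
  | nil {Δ : Ctx S.Base} {σ : ℕ → Val S} : Subst Q Δ .nil σ (toUnit (𝓜.env Δ))
  | var {Δ Γ : Ctx S.Base} {σ : ℕ → Val S} {X : VTy S.Base} {f : 𝓜.env Δ ⟶ 𝓜.env Γ}
      {g : 𝓜.env Δ ⟶ 𝓜.ty X} :
      Subst Q Δ Γ (fun i => σ (i + 1)) f → Q Δ (σ 0) X g → Subst Q Δ (.var Γ X) σ (lift f g)
  | gap {Δ Γ : Ctx S.Base} {σ : ℕ → Val S} {f : 𝓜.env Δ ⟶ 𝓜.env Γ} :
      Subst Q Δ Γ (fun i => σ (i + 1)) f → Subst Q Δ (.gap Γ) σ f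
  | mod {Δ Δ' Γ : Ctx S.Base} {σ : ℕ → Val S} {τ : ℕ}
      {p : 𝓜.env Δ ⟶ (𝓜.past τ).obj (𝓜.env Δ')} {f : 𝓜.env Δ' ⟶ 𝓜.env Γ} :
      𝓜.Pra Δ τ Δ' p → Subst Q Δ' Γ σ f → Subst Q Δ (.mod Γ τ) σ (p ≫ (𝓜.past τ).map f)

/-- Classes of interpreted terms that contain the variables and are closed under weakening. The
relevant ones are the variables, and all well-typed values: the substitution lemma for the first,
which is about renamings, yields the closure of the second under weakening. -/
structure TermClass
    (Q : (Δ : Ctx S.Base) → Val S → (X : VTy S.Base) → (𝓜.env Δ ⟶ 𝓜.ty X) → Prop) : Prop where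
  semV : ∀ {Δ V X g}, Q Δ V X g → 𝓜.SemV Δ V X g
  var : ∀ {Δ X}, Q (.var Δ X) (.var 0) X (snd (𝓜.env Δ) (𝓜.ty X))
  weaken : ∀ {Δ' Δ V X ρ g h}, Q Δ V X g → 𝓜.Weaken Δ' Δ ρ h → Q Δ' (V.rename ρ) X (h ≫ g)

variable {𝓜}
  {Q : (Δ : Ctx S.Base) → Val S → (X : VTy S.Base) → (𝓜.env Δ ⟶ 𝓜.ty X) → Prop}

theorem Subst.congr {Δ Γ : Ctx S.Base} {σ σ' : ℕ → Val S} {f f' : 𝓜.env Δ ⟶ 𝓜.env Γ}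
    (h : 𝓜.Subst Q Δ Γ σ f) (e : σ = σ') (e' : f = f') : 𝓜.Subst Q Δ Γ σ' f' := e ▸ e' ▸ h

/-- Substitutions into `Δ` can be weakened to substitutions into `Δ'`. -/
theorem Subst.weaken (hQ : 𝓜.TermClass Q) {Δ' Δ Γ : Ctx S.Base} {σ : ℕ → Val S}
    {f : 𝓜.env Δ ⟶ 𝓜.env Γ} {ρ : ℕ → ℕ} {g : 𝓜.env Δ' ⟶ 𝓜.env Δ}
    (h : 𝓜.Subst Q Δ Γ σ f) (hw : 𝓜.Weaken Δ' Δ ρ g) :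
    𝓜.Subst Q Δ' Γ (fun i => (σ i).rename ρ) (g ≫ f) := by
  induction h generalizing Δ' ρ with
  | nil => exact Subst.nil.congr rfl (toUnit_unique _ _)
  | var _ hq ih => exact (Subst.var (ih hw) (hQ.weaken hq hw)).congr rfl (comp_lift _ _ _).symm
  | gap _ ih => exact Subst.gap (ih hw)
  | mod hp _ ih =>
    obtain ⟨Δ₁, p', g', hp', hw', e⟩ := hw.minus hp
    exact (Subst.mod hp' (ih hw')).congr rfl (comp_map_comp _ e _)

theorem Subst.weaken_id (hQ : 𝓜.TermClass Q) {Δ' Δ Γ : Ctx S.Base} {σ : ℕ → Val S}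
    {f : 𝓜.env Δ ⟶ 𝓜.env Γ} {g : 𝓜.env Δ' ⟶ 𝓜.env Δ}
    (h : 𝓜.Subst Q Δ Γ σ f) (hw : 𝓜.Weaken Δ' Δ id g) : 𝓜.Subst Q Δ' Γ σ (g ≫ f) :=
  (h.weaken hQ hw).congr (funext fun i => (σ i).rename_id) rfl

/-- Going back `τ` units from `Γ, ⟨τ⟩` leaves the empty modality `⟨0⟩` behind, and not `Γ` itself
(for `τ = 0`, because `Γ, ⟨0⟩` is left unchanged). -/
theorem pra_mod_self {Γ : Ctx S.Base} {τ : ℕ} :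
    𝓜.Pra (.mod Γ τ) τ (.mod Γ 0) ((𝓜.past τ).map (𝓜.mods.η.hom.app (𝓜.env Γ))) := by
  rcases Nat.eq_zero_or_pos τ with rfl | hτ
  · exact Pra.zero.congr (𝓜.mods.map_η_eq_η _).symm
  · exact (Pra.le hτ rfl).congr (𝓜.mods.map_η_eq_comu _).symm

/-- Substitutions can be restricted to a time `τ` units in the past. -/
theorem Subst.minus {Δ Γ Γ' : Ctx S.Base} {σ : ℕ → Val S} {f : 𝓜.env Δ ⟶ 𝓜.env Γ} {τ : ℕ}
    {q : 𝓜.env Γ ⟶ (𝓜.past τ).obj (𝓜.env Γ')} (h : 𝓜.Subst Q Δ Γ σ f) (hq : 𝓜.Pra Γ τ Γ' q) :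
    ∃ Δ' p f', 𝓜.Pra Δ τ Δ' p ∧ 𝓜.Subst Q Δ' Γ' σ f' ∧ p ≫ (𝓜.past τ).map f' = f ≫ q := by
  induction hq generalizing Δ σ with
  | zero => exact ⟨_, _, _, .zero, h, 𝓜.mods.η_natural _⟩
  | var hτ hq ih =>
    cases h with
    | var h _ =>
      obtain ⟨Δ', p, f', hp, h', e⟩ := ih h
      exact ⟨_, _, _, hp, .gap h', e.trans (lift_fst_assoc _ _ _).symm⟩
  | gap hτ hq ih =>
    cases h with
    | gap h =>
      obtain ⟨Δ', p, f', hp, h', e⟩ := ih h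
      exact ⟨_, _, _, hp, .gap h', e⟩
  | @le Γ τ τ' s hτ hs =>
    cases h with
    | mod hr h =>
      obtain ⟨Δ', p, q, hp, hq, e⟩ := hr.split hs
      refine ⟨_, _, _, hp, .mod hq h, ?_⟩
      rw [← e]
      exact 𝓜.mods.split_comu hs _ _ _
  | gt hs hq hθ ih =>
    cases h with
    | mod hr h =>
      obtain ⟨Δ', p, f', hp, h', e⟩ := ih h
      exact ⟨_, _, _, hr.comp hp hθ, h', 𝓜.mods.seq_map _ _ e⟩

theorem Subst.lookup (hQ : 𝓜.TermClass Q) {Δ Γ : Ctx S.Base} {σ : ℕ → Val S}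
    {f : 𝓜.env Δ ⟶ 𝓜.env Γ} (h : 𝓜.Subst Q Δ Γ σ f) {i : ℕ} {X : VTy S.Base}
    (v : Lookup Γ i X) : Q Δ (σ i) X (f ≫ 𝓜.lookup v) := by
  induction h generalizing i with
  | nil => cases v
  | var _ hq ih =>
    cases v with
    | here => exact (congrArg (Q _ _ _) (lift_snd _ _)).mpr hq
    | var v => exact (congrArg (Q _ _ _) (lift_fst_assoc _ _ _)).mpr (ih v)
  | gap _ ih =>
    cases v with
    | gap v => exact ih v
  | @mod Δ Δ' Γ σ τ p f hp _ ih =>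
    cases v with
    | mod v =>
      have h := hQ.weaken (ih v) (.pra hp)
      rw [Val.rename_id] at h
      exact (congrArg (Q _ _ _) (𝓜.mods.map_comp_now _ _ _)).mpr h

/-- The substitutions by a class of terms satisfy the hypotheses of the substitution lemma. -/
theorem TermClass.substClass (hQ : 𝓜.TermClass Q) : 𝓜.SubstClass (𝓜.Subst Q) where
  lookup h _ _ v := hQ.semV (h.lookup hQ v)
  var {_ _ σ _} h _ :=
    (Subst.var (σ := liftSub σ) (h.weaken hQ .var) hQ.var).congr rfl
      (lift_fst_comp_snd _)
  -- Going back `τ` units from `Δ, ⟨τ⟩` leads to `Δ, ⟨0⟩`.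
  mod {_ _ _ f} h _ :=
    (Subst.mod pra_mod_self (h.weaken_id hQ .mod_zero)).congr rfl (𝓜.mods.map_η_comp_now f)
  minus h _ _ _ hq := h.minus hq

end Model

/-! ### Equations for matching and for merging modalities -/

section

variable {C : Type v} [Category.{w} C]

theorem whiskerRight_id_eq [CartesianMonoidalCategory C] (A B : C) :
    (𝟙 A) ▷ B = 𝟙 (A ⊗ B) := by simp

theorem whiskerRight_whiskerRight_comp [CartesianMonoidalCategory C] {A A' A'' B D : C}
    (f : A ⟶ A') (g : A' ⟶ A'') (k : A'' ⊗ B ⟶ D) :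
    (f ▷ B) ≫ (g ▷ B) ≫ k = ((f ≫ g) ▷ B) ≫ k := by simp

theorem whiskerRight₂_comp [CartesianMonoidalCategory C] {A A' A'' B B' D : C}
    (f : A ⟶ A') (g : A' ⟶ A'') (k : (A'' ⊗ B) ⊗ B' ⟶ D) :
    ((f ▷ B) ▷ B') ≫ ((g ▷ B) ▷ B') ≫ k = (((f ≫ g) ▷ B) ▷ B') ≫ k := by simp

/-- The β-law of products. -/
theorem splitS_lift [CartesianMonoidalCategory C] {E X Y Z : C} (g : E ⟶ X) (g' : E ⟶ Y)
    (k : (E ⊗ X) ⊗ Y ⟶ Z) : splitS (lift g g') k = lift (lift (𝟙 E) g) g' ≫ k := by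
  rw [splitS, ← Category.assoc, lift_lift_associator_inv]

/-- The η-law of products. -/
theorem splitS_eta [CartesianMonoidalCategory C] {E X Y Z : C} (g : E ⟶ X ⊗ Y)
    (k : E ⊗ (X ⊗ Y) ⟶ Z) :
    splitS g (lift (fst (E ⊗ X) Y ≫ fst E X)
      (lift (fst (E ⊗ X) Y ≫ snd E X) (snd (E ⊗ X) Y)) ≫ k) =
      lift (𝟙 E) g ≫ k := by
  rw [splitS, ← Category.assoc, ← Category.assoc]
  congr 1
  ext <;> simp

theorem Modalities.map_η_now_now (𝓜 : Modalities C) {τ : ℕ} (A : C) :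
    ((𝓜.past τ).map (𝓜.η.hom.app A) ≫ 𝓜.now τ _) ≫ 𝓜.now 0 A ≫ 𝟙 A = 𝓜.now τ A := by
  rw [now_natural, Category.assoc, Category.comp_id, η_now]
  exact Category.comp_id _

theorem Modalities.map_η_comp_mu (𝓜 : Modalities C) {a b c : ℕ} (h : c ≤ b + a) {A D : C}
    {p : (𝓜.past 0).obj ((𝓜.past a).obj A) ⟶ (𝓜.past a).obj D} {f : D ⟶ A}
    (e : 𝓜.now 0 ((𝓜.past a).obj A) ≫ 𝟙 _ = p ≫ (𝓜.past a).map f) :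
    ((𝓜.past b).map (𝓜.η.hom.app ((𝓜.past a).obj A)) ≫ (𝓜.past b).map p ≫ 𝓜.mu h D) ≫
      (𝓜.past c).map f = 𝓜.mu h A := by
  simp only [Category.assoc]
  rw [← mu_natural, ← Functor.map_comp_assoc ((𝓜.past b)) p, ← e, ← Category.assoc,
    map_η_comp_now, CategoryTheory.Functor.map_id]
  exact Category.id_comp _

end

namespace Model

variable {S : Signature.{u}} {C : Type v} [Category.{w} C] [CartesianMonoidalCategory C]
  [MonoidalClosed C] [HasProductsOfShape ℕ C] [HasProductsOfShape S.Op C] {𝓜 : Model S C}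

/-! ### Renamings and substitutions -/

variable (𝓜) in
/-- The interpreted terms that are variables: substitutions by these are renamings. -/
def IsVar (Δ : Ctx S.Base) (V : Val S) (X : VTy S.Base) (g : 𝓜.env Δ ⟶ 𝓜.ty X) : Prop :=
  ∃ (i : ℕ) (v : Lookup Δ i X), V = .var i ∧ 𝓜.lookup v = g

/-- A variable of `Γ - τ` is a variable of `Γ`, whose interpretation passes through the
modalities that are removed. -/
theorem Pra.exists_lookup {Δ Δ' : Ctx S.Base} {τ : ℕ}
    {p : 𝓜.env Δ ⟶ (𝓜.past τ).obj (𝓜.env Δ')} (hp : 𝓜.Pra Δ τ Δ' p) {i : ℕ} {X : VTy S.Base}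
    (v : Lookup Δ' i X) :
    ∃ v' : Lookup Δ i X, 𝓜.lookup v' = p ≫ 𝓜.mods.now τ (𝓜.env Δ') ≫ 𝓜.lookup v := by
  induction hp generalizing i with
  | zero =>
    exact ⟨v, ((congrArg (· ≫ 𝓜.lookup v) (𝓜.mods.η_now _)).trans
      (Category.id_comp _)).symm.trans (Category.assoc _ _ _)⟩
  | var _ _ ih =>
    cases v with
    | gap v =>
      obtain ⟨v', e⟩ := ih v
      exact ⟨.var v', (congrArg (fst _ _ ≫ ·) e).trans (Category.assoc _ _ _).symm⟩
  | gap _ _ ih =>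
    cases v with
    | gap v =>
      obtain ⟨v', e⟩ := ih v
      exact ⟨.gap v', e⟩
  | le _ h =>
    cases v with
    | mod v =>
      exact ⟨.mod v, ((congrArg (· ≫ 𝓜.lookup v) (𝓜.mods.comu_now h _)).symm.trans
        (Category.assoc _ _ _)).trans (congrArg (𝓜.mods.comu h _ ≫ ·) (Category.assoc _ _ _))⟩
  | gt _ _ h ih =>
    obtain ⟨v', e⟩ := ih v
    exact ⟨.mod v', (congrArg (𝓜.mods.now _ _ ≫ ·) e).trans (𝓜.mods.map_mu_now _ _ _).symm⟩

theorem Weaken.exists_lookup {Δ' Δ : Ctx S.Base} {ρ : ℕ → ℕ} {h : 𝓜.env Δ' ⟶ 𝓜.env Δ}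
    (hw : 𝓜.Weaken Δ' Δ ρ h) {i : ℕ} {X : VTy S.Base} (v : Lookup Δ i X) :
    ∃ v' : Lookup Δ' (ρ i) X, 𝓜.lookup v' = h ≫ 𝓜.lookup v := by
  cases hw with
  | refl => exact ⟨v, (Category.id_comp _).symm⟩
  | var => exact ⟨.var v, rfl⟩
  | gap => exact ⟨.gap v, (Category.id_comp _).symm⟩
  | mod_zero => exact ⟨.mod v, rfl⟩
  | pra hp =>
    obtain ⟨v', e⟩ := hp.exists_lookup v
    exact ⟨v', e.trans (Category.assoc _ _ _).symm⟩

variable (𝓜) in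
theorem termClass_isVar : 𝓜.TermClass 𝓜.IsVar where
  semV := by
    rintro Δ V X g ⟨i, v, rfl, rfl⟩
    exact SemV.var v
  var := ⟨0, .here, rfl, rfl⟩
  weaken := by
    rintro Δ' Δ V X ρ g h ⟨i, v, rfl, rfl⟩ hw
    obtain ⟨v', e⟩ := hw.exists_lookup v
    exact ⟨ρ i, v', rfl, e⟩

theorem liftSub_var_self : liftSub (S := S) .var = .var := by
  funext i; cases i <;> rfl

theorem Subst.id {Q : (Δ : Ctx S.Base) → Val S → (X : VTy S.Base) → (𝓜.env Δ ⟶ 𝓜.ty X) → Prop}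
    (hQ : 𝓜.TermClass Q) : ∀ Γ : Ctx S.Base, 𝓜.Subst Q Γ Γ .var (𝟙 (𝓜.env Γ))
  | .nil => Subst.nil.congr rfl (toUnit_unique _ _)
  | .var Γ X => (hQ.substClass.var (Subst.id hQ Γ) X).congr liftSub_var_self
      (whiskerRight_id_eq _ _)
  | .mod Γ τ => (hQ.substClass.mod (Subst.id hQ Γ) τ).congr rfl
      (CategoryTheory.Functor.map_id _ _)
  | .gap Γ => Subst.gap (((Subst.id hQ Γ).weaken hQ .gap).congr rfl (Category.id_comp _))

variable (𝓜) in
/-- Renamings `ρ` of terms over `Γ` to terms over `Δ`, with their interpretation. -/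
def Rename (Δ Γ : Ctx S.Base) (ρ : ℕ → ℕ) (f : 𝓜.env Δ ⟶ 𝓜.env Γ) : Prop :=
  𝓜.Subst 𝓜.IsVar Δ Γ (fun i => .var (ρ i)) f

variable {Γ Δ : Ctx S.Base} {X Y Z : VTy S.Base} {τ τ' θ : ℕ} {V W : Val S} {M N : Comp S}
  {ρ : ℕ → ℕ} {f : 𝓜.env Δ ⟶ 𝓜.env Γ}

theorem Rename.congr {f' : 𝓜.env Δ ⟶ 𝓜.env Γ} (h : 𝓜.Rename Δ Γ ρ f) (e : f = f') :
    𝓜.Rename Δ Γ ρ f' := e ▸ h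

theorem Weaken.rename (h : 𝓜.Weaken Δ Γ ρ f) : 𝓜.Rename Δ Γ ρ f :=
  ((Subst.id 𝓜.termClass_isVar Γ).weaken 𝓜.termClass_isVar h).congr rfl (Category.comp_id f)

theorem Rename.var (h : 𝓜.Rename Δ Γ ρ f) (X : VTy S.Base) :
    𝓜.Rename (.var Δ X) (.var Γ X) (liftRen ρ) (f ▷ 𝓜.ty X) :=
  (𝓜.termClass_isVar.substClass.var h X).congr (liftSub_var ρ) rfl

theorem Rename.var_id (h : 𝓜.Rename Δ Γ id f) (X : VTy S.Base) :
    𝓜.Rename (.var Δ X) (.var Γ X) id (f ▷ 𝓜.ty X) :=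
  liftRen_id ▸ h.var X

theorem Rename.mod (h : 𝓜.Rename Δ Γ ρ f) (τ : ℕ) :
    𝓜.Rename (.mod Δ τ) (.mod Γ τ) ρ ((𝓜.past τ).map f) :=
  𝓜.termClass_isVar.substClass.mod h τ

theorem SemV.rename {g : 𝓜.env Γ ⟶ 𝓜.ty X} (h : 𝓜.SemV Γ V X g) (hρ : 𝓜.Rename Δ Γ ρ f) :
    𝓜.SemV Δ (V.rename ρ) X (f ≫ g) := by
  obtain ⟨d, rfl⟩ := h
  rw [Val.rename_eq_subst]
  exact 𝓜.termClass_isVar.substClass.semV d hρ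

theorem SemV.rename_id {g : 𝓜.env Γ ⟶ 𝓜.ty X} (h : 𝓜.SemV Γ V X g)
    (hρ : 𝓜.Rename Δ Γ id f) : 𝓜.SemV Δ V X (f ≫ g) := by
  have := h.rename hρ
  rwa [Val.rename_id] at this

theorem SemC.rename {g : 𝓜.env Γ ⟶ (𝓜.T τ).obj (𝓜.ty X)} (h : 𝓜.SemC Γ M X τ g)
    (hρ : 𝓜.Rename Δ Γ ρ f) : 𝓜.SemC Δ (M.rename ρ) X τ (f ≫ g) := by
  obtain ⟨d, rfl⟩ := h
  rw [Comp.rename_eq_subst]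
  exact 𝓜.termClass_isVar.substClass.semC d hρ

theorem SemC.rename_id {g : 𝓜.env Γ ⟶ (𝓜.T τ).obj (𝓜.ty X)} (h : 𝓜.SemC Γ M X τ g)
    (hρ : 𝓜.Rename Δ Γ id f) : 𝓜.SemC Δ M X τ (f ≫ g) := by
  have := h.rename hρ
  rwa [Comp.rename_id] at this

variable (𝓜) in
theorem termClass_semV : 𝓜.TermClass 𝓜.SemV where
  semV := id
  var := SemV.var .here
  weaken h hw := h.rename hw.rename

theorem SemV.subst {σ : ℕ → Val S} {g : 𝓜.env Γ ⟶ 𝓜.ty X} (h : 𝓜.SemV Γ V X g)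
    (hσ : 𝓜.Subst 𝓜.SemV Δ Γ σ f) : 𝓜.SemV Δ (V.subst σ) X (f ≫ g) := by
  obtain ⟨d, rfl⟩ := h
  exact 𝓜.termClass_semV.substClass.semV d hσ

theorem SemC.subst {σ : ℕ → Val S} {g : 𝓜.env Γ ⟶ (𝓜.T τ).obj (𝓜.ty X)}
    (h : 𝓜.SemC Γ M X τ g) (hσ : 𝓜.Subst 𝓜.SemV Δ Γ σ f) :
    𝓜.SemC Δ (M.subst σ) X τ (f ≫ g) := by
  obtain ⟨d, rfl⟩ := h
  exact 𝓜.termClass_semV.substClass.semC d hσ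

/-! ### The renamings and substitutions of the equational theory -/

/-- A term over `Γ` is also a term over `Γ, ⟨τ⟩`. -/
theorem rename_now : 𝓜.Rename (.mod Γ τ) Γ id (𝓜.mods.now τ (𝓜.env Γ)) :=
  Rename.congr (((Subst.id 𝓜.termClass_isVar Γ).weaken_id 𝓜.termClass_isVar .mod_zero).weaken_id
    𝓜.termClass_isVar (.pra pra_mod_self)) (𝓜.mods.map_η_now_now _)

/-- A term over `Γ - τ, ⟨τ⟩` is also a term over `Γ`. -/
theorem Pra.rename {Γ' : Ctx S.Base} {p : 𝓜.env Γ ⟶ (𝓜.past τ).obj (𝓜.env Γ')}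
    (hp : 𝓜.Pra Γ τ Γ' p) : 𝓜.Rename Γ (.mod Γ' τ) id p :=
  (Subst.mod hp (Subst.id 𝓜.termClass_isVar Γ')).congr rfl (comp_map_id _ _)

/-- Inversion of the rule `Subst.mod`, with an equation in place of the form of the
interpretation. -/
theorem Subst.mod_inv
    {Q : (Δ : Ctx S.Base) → Val S → (X : VTy S.Base) → (𝓜.env Δ ⟶ 𝓜.ty X) → Prop}
    {σ : ℕ → Val S} {g : 𝓜.env Δ ⟶ 𝓜.env (.mod Γ τ)} (h : 𝓜.Subst Q Δ (.mod Γ τ) σ g) :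
    ∃ Δ' p f, 𝓜.Pra Δ τ Δ' p ∧ 𝓜.Subst Q Δ' Γ σ f ∧ g = p ≫ (𝓜.past τ).map f := by
  cases h with
  | mod hp h => exact ⟨_, _, _, hp, h, rfl⟩

/-- A term over `Γ, ⟨a + b⟩` is also a term over `Γ, ⟨a⟩, ⟨b⟩`. -/
theorem rename_mu {a b : ℕ} (h : a + b ≤ b + a) :
    𝓜.Rename (.mod (.mod Γ a) b) (.mod Γ (a + b)) id (𝓜.mods.mu h (𝓜.env Γ)) := by
  obtain ⟨Δ', p, f, hp, hf, e⟩ := ((Subst.id 𝓜.termClass_isVar (.mod Γ a)).weaken_id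
    𝓜.termClass_isVar .mod_zero).mod_inv
  exact (Subst.mod (pra_mod_self.comp hp (Nat.add_comm a b)) hf).congr rfl
    (𝓜.mods.map_η_comp_mu _ e)

theorem SemC.merge {a b : ℕ} (h : a + b ≤ b + a)
    {g : (𝓜.past (a + b)).obj (𝓜.env Γ) ⊗ 𝓜.ty X ⟶ (𝓜.T τ).obj (𝓜.ty Y)}
    (hN : 𝓜.SemC (.var (.mod Γ (a + b)) X) N Y τ g) :
    𝓜.SemC (.var (.mod (.mod Γ a) b) X) N Y τ ((𝓜.mods.mu h (𝓜.env Γ) ▷ 𝓜.ty X) ≫ g) :=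
  hN.rename_id ((rename_mu h).var_id X)

theorem SemC.merge_weaken {a b : ℕ} (h : a + b ≤ b + a)
    {g : (𝓜.past (a + b)).obj (𝓜.env Γ) ⊗ 𝓜.ty X ⟶ (𝓜.T τ).obj (𝓜.ty Y)}
    (hN : 𝓜.SemC (.var (.mod Γ (a + b)) X) N Y τ g) :
    𝓜.SemC (.var (.mod (.var (.mod Γ a) Z) b) X) (N.rename (liftRen Nat.succ)) Y τ
      ((((𝓜.past b).map (fst ((𝓜.past a).obj (𝓜.env Γ)) (𝓜.ty Z)) ≫ 𝓜.mods.mu h (𝓜.env Γ)) ▷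
        𝓜.ty X) ≫ g) :=
  ((hN.merge h).rename ((Weaken.var.rename.mod b).var X)).congr
    (whiskerRight_whiskerRight_comp _ _ _)

theorem subst_sub1 {g : 𝓜.env Γ ⟶ 𝓜.ty X} (h : 𝓜.SemV Γ V X g) :
    𝓜.Subst 𝓜.SemV Γ (.var Γ X) (sub1 V) (lift (𝟙 (𝓜.env Γ)) g) :=
  Subst.var (Subst.id 𝓜.termClass_semV Γ) h

/-- The substitution of a value for the last variable of `Γ, ⟨0⟩, x : X`, which also removes the
modality `⟨0⟩`. -/
theorem subst_sub1_mod_zero {g : 𝓜.env Γ ⟶ 𝓜.ty X} (h : 𝓜.SemV Γ V X g) :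
    𝓜.Subst 𝓜.SemV Γ (.var (.mod Γ 0) X) (sub1 V)
      (lift (𝓜.mods.η.hom.app (𝓜.env Γ)) g) :=
  Subst.var ((Subst.mod .zero (Subst.id 𝓜.termClass_semV Γ)).congr rfl (comp_map_id _ _)) h

theorem subst_sub2 {g : 𝓜.env Γ ⟶ 𝓜.ty X} {g' : 𝓜.env Γ ⟶ 𝓜.ty Y} (h : 𝓜.SemV Γ V X g)
    (h' : 𝓜.SemV Γ W Y g') :
    𝓜.Subst 𝓜.SemV Γ (.var (.var Γ X) Y) (sub2 V W) (lift (lift (𝟙 (𝓜.env Γ)) g) g') :=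
  Subst.var (Subst.var (Subst.id 𝓜.termClass_semV Γ) h) h'

theorem subst_subOver1 {g : 𝓜.env Γ ⊗ 𝓜.ty X ⟶ 𝓜.ty Z} (h : 𝓜.SemV (.var Γ X) V Z g) :
    𝓜.Subst 𝓜.SemV (.var Γ X) (.var Γ Z) (subOver1 V) (lift (fst (𝓜.env Γ) (𝓜.ty X)) g) :=
  Subst.var (((Subst.id 𝓜.termClass_semV Γ).weaken 𝓜.termClass_semV .var).congr rfl
    (Category.comp_id _)) h

theorem subst_subOver2 {g : (𝓜.env Γ ⊗ 𝓜.ty X) ⊗ 𝓜.ty Y ⟶ 𝓜.ty Z}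
    (h : 𝓜.SemV (.var (.var Γ X) Y) V Z g) :
    𝓜.Subst 𝓜.SemV (.var (.var Γ X) Y) (.var Γ Z) (subOver2 V)
      (lift (fst (𝓜.env Γ ⊗ 𝓜.ty X) (𝓜.ty Y) ≫ fst (𝓜.env Γ) (𝓜.ty X)) g) :=
  Subst.var ((((Subst.id 𝓜.termClass_semV Γ).weaken 𝓜.termClass_semV .var).weaken
    𝓜.termClass_semV .var).congr rfl (congrArg (fst _ _ ≫ ·) (Category.comp_id _))) h

/-- The interpretation of the substitution of one variable depends only on the interpretation of
the substituted value. -/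
theorem exists_subst_subAt (g : 𝓜.env Γ ⟶ 𝓜.ty X) : ∀ Γ' : Ctx S.Base,
    ∃ f : 𝓜.env (Γ.append Γ') ⟶ 𝓜.env ((Ctx.var Γ X).append Γ'), ∀ V : Val S, 𝓜.SemV Γ V X g →
      𝓜.Subst 𝓜.SemV (Γ.append Γ') ((Ctx.var Γ X).append Γ') (subAt V Γ'.length) f
  | .nil => ⟨_, fun _ h => subst_sub1 h⟩
  | .var Γ' Y => by
    obtain ⟨f, hf⟩ := exists_subst_subAt g Γ'
    exact ⟨_, fun V h => 𝓜.termClass_semV.substClass.var (hf V h) Y⟩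
  | .mod Γ' τ => by
    obtain ⟨f, hf⟩ := exists_subst_subAt g Γ'
    exact ⟨_, fun V h => 𝓜.termClass_semV.substClass.mod (hf V h) τ⟩
  | .gap Γ' => by
    obtain ⟨f, hf⟩ := exists_subst_subAt g Γ'
    exact ⟨_, fun V h => Subst.gap (σ := liftSub (subAt V Γ'.length))
      ((hf V h).weaken 𝓜.termClass_semV .gap)⟩

/-- Grades can be changed back when the interpretation is visibly a cast. The computation axioms
relate grades that agree only up to associativity and unit laws. -/
theorem SemC.uncast {e : τ = τ'} {g : 𝓜.env Γ ⟶ (𝓜.T τ).obj (𝓜.ty X)}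
    (h : 𝓜.SemC Γ M X τ' (g ≫ 𝓜.castT e _)) : 𝓜.SemC Γ M X τ g := by
  subst e
  exact h.congr (Category.comp_id g)

end Model

/-! ### Sound equations -/

namespace Model

variable {S : Signature.{u}} {C : Type v} [Category.{w} C] [CartesianMonoidalCategory C]
  [MonoidalClosed C] [HasProductsOfShape ℕ C] [HasProductsOfShape S.Op C] {𝓜 : Model S C}

variable (𝓜) in
/-- Both values have type `X` in the context `Γ`, with the same interpretation. -/
def SoundV (Γ : Ctx S.Base) (V W : Val S) (X : VTy S.Base) : Prop :=
  ∃ g, 𝓜.SemV Γ V X g ∧ 𝓜.SemV Γ W X g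

variable (𝓜) in
/-- Both computations have type `X ! τ` in the context `Γ`, with the same interpretation. -/
def SoundC (Γ : Ctx S.Base) (M N : Comp S) (X : VTy S.Base) (τ : ℕ) : Prop :=
  ∃ g, 𝓜.SemC Γ M X τ g ∧ 𝓜.SemC Γ N X τ g

variable {Γ Γ' : Ctx S.Base} {X Y Z : VTy S.Base} {τ τ' τ'' : ℕ} {U V V' W W' I J : Val S}
  {M M' N N' P : Comp S} {H H' : S.Op → Comp S}

theorem _root_.LambdaTau.HasV.sem (d : HasV S Γ V X) : 𝓜.SemV Γ V X (𝓜.semV d) := ⟨d, rfl⟩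

theorem _root_.LambdaTau.HasC.sem (d : HasC S Γ M X τ) : 𝓜.SemC Γ M X τ (𝓜.semC d) := ⟨d, rfl⟩

theorem SemV.nonempty {g : 𝓜.env Γ ⟶ 𝓜.ty X} (h : 𝓜.SemV Γ V X g) : Nonempty (HasV S Γ V X) :=
  let ⟨d, _⟩ := h; ⟨d⟩

theorem SemC.nonempty {g : 𝓜.env Γ ⟶ (𝓜.T τ).obj (𝓜.ty X)} (h : 𝓜.SemC Γ M X τ g) :
    Nonempty (HasC S Γ M X τ) :=
  let ⟨d, _⟩ := h; ⟨d⟩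

/-! ### Congruence and substitutivity -/

theorem SoundV.trans (h : 𝓜.SoundV Γ U V X) (h' : 𝓜.SoundV Γ V W X) : 𝓜.SoundV Γ U W X := by
  obtain ⟨g, hU, hV⟩ := h
  obtain ⟨g', hV', hW⟩ := h'
  obtain rfl := hV.unique hV'
  exact ⟨g, hU, hW⟩

theorem SoundC.trans (h : 𝓜.SoundC Γ M N X τ) (h' : 𝓜.SoundC Γ N P X τ) :
    𝓜.SoundC Γ M P X τ := by
  obtain ⟨g, hM, hN⟩ := h
  obtain ⟨g', hN', hP⟩ := h'
  obtain rfl := hN.unique hN'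
  exact ⟨g, hM, hP⟩

theorem SoundV.const (f : S.Const) {Vs Ws : Fin (S.arity f) → Val S}
    (h : ∀ i, 𝓜.SoundV Γ (Vs i) (Ws i) (S.constDom f i).toVTy) :
    𝓜.SoundV Γ (.const f Vs) (.const f Ws) (S.constCod f).toVTy := by
  choose gs h h' using h
  exact ⟨_, SemV.const f h, SemV.const f h'⟩

theorem SoundV.subst (h : 𝓜.SoundV ((Ctx.var Γ X).append Γ') I J Y) (h' : 𝓜.SoundV Γ V W X) :
    𝓜.SoundV (Γ.append Γ') (I.subst (subAt V Γ'.length)) (J.subst (subAt W Γ'.length)) Y := by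
  obtain ⟨g, hI, hJ⟩ := h
  obtain ⟨g', hV, hW⟩ := h'
  obtain ⟨f, hf⟩ := exists_subst_subAt g' Γ'
  exact ⟨_, hI.subst (hf V hV), hJ.subst (hf W hW)⟩

theorem SoundC.subst (h : 𝓜.SoundC ((Ctx.var Γ X).append Γ') M N Y τ) (h' : 𝓜.SoundV Γ V W X) :
    𝓜.SoundC (Γ.append Γ') (M.subst (subAt V Γ'.length)) (N.subst (subAt W Γ'.length)) Y τ := by
  obtain ⟨g, hI, hJ⟩ := h
  obtain ⟨g', hV, hW⟩ := h'
  obtain ⟨f, hf⟩ := exists_subst_subAt g' Γ'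
  exact ⟨_, hI.subst (hf V hV), hJ.subst (hf W hW)⟩

theorem SoundC.handle (h : 𝓜.SoundC Γ M M' X τ) (h' : 𝓜.SoundC (.var (.mod Γ τ) X) N N' Y τ')
    (hs : ∀ (o : S.Op) (θ : ℕ),
      𝓜.SoundC (.var (.var Γ (S.argTy o)) (.box (S.opTime o) (.fn (S.resTy o) Y θ)))
        (H o) (H' o) Y (S.opTime o + θ)) :
    𝓜.SoundC Γ (.handle M H N) (.handle M' H' N') Y (τ + τ') := by
  obtain ⟨_, hM, hM'⟩ := h
  obtain ⟨_, hN, hN'⟩ := h'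
  choose gs hH hH' using hs
  exact ⟨_, SemC.handle hM hN hH, SemC.handle hM' hN' hH'⟩

/-! ### The equations between values -/

theorem soundV_unit_eta (d : HasV S Γ V .unit) : 𝓜.SoundV Γ .unit V .unit :=
  ⟨_, SemV.unit, d.sem.congr (toUnit_unique _ _)⟩

theorem soundV_fn_eta (d : HasV S Γ V (.fn X Y τ)) :
    𝓜.SoundV Γ (.lam X (.app (V.rename Nat.succ) (.var 0))) V (.fn X Y τ) :=
  ⟨_, (SemV.lam (SemC.app (d.sem.rename Weaken.var.rename) (SemV.var .here))).congr (cur_eval _),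
    d.sem⟩

/-! ### The equations between computations -/

theorem soundC_fn_beta (d : HasC S (.var Γ X) M Y τ) (e : HasV S Γ V X) :
    𝓜.SoundC Γ (.app (.lam X M) V) (M.subst (sub1 V)) Y τ :=
  ⟨_, (SemC.app (SemV.lam d.sem) e.sem).congr (lift_cur_eval _ _),
    d.sem.subst (subst_sub1 e.sem)⟩

theorem soundC_prod_beta (d : HasV S Γ V X) (d' : HasV S Γ W Y)
    (e : HasC S (.var (.var Γ X) Y) N Z τ) :
    𝓜.SoundC Γ (.split (.pair V W) N) (N.subst (sub2 V W)) Z τ :=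
  ⟨_, (SemC.split (SemV.pair d.sem d'.sem) e.sem).congr (splitS_lift _ _ _),
    e.sem.subst (subst_sub2 d.sem d'.sem)⟩

theorem soundC_prod_eta (d : HasV S Γ V (.prod X Y)) (e : HasC S (.var Γ (.prod X Y)) N Z τ) :
    𝓜.SoundC Γ (.split V (N.subst (subOver2 (.pair (.var 1) (.var 0))))) (N.subst (sub1 V)) Z τ :=
  ⟨_, (SemC.split d.sem (e.sem.subst
      (subst_subOver2 (SemV.pair (SemV.var (.var .here)) (SemV.var .here))))).congr
      (splitS_eta _ _),
    e.sem.subst (subst_sub1 d.sem)⟩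

theorem soundC_let_ret (d : HasV S Γ V X) (e : HasC S (.var (.mod Γ 0) X) N Y τ) :
    𝓜.SoundC Γ (.letin (.ret V) N) (N.subst (sub1 V)) Y τ :=
  ⟨_, ((SemC.letin (SemC.ret d.sem) e.sem).congr (𝓜.letS_ret _ _)).uncast,
    e.sem.subst (subst_sub1_mod_zero d.sem)⟩

theorem soundC_let_let (d : HasC S Γ M X τ) (e : HasC S (.var (.mod Γ τ) X) N Y τ')
    (e' : HasC S (.var (.mod Γ (τ + τ')) Y) P Z τ'') :
    𝓜.SoundC Γ (.letin (.letin M N) P) (.letin M (.letin N (P.rename (liftRen Nat.succ))))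
      Z (τ + τ' + τ'') :=
  ⟨_, SemC.letin (SemC.letin d.sem e.sem) e'.sem,
    ((SemC.letin d.sem (SemC.letin e.sem (e'.sem.merge_weaken (Nat.add_comm τ τ').le))).congr
      (𝓜.letS_letS _ _ _ _).symm).uncast⟩

theorem soundC_let_eta (d : HasC S Γ M X τ) :
    𝓜.SoundC Γ (.letin M (.ret (.var 0))) M X τ :=
  ⟨_, (SemC.letin d.sem (SemC.ret (SemV.var .here))).congr (𝓜.letS_eta _), d.sem⟩

theorem soundC_let_op (o : S.Op) (d : HasV S Γ V (S.argTy o))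
    (e : HasC S (.var (.mod Γ (S.opTime o)) (S.resTy o)) M X τ)
    (e' : HasC S (.var (.mod Γ (S.opTime o + τ)) X) N Y τ') :
    𝓜.SoundC Γ (.letin (.op o V M) N) (.op o V (.letin M (N.rename (liftRen Nat.succ))))
      Y (S.opTime o + τ + τ') :=
  ⟨_, (SemC.letin (SemC.op o d.sem e.sem) e'.sem).congr
      (𝓜.letS_opS o _ _ _ (Nat.add_comm _ _).le),
    (SemC.op o d.sem (SemC.letin e.sem (e'.sem.merge_weaken (Nat.add_comm _ _).le))).cast
      (Nat.add_assoc _ _ _).symm⟩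

theorem soundC_let_delay (d : HasC S (.mod Γ τ) M X τ')
    (e : HasC S (.var (.mod Γ (τ + τ')) X) N Y τ'') :
    𝓜.SoundC Γ (.letin (.delay τ M) N) (.delay τ (.letin M N)) Y (τ + τ' + τ'') :=
  ⟨_, (SemC.letin (SemC.delay d.sem) e.sem).congr (𝓜.letS_delayS _ _ (Nat.add_comm _ _).le),
    (SemC.delay (SemC.letin d.sem (e.sem.merge (Nat.add_comm _ _).le))).cast
      (Nat.add_assoc _ _ _).symm⟩

theorem soundC_handle_ret (d : HasV S Γ V X) (e : HasC S (.var (.mod Γ 0) X) N Y τ)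
    (hs : ∀ (o : S.Op) (θ : ℕ),
      HasC S (.var (.var Γ (S.argTy o)) (.box (S.opTime o) (.fn (S.resTy o) Y θ)))
        (H o) Y (S.opTime o + θ)) :
    𝓜.SoundC Γ (.handle (.ret V) H N) (N.subst (sub1 V)) Y τ :=
  ⟨_, ((SemC.handle (SemC.ret d.sem) e.sem fun o θ => (hs o θ).sem).congr
      (𝓜.handleS_ret _ _ _)).uncast,
    e.sem.subst (subst_sub1_mod_zero d.sem)⟩

theorem soundC_handle_delay (d : HasC S (.mod Γ τ) M X τ')
    (e : HasC S (.var (.mod Γ (τ + τ')) X) N Y τ'')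
    (hs : ∀ (o : S.Op) (θ : ℕ),
      HasC S (.var (.var Γ (S.argTy o)) (.box (S.opTime o) (.fn (S.resTy o) Y θ)))
        (H o) Y (S.opTime o + θ)) :
    𝓜.SoundC Γ (.handle (.delay τ M) H N) (.delay τ (.handle M H N)) Y (τ + τ' + τ'') :=
  ⟨_, (SemC.handle (SemC.delay d.sem) e.sem fun o θ => (hs o θ).sem).congr
      (𝓜.handleS_delayS _ _ _ (Nat.add_comm _ _).le),
    (SemC.delay (SemC.handle d.sem (e.sem.merge (Nat.add_comm _ _).le) fun o θ =>
      (hs o θ).sem.rename_id ((rename_now.var_id _).var_id _))).cast (Nat.add_assoc _ _ _).symm⟩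

theorem soundC_handle_op (o : S.Op) (d : HasV S Γ V (S.argTy o))
    (e : HasC S (.var (.mod Γ (S.opTime o)) (S.resTy o)) M X τ)
    (e' : HasC S (.var (.mod Γ (S.opTime o + τ)) X) N Y τ')
    (hs : ∀ (o : S.Op) (θ : ℕ),
      HasC S (.var (.var Γ (S.argTy o)) (.box (S.opTime o) (.fn (S.resTy o) Y θ)))
        (H o) Y (S.opTime o + θ)) :
    𝓜.SoundC Γ (.handle (.op o V M) H N)
      ((H o).subst (sub2 V (.box (S.opTime o) (.lam (S.resTy o)
        (.handle M (fun o' => (H o').rename (liftRen (liftRen Nat.succ)))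
          (N.rename (liftRen Nat.succ)))))))
      Y (S.opTime o + τ + τ') :=
  ⟨_, (SemC.handle (SemC.op o d.sem e.sem) e'.sem fun o' θ => (hs o' θ).sem).congr
      (𝓜.handleS_opS o _ _ _ _ (Nat.add_comm _ _).le),
    ((hs o (τ + τ')).sem.subst (subst_sub2 d.sem (SemV.box (SemV.lam (SemC.handle e.sem
      (e'.sem.merge_weaken (Nat.add_comm _ _).le) fun o' θ =>
        (((hs o' θ).sem.rename_id ((rename_now.var_id _).var_id _)).rename
          ((Weaken.var.rename.var _).var _)).congr (whiskerRight₂_comp _ _ _)))))).cast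
      (Nat.add_assoc _ _ _).symm⟩

theorem soundC_unbox_beta (h : τ ≤ Γ.time) (d : HasV S (.mod (Γ.minus τ) τ) V X)
    (e : HasC S (.var Γ X) N Y τ') :
    𝓜.SoundC Γ (.unbox τ (.box τ V) N) (N.subst (sub1 V)) Y τ' :=
  ⟨_, (SemC.unbox (pra_minus h) (SemV.box d.sem) e.sem).congr (𝓜.unboxS_boxS _ _ _),
    e.sem.subst (subst_sub1 (d.sem.rename_id (pra_minus h).rename))⟩

theorem soundC_unbox_eta (h : τ ≤ Γ.time) (d : HasV S (Γ.minus τ) V (.box τ X))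
    (e : HasC S (.var Γ (.box τ X)) N Y τ') :
    𝓜.SoundC Γ (.unbox τ V (N.subst (subOver1 (.box τ (.var 0))))) (N.subst (sub1 V)) Y τ' :=
  ⟨_, (SemC.unbox (pra_minus h) d.sem
      (e.sem.subst (subst_subOver1 (SemV.box (SemV.var (.mod .here)))))).congr
      (𝓜.unboxS_eta _ _ _),
    (e.sem.subst (subst_sub1 (d.sem.rename_id (Weaken.pra (pra_minus h)).rename))).congr
      (congrArg (lift (𝟙 _) · ≫ _) (Category.assoc _ _ _))⟩

mutual

/-- Soundness of the equational theory for values. -/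
theorem soundV {Γ : Ctx S.Base} {I J : Val S} {X : VTy S.Base} :
    EqV S Γ I J X → 𝓜.SoundV Γ I J X
  | .refl d => ⟨_, d.sem, d.sem⟩
  | .symm h => let ⟨g, hI, hJ⟩ := soundV h; ⟨g, hJ, hI⟩
  | .trans h h' => (soundV h).trans (soundV h')
  | .const f h => .const f fun i => soundV (h i)
  | .pair h h' =>
    let ⟨_, hV, hV'⟩ := soundV h
    let ⟨_, hW, hW'⟩ := soundV h'
    ⟨_, SemV.pair hV hW, SemV.pair hV' hW'⟩
  | .lam h => let ⟨_, hM, hM'⟩ := soundC h; ⟨_, SemV.lam hM, SemV.lam hM'⟩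
  | .box h => let ⟨_, hV, hV'⟩ := soundV h; ⟨_, SemV.box hV, SemV.box hV'⟩
  | .subst h h' => (soundV h).subst (soundV h')
  | .unit_eta d => soundV_unit_eta d
  | .fn_eta d => soundV_fn_eta d

/-- Soundness of the equational theory for computations. -/
theorem soundC {Γ : Ctx S.Base} {I J : Comp S} {X : VTy S.Base} {τ : ℕ} :
    EqC S Γ I J X τ → 𝓜.SoundC Γ I J X τ
  | .refl d => ⟨_, d.sem, d.sem⟩
  | .symm h => let ⟨g, hI, hJ⟩ := soundC h; ⟨g, hJ, hI⟩
  | .trans h h' => (soundC h).trans (soundC h')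
  | .ret h => let ⟨_, hV, hV'⟩ := soundV h; ⟨_, SemC.ret hV, SemC.ret hV'⟩
  | .letin h h' =>
    let ⟨_, hM, hM'⟩ := soundC h
    let ⟨_, hN, hN'⟩ := soundC h'
    ⟨_, SemC.letin hM hN, SemC.letin hM' hN'⟩
  | .app h h' =>
    let ⟨_, hV, hV'⟩ := soundV h
    let ⟨_, hW, hW'⟩ := soundV h'
    ⟨_, SemC.app hV hW, SemC.app hV' hW'⟩
  | .split h h' =>
    let ⟨_, hV, hV'⟩ := soundV h
    let ⟨_, hN, hN'⟩ := soundC h'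
    ⟨_, SemC.split hV hN, SemC.split hV' hN'⟩
  | .op o h h' =>
    let ⟨_, hV, hV'⟩ := soundV h
    let ⟨_, hM, hM'⟩ := soundC h'
    ⟨_, SemC.op o hV hM, SemC.op o hV' hM'⟩
  | .delay h => let ⟨_, hM, hM'⟩ := soundC h; ⟨_, SemC.delay hM, SemC.delay hM'⟩
  | .handle h h' hs => (soundC h).handle (soundC h') fun o θ => soundC (hs o θ)
  | .unbox p h h' =>
    let ⟨_, hV, hV'⟩ := soundV h
    let ⟨_, hN, hN'⟩ := soundC h'
    ⟨_, SemC.unbox (pra_minus p) hV hN, SemC.unbox (pra_minus p) hV' hN'⟩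
  | .subst h h' => (soundC h).subst (soundV h')
  | .fn_beta d e => soundC_fn_beta d e
  | .prod_beta d d' e => soundC_prod_beta d d' e
  | .prod_eta d e => soundC_prod_eta d e
  | .let_ret d e => soundC_let_ret d e
  | .let_let d e e' => soundC_let_let d e e'
  | .let_eta d => soundC_let_eta d
  | .let_op o d e e' => soundC_let_op o d e e'
  | .let_delay d e => soundC_let_delay d e
  | .handle_ret d e hs => soundC_handle_ret d e hs
  | .handle_op o d e e' hs => soundC_handle_op o d e e' hs
  | .handle_delay d e hs => soundC_handle_delay d e hs
  | .unbox_beta h d e => soundC_unbox_beta h d e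
  | .unbox_eta h d e => soundC_unbox_eta h d e

end

end Model

end

end LambdaTau

theorem theorem3 {S : Signature.{u}} {C : Type v} [Category.{w} C] [CartesianMonoidalCategory C]
    [MonoidalClosed C] [Limits.HasProductsOfShape ℕ C] [Limits.HasProductsOfShape S.Op C]
    (𝓜 : Model S C) :
    (∀ (Γ : Ctx S.Base) (I J : Val S) (X : VTy S.Base), EqV S Γ I J X →
      Nonempty (HasV S Γ I X) ∧ Nonempty (HasV S Γ J X) ∧
        ∀ (d : HasV S Γ I X) (e : HasV S Γ J X), 𝓜.semV d = 𝓜.semV e) ∧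
    (∀ (Γ : Ctx S.Base) (I J : Comp S) (X : VTy S.Base) (τ : ℕ), EqC S Γ I J X τ →
      Nonempty (HasC S Γ I X τ) ∧ Nonempty (HasC S Γ J X τ) ∧
        ∀ (d : HasC S Γ I X τ) (e : HasC S Γ J X τ), 𝓜.semC d = 𝓜.semC e) := by
  refine ⟨fun Γ I J X h => ?_, fun Γ I J X τ h => ?_⟩
  · obtain ⟨g, hI, hJ⟩ := Model.soundV (𝓜 := 𝓜) h
    exact ⟨hI.nonempty, hJ.nonempty, fun d e => (d.sem.unique hI).trans (hJ.unique e.sem)⟩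
  · obtain ⟨g, hI, hJ⟩ := Model.soundC (𝓜 := 𝓜) h
    exact ⟨hI.nonempty, hJ.nonempty, fun d e => (d.sem.unique hI).trans (hJ.unique e.sem)⟩
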